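/- **Conventions.** A *partial monoid* is a simplicial set $X$ with exactly one vertex whose spine maps $X_n\to (X_1)^n$ (the $n$ consecutive edges) are injective for $n\ge 1$; write $[x_1|\dots|x_n]$ for the $n$-simplex with spine $(x_1,\dots,x_n)$, if it exists, $x_1\cdots x_n$ for its edge from the first to the last vertex, and $1$ for the degenerate edge. A *partial group* is a partial monoid with an anti-involution $\nu$ ($\nu\colon X\to X^{\mathrm{op}}$, $\nu^{-1}=\nu^{\mathrm{op}}$) such that, for every simplex $u$ of positive dimension, $[\nu(u)|u]$ exists and has product $1$; put $x^{-1}=\nu(x)$. For simplicial maps $f,g\colon Y\to X$ ($Y$ a partial monoid) and $\eta\in X_1$, write $f\xleftarrow{\eta}g$ if there is a simplicial map $F\colon Y\times\Delta[1]\to X$ which is $f$ at the vertex $0$ and $g$ at the vertex $1$ of $\Delta[1]$, with $F(1,\iota_1)=\eta$, where $\iota_1$ is the nondegenerate edge of $\Delta[1]$. Let $N(M)=\{\eta\in M_1 : f\xleftarrow{\eta}\mathrm{id}_M \text{ for some } f\}$. An *extension* $M\xrightarrow{\imath}E\xrightarrow{\tau}H$ of partial groups consists of a fibre bundle $\tau$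 with fibre $M$ (that is, $\tau$ is surjective, and the pullback of $\tau$ along any $b\colon\Delta[n]\to H$ is isomorphic to $M\times\Delta[n]$ over $\Delta[n]$) and an isomorphism $\imath$ of $M$ onto the fibre of $\tau$ over the vertex of $H$. Let $N_E(M)$ be the set of simplices $[\eta_1|\dots|\eta_n]$ of $E$ such that for each $i$ there is $f$ with $f\xleftarrow{\eta_i}\imath$. A *section* is a simplicial map $\sigma\colon H\to E$ with $\tau\sigma=\mathrm{id}$; it is *regular* if $\sigma(H)\subseteq N_E(M)$. $\mathfrak X(\tau)$ is the set of sections modulo the equivalence relation generated by homotopy. A *twisting pair* $\phi=(t,\eta)$ consists of $t\colon H_1\to\mathrm{Aut}(M)$ and $\eta\colon H_2\to N(M)$ with $t(g)t(h)\xleftarrow{\eta(g,h)}t(gh)$ for $[g|h]\in H_2$, $t(1)=\mathrm{id}$, $\eta(g,1)=1=\eta(1,g)$, and $t(g)(\eta(h,k))\cdot\eta(g,hk)=\eta(g,h)\cdot\eta(gh,k)$ for $[g|h|k]\in H_3$. $H^2(H;N(M))$ is the set of twisting pairs modulo the equivalence relation generated by: $(t,\eta)\sim(t',\eta')$ if there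 is $\theta\colon H_1\to N(M)$ with $t'(g)\xleftarrow{\theta(g)}t(g)$ for all $g\in H_1$ and $\eta'(g,h)\,\theta(gh)=\theta(g)\,t(g)(\theta(h))\,\eta(g,h)$ for all $[g|h]\in H_2$. A class *vanishes* if it contains some $(t,\eta)$ with $\eta=1$. The twisted product $M\times_\phi H$ is the partial monoid with edges $(x,g)\in M_1\times H_1$ in which $[(x_1,g_1)|\dots|(x_n,g_n)]$ exists if and only if $[g_1|\dots|g_n]\in H_n$ and $[x_1|t(g_1)(x_2)|\dots|(t(g_1)\cdots t(g_{n-1}))(x_n)]\in M_n$, with product $(x,g)(z,h)=(x\cdot t(g)(z)\cdot\eta(g,h),\,gh)$, inclusion $x\mapsto(x,1)$ and projection $(x,g)\mapsto g$. An *action* of $H$ on $M$ is a simplicial map $\rho\colon H\to B\mathrm{Aut}(M)$; write ${}^hx=\rho(h)(x)$. A *derivation* is a family of maps $\theta_n\colon H_n\to M_n$, $n\ge0$, commuting with all degeneracies and with all faces $d_i$, $i\ge1$, and with $d_0\theta_n([h_1|\dots|h_n])={}^{h_1}\theta_{n-1}(d_0[h_1|\dots|h_n])$; write $\theta=\theta_1$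 on edges. A derivation is *regular* if all edges in the spines of its values lie in $N(M)$. $H^1(H;M)$ is the set of derivations modulo the equivalence relation generated by: $\theta\sim\theta'$ if there is $y\in M_1$ such that for every simplex $[h_1|\dots|h_n]$ of $H$, $n\ge 0$, the simplices $$\bigl[\theta(h_1)\,|\,{}^{h_1}\theta(h_2)\,|\dots|\,{}^{h_1\cdots h_{k-1}}\theta(h_k)\,|\,{}^{h_1\cdots h_k}y\,|\,{}^{h_1\cdots h_k}\theta'(h_{k+1})\,|\dots|\,{}^{h_1\cdots h_{n-1}}\theta'(h_n)\bigr],\quad 0\le k\le n,$$ exist in $M$ and all have the same product. **Theorem.** Let $M\xrightarrow{\imath}E\xrightarrow{\tau}H$ be an extension of partial groups. (a) There is exactly one class $[\eta]\in H^2(H;N(M))$ which is represented by a twisting pair $\phi=(t,\eta)$ such that the extension is equivalent to $M\times_\phi H$ (isomorphic to it, compatibly with the inclusions of $M$ and the projections to $H$). The extension admits a regular section if and only if $[\eta]$ vanishes. Moreover, for every such $\phi=(t,\eta)$, a regular section exists if and only if $\eta$ is a coboundary, i.e. there is $\theta\colon H_1\to N(M)$ with $\theta(gh)=\theta(g)\cdot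 t(g)(\theta(h))\cdot\eta(g,h)$ for all $[g|h]\in H_2$. (b) For a regular section $\sigma_0$ there is exactly one action $\rho$ of $H$ on $M$ given by conjugation in $E$, that is, such that $\imath\circ\rho(h)\xleftarrow{\sigma_0(h)}\imath$ and $\imath({}^hx)=\sigma_0(h)\cdot\imath(x)\cdot\sigma_0(h^{-1})$ for all $h\in H_1$, $x\in M_1$. For this action there is a bijection $\theta\mapsto\sigma_\theta$ from the derivations $H\to M$ to the sections of $\tau$, with $\sigma_\theta(h)=\imath(\theta(h))\cdot\sigma_0(h)$ for $h\in H_1$, under which regular derivations correspond exactly to regular sections, and it induces a bijection $H^1(H;M)\to\mathfrak X(\tau)$. -/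

import Mathlib

open CategoryTheory Opposite MonoidalCategory CartesianMonoidalCategory Simplicial

universe u

namespace PartialGroups

/-! ### Edges and products of simplices -/

/-- The edge of an `n`-simplex from its `i`-th to its `j`-th vertex.  For a simplex
`[x₁|...|xₙ]` of a partial group this is the product of `x_{i+1}, ..., x_j`
(the unit if `i = j`). -/
def edge (X : SSet.{u}) {n : ℕ} (i j : Fin (n + 1)) (hij : i ≤ j) (s : X _⦋n⦌) : X _⦋1⦌ :=
  X.map (SimplexCategory.mkOfLe i j hij).op s

/-- The spine operator: the family of the `n` consecutive edges of an `n`-simplex.  A simplex with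
spine `(x₁, ..., xₙ)` is written `[x₁|...|xₙ]`. -/
def spine (X : SSet.{u}) {n : ℕ} (s : X _⦋n⦌) : Fin n → X _⦋1⦌ :=
  fun i => X.map (SimplexCategory.mkOfSucc i).op s

/-- The product operator: the edge from the first to the last vertex. -/
def prod (X : SSet.{u}) {n : ℕ} (s : X _⦋n⦌) : X _⦋1⦌ :=
  X.map (SimplexCategory.diag n).op s

/-- `IsProd X x p`: the simplex `[x₁|...|xₙ]` exists in `X` and its product `x₁ ⬝ ... ⬝ xₙ`
is `p`. -/
def IsProd (X : SSet.{u}) {n : ℕ} (x : Fin n → X _⦋1⦌) (p : X _⦋1⦌) : Prop :=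
  ∃ s : X _⦋n⦌, spine X s = x ∧ prod X s = p

/-! ### Partial monoids and partial groups -/

/-- A partial monoid: a simplicial set with a unique vertex and injective spine operators. -/
class PartialMonoid (X : SSet.{u}) : Prop where
  existsUnique_vertex : ∃! _v : X _⦋0⦌, True
  spine_injective : ∀ n : ℕ, 1 ≤ n → Function.Injective (spine X (n := n))

/-- The unique vertex of a partial monoid. -/
noncomputable def vertex (X : SSet.{u}) [PartialMonoid X] : X _⦋0⦌ :=
  (PartialMonoid.existsUnique_vertex (X := X)).choose

/-- The unit of a partial monoid: the degenerate edge on the vertex. -/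
noncomputable def unit (X : SSet.{u}) [PartialMonoid X] : X _⦋1⦌ :=
  X.σ 0 (vertex X)

/-- A partial group: a partial monoid with an inversion, that is, an anti-involution
`ν : X ⟶ Xᵒᵖ` such that for every simplex `u` of positive dimension the simplex `[ν(u)|u]` exists
and has product `1`. -/
class PartialGroup (X : SSet.{u}) extends PartialMonoid X where
  inversion : X ⟶ X.op
  inversion_inversion : ∀ (n : ℕ) (x : X _⦋n⦌),
    SSet.opObjEquiv (inversion.app (op ⦋n⦌)
      (SSet.opObjEquiv (inversion.app (op ⦋n⦌) x))) = x
  inversion_mul : ∀ (n : ℕ), 1 ≤ n → ∀ x : X _⦋n⦌,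
    IsProd X (Fin.append (spine X (SSet.opObjEquiv (inversion.app (op ⦋n⦌) x) : X _⦋n⦌))
      (spine X x)) (unit X)

/-- The inverse of an edge of a partial group. -/
def inv (X : SSet.{u}) [PartialGroup X] (x : X _⦋1⦌) : X _⦋1⦌ :=
  SSet.opObjEquiv ((PartialGroup.inversion (X := X)).app (op ⦋1⦌) x)

/-! ### Homotopies and normalizers -/

/-- `η` determines a homotopy `f ←η g`: there is a map `F : Y × Δ[1] ⟶ X` restricting to `f` at
the vertex `0` and to `g` at the vertex `1` of `Δ[1]`, with `F(1, ι₁) = η`, where `ι₁` is the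
nondegenerate edge of `Δ[1]`. -/
def DeterminesHomotopy {Y X : SSet.{u}} [PartialMonoid Y] (η : X _⦋1⦌) (f g : Y ⟶ X) : Prop :=
  ∃ F : SSet.Homotopy f g,
    F.h.app (op ⦋1⦌) (unit Y, SSet.stdSimplex.objEquiv.symm (𝟙 ⦋1⦌)) = η

/-- The edges `η` of `E` which define a homotopy `f ←η i` of the given map `i : M ⟶ E`.
For `i = 𝟙 M` this is the normalizer `N(M)` of `M`; for `i` the inclusion of `M` in `E` these are
the edges of `N_E(M)`. -/
def normalizer {M E : SSet.{u}} [PartialMonoid M] (i : M ⟶ E) : Set (E _⦋1⦌) :=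
  {η | ∃ f : M ⟶ E, DeterminesHomotopy η f i}

/-- The simplices `[η₁|...|ηₙ]` of `E` all of whose `ηᵢ` define a homotopy of `i : M ⟶ E`.
For `i = 𝟙 M` these are the simplices of `BN(M)`; for the inclusion of `M` in `E` they are the
simplices of `N_E(M)`. -/
def normalizerSimplices {M E : SSet.{u}} [PartialMonoid M] (i : M ⟶ E) (n : ℕ) :
    Set (E _⦋n⦌) :=
  {s | ∀ k : Fin n, spine E s k ∈ normalizer i}

/-! ### Automorphisms and actions -/

/-- The automorphism `a` applied to a simplex.  The product of `Aut M` is composition: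
`(a * b)(x) = a (b x)`. -/
def applyAut {M : SSet.{u}} (a : Aut M) {n : ℕ} (x : M _⦋n⦌) : M _⦋n⦌ :=
  a.hom.app (op ⦋n⦌) x

/-- The bar construction `BG`, as the nerve of the one-object category with morphisms `G`.  The
opposite appears because composition in Mathlib is written in diagrammatic order, so that
`d₁ [g|h] = [g h]`. -/
def bar (G : Type u) [Group G] : SSet.{u} := nerve (SingleObj Gᵐᵒᵖ)

/-- The element of `G` which labels an edge of `BG`. -/
def barLabel {G : Type u} [Group G] (s : (bar G) _⦋1⦌) : G :=
  MulOpposite.unop (show Gᵐᵒᵖ from ComposableArrows.hom (show ComposableArrows _ 1 from s))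

/-- An action of `H` on `M` is a homomorphism `H ⟶ B Aut(M)`. -/
abbrev Action (H M : SSet.{u}) := H ⟶ bar (Aut M)

/-- The automorphism by which an edge `h` of `H` acts on `M`. -/
def Action.aut {H M : SSet.{u}} (ρ : Action H M) (h : H _⦋1⦌) : Aut M :=
  barLabel (ρ.app (op ⦋1⦌) h)

/-! ### Extensions and sections -/

/-- `f : E ⟶ B` is a fibre bundle with fibre `F`: it is surjective and, for every simplex
`b : Δ[n] ⟶ B`, the pullback of `f` along `b` is isomorphic over `Δ[n]` to `F × Δ[n]`. -/
structure IsFibreBundle (F : SSet.{u}) {E B : SSet.{u}} (f : E ⟶ B) : Prop where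
  surjective : ∀ n : ℕ, Function.Surjective (fun s : E _⦋n⦌ => f.app (op ⦋n⦌) s)
  locally_trivial : ∀ (n : ℕ) (b : (Δ[n] : SSet.{u}) ⟶ B),
    ∃ e : F ⊗ (Δ[n] : SSet.{u}) ⟶ E, IsPullback e (snd F (Δ[n] : SSet.{u})) f b

/-- `M ⟶ E ⟶ H` is an extension: `τ` is a fibre bundle with fibre `M`, and `i` identifies `M` with
the fibre of `τ` over a vertex of `H` (there is only one, if `H` is a partial group). -/
structure IsExtension {M E H : SSet.{u}} (i : M ⟶ E) (τ : E ⟶ H) : Prop where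
  isFibreBundle : IsFibreBundle M τ
  isPullback : ∃ (c : M ⟶ (Δ[0] : SSet.{u})) (v : (Δ[0] : SSet.{u}) ⟶ H), IsPullback i c τ v

/-- The set `Γ(τ)` of sections of `τ`. -/
def Section {E H : SSet.{u}} (τ : E ⟶ H) := {σ : H ⟶ E // σ ≫ τ = 𝟙 H}

/-- A section is regular if its image lies in `N_E(M)`. -/
def Section.IsRegular {M E H : SSet.{u}} [PartialMonoid M] {τ : E ⟶ H} (σ : Section τ)
    (i : M ⟶ E) : Prop :=
  ∀ (n : ℕ) (h : H _⦋n⦌), σ.1.app (op ⦋n⦌) h ∈ normalizerSimplices i n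

/-- The set `𝔛(τ)`: sections modulo the equivalence relation generated by homotopy (through
arbitrary maps `H × Δ[1] ⟶ E`). -/
def SectionClasses {E H : SSet.{u}} (τ : E ⟶ H) :=
  Quot (fun σ σ' : Section τ => Nonempty (SSet.Homotopy σ.1 σ'.1))

/-! ### Twisting pairs and the second non-abelian cohomology -/

/-- An `H`-twisting pair `(t, η)` for `M`, that is, a normalized non-abelian `2`-cocycle of `H`
with values in `N(M)`. For `s = [g|h]` we have `g = d₂ s`, `h = d₀ s`, `g h = d₁ s`. -/
structure TwistingPair (H M : SSet.{u}) [PartialGroup H] [PartialGroup M] where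
  t : H _⦋1⦌ → Aut M
  η : H _⦋2⦌ → M _⦋1⦌
  η_mem : ∀ s, η s ∈ normalizer (𝟙 M)
  homotopy : ∀ s : H _⦋2⦌,
    DeterminesHomotopy (η s) (t (H.δ 2 s) * t (H.δ 0 s)).hom (t (H.δ 1 s)).hom
  t_unit : t (unit H) = 1
  η_unit_left : ∀ g : H _⦋1⦌, η (H.σ 0 g) = unit M
  η_unit_right : ∀ g : H _⦋1⦌, η (H.σ 1 g) = unit M
  /-- For `s = [g|h|k]`: `t(g)(η(h,k)) ⬝ η(g,hk) = η(g,h) ⬝ η(gh,k)`. -/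
  cocycle : ∀ s : H _⦋3⦌, ∃ p : M _⦋1⦌,
    IsProd M ![applyAut (t (spine H s 0)) (η (H.δ 0 s)), η (H.δ 2 s)] p ∧
    IsProd M ![η (H.δ 3 s), η (H.δ 1 s)] p

section Cohomology

variable {H M : SSet.{u}} [PartialGroup H] [PartialGroup M]

/-- Two twisting pairs are cohomologous if there is `θ : H₁ → N(M)` with `t'(g) = c_{θ(g)} ∘ t(g)`
(where `c_x` is conjugation by `x`) and `η'(g,h) ⬝ θ(gh) = θ(g) ⬝ t(g)(θ(h)) ⬝ η(g,h)`. -/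
def TwistingPair.Cohomologous (φ φ' : TwistingPair H M) : Prop :=
  ∃ θ : H _⦋1⦌ → M _⦋1⦌, (∀ g, θ g ∈ normalizer (𝟙 M)) ∧
    (∀ g, DeterminesHomotopy (θ g) (φ'.t g).hom (φ.t g).hom) ∧
    ∀ s : H _⦋2⦌, ∃ p : M _⦋1⦌,
      IsProd M ![φ'.η s, θ (H.δ 1 s)] p ∧
      IsProd M ![θ (H.δ 2 s), applyAut (φ.t (H.δ 2 s)) (θ (H.δ 0 s)), φ.η s] p

/-- The cocycle `η` is a coboundary: there is `θ : H₁ → N(M)` with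
`θ(gh) = θ(g) ⬝ t(g)(θ(h)) ⬝ η(g,h)`, or
`η(g,h) = t(g)(θ(h)⁻¹) ⬝ θ(g)⁻¹ ⬝ θ(gh)`. -/
def TwistingPair.IsCoboundary (φ : TwistingPair H M) : Prop :=
  ∃ θ : H _⦋1⦌ → M _⦋1⦌, (∀ g, θ g ∈ normalizer (𝟙 M)) ∧
    ∀ s : H _⦋2⦌,
      IsProd M ![θ (H.δ 2 s), applyAut (φ.t (H.δ 2 s)) (θ (H.δ 0 s)), φ.η s] (θ (H.δ 1 s))

variable (H M) in
/-- The non-abelian cohomology set `H²(H; N(M))`: classes of twisting pairs. -/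
def H2 := Quot (TwistingPair.Cohomologous (H := H) (M := M))

/-- A class in `H²(H; N(M))` vanishes (is neutral) if it has a representative with trivial
second component. -/
def H2.Vanishes (c : H2 H M) : Prop :=
  ∃ φ : TwistingPair H M, Quot.mk _ φ = c ∧ ∀ s, φ.η s = unit M

/-- `E` is equivalent, as an extension of `H` by `M`, to the twisted product `M ×_φ H`.  The latter
is the partial monoid with edges the pairs `(x,g)`, in which `[(x₁,g₁)|...|(xₙ,gₙ)]` is a simplex
if and only if `[g₁|...|gₙ]` is a simplex of `H` and
`[x₁|t(g₁)(x₂)|...|(t(g₁) ∘ ... ∘ t(gₙ₋₁))(xₙ)]` is a simplex of `M`, with product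
`(x,g) ⬝ (z,h) = (x ⬝ t(g)(z) ⬝ η(g,h), gh)`, inclusion `x ↦ (x,1)` and projection
`(x,g) ↦ g`.  As a partial monoid is determined by its edges, its simplices as words in the
edges, and its product, the equivalence is given by a bijection on edges. -/
def IsTwistedProduct {E : SSet.{u}} (i : M ⟶ E) (τ : E ⟶ H) (φ : TwistingPair H M) : Prop :=
  PartialMonoid E ∧ ∃ e : M _⦋1⦌ × H _⦋1⦌ ≃ E _⦋1⦌,
    (∀ x : M _⦋1⦌, i.app (op ⦋1⦌) x = e (x, unit H)) ∧
    (∀ (x : M _⦋1⦌) (g : H _⦋1⦌), τ.app (op ⦋1⦌) (e (x, g)) = g) ∧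
    (∀ (n : ℕ) (w : Fin n → M _⦋1⦌ × H _⦋1⦌),
      (∃ s : E _⦋n⦌, spine E s = fun k => e (w k)) ↔
        (∃ b : H _⦋n⦌, spine H b = fun k => (w k).2) ∧
        (∃ m : M _⦋n⦌, spine M m = fun k : Fin n =>
          applyAut ((List.ofFn fun j => φ.t (w j).2).take (k : ℕ)).prod (w k).1)) ∧
    (∀ (b : H _⦋2⦌) (x z : M _⦋1⦌) (s : E _⦋2⦌),
      spine E s = ![e (x, H.δ 2 b), e (z, H.δ 0 b)] →
        ∃ p : M _⦋1⦌, IsProd M ![x, applyAut (φ.t (H.δ 2 b)) z, φ.η b] p ∧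
          prod E s = e (p, H.δ 1 b))

/-- `c` is the obstruction class `[η]` of the extension: it is represented by a twisting pair
`φ = (t, η)` such that the extension is equivalent to `M ×_φ H`. -/
def IsObstructionClass {E : SSet.{u}} (i : M ⟶ E) (τ : E ⟶ H) (c : H2 H M) : Prop :=
  ∃ φ : TwistingPair H M, IsTwistedProduct i τ φ ∧ Quot.mk _ φ = c

end Cohomology

/-! ### Derivations and the first non-abelian cohomology -/

/-- A derivation `θ : H → M` with respect to an action `ρ` of `H` on `M`. -/
structure Derivation {H M : SSet.{u}} (ρ : Action H M) where
  map : ∀ n : ℕ, H _⦋n⦌ → M _⦋n⦌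
  δ_zero : ∀ (n : ℕ) (h : H _⦋n + 1⦌),
    M.δ 0 (map (n + 1) h) = applyAut (ρ.aut (spine H h 0)) (map n (H.δ 0 h))
  δ_succ : ∀ (n : ℕ) (j : Fin (n + 1)) (h : H _⦋n + 1⦌),
    M.δ j.succ (map (n + 1) h) = map n (H.δ j.succ h)
  σ_map : ∀ (n : ℕ) (j : Fin (n + 1)) (h : H _⦋n⦌),
    M.σ j (map n h) = map (n + 1) (H.σ j h)

/-- A derivation is regular if its image lies in `BN(M)`. -/
def Derivation.IsRegular {H M : SSet.{u}} [PartialMonoid M] {ρ : Action H M}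
    (θ : Derivation ρ) : Prop :=
  ∀ (n : ℕ) (h : H _⦋n⦌), θ.map n h ∈ normalizerSimplices (𝟙 M) n

/-- The relation `θ ∼ θ'`: there is `y ∈ M₁` such that, for every simplex `[h₁|...|hₙ]` of `H`,
the simplices
`v_k = [θ(h₁)|...|ʰ¹⋯ʰᵏ⁻¹θ(h_k)|ʰ¹⋯ʰᵏy|ʰ¹⋯ʰᵏθ'(h_{k+1})|...|ʰ¹⋯ʰⁿ⁻¹θ'(hₙ)]`, `k = 0, ..., n`, exist
in `M` and have the same product. The entry of `v_k` with index `k` (counted from `0`) is the one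
that involves `y`. -/
def Derivation.Related {H M : SSet.{u}} {ρ : Action H M} (θ θ' : Derivation ρ) : Prop :=
  ∃ y : M _⦋1⦌, ∀ (n : ℕ) (h : H _⦋n⦌), ∃ p : M _⦋1⦌, ∀ k : Fin (n + 1),
    IsProd M (k.insertNth (α := fun _ => M _⦋1⦌)
      (applyAut (ρ.aut (edge H 0 k (Fin.zero_le k) h)) y)
      (fun j : Fin n => applyAut (ρ.aut (edge H 0 j.castSucc (Fin.zero_le _) h))
        (if j.castSucc < k then θ.map 1 (spine H h j) else θ'.map 1 (spine H h j)))) p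

/-- `H¹(H; M)`: derivations modulo the equivalence relation generated by `∼`. -/
def H1 {H M : SSet.{u}} (ρ : Action H M) :=
  Quot (Derivation.Related (ρ := ρ))

/-- The action `ρ` of `H` on `M` is given by conjugation in `E` by the values of the section `σ`:
`σ(h)` determines a homotopy from `i` to `i ∘ ρ(h)`, and
`i(ρ(h)(x)) = σ(h) ⬝ i(x) ⬝ σ(h⁻¹)` for every edge `x` of `M`. -/
def IsConjugationAction {M E H : SSet.{u}} [PartialGroup M] [PartialGroup H] {τ : E ⟶ H}
    (i : M ⟶ E) (σ : Section τ) (ρ : Action H M) : Prop :=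
  ∀ h : H _⦋1⦌,
    DeterminesHomotopy (σ.1.app (op ⦋1⦌) h) ((ρ.aut h).hom ≫ i) i ∧
    ∀ x : M _⦋1⦌,
      IsProd E ![σ.1.app (op ⦋1⦌) h, i.app (op ⦋1⦌) x, σ.1.app (op ⦋1⦌) (inv H h)]
        (i.app (op ⦋1⦌) (applyAut (ρ.aut h) x))

end PartialGroups

namespace PartialGroups

/-! ### Restriction of simplices along simplicial operators -/

/-! A simplicial map into a partial monoid is determined by its values on edges, and
`isEdgeMap_of_spine` says when a map on edges extends. So everything becomes a computation with
words and products in $E$, which is itself a partial monoid because each of its simplices lies in a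
trivialization $M\times\Delta[n]$ over its image in $H$ (`IsExt.partialMonoid`).

Over every edge $g$ of $H$ choose a trivialization $M\times\Delta[1]\to E$ which is $\imath$ at the
vertex 1; at the vertex 0 it is then $\imath\circ t(g)$ for an automorphism $t(g)$. Such a framing
can be extended along the spine of any simplex of $H$ (`Framing.exists_triv`), which shows that the
words in $E$ are those of a twisted product. Over $[g|h]$ the long edge of the extended
trivialization differs from the chosen one over $gh$ by a homotopy of $M$, whose edge is $\eta(g,h)$
(`Framing.exists_η`); associativity in $E$ is the cocycle identity. Conversely, every presentation
as a twisted product comes from a framing (`IsTPEquiv.exists_framing`), and two framings differ by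
edges $\theta(g)\in N(M)$, so their cocycles are cohomologous (`IsTPEquiv.cohomologous`).

All words in $N(M)$ exist, so $N(M)$ gives a monoid. A regular section has the form
$g\mapsto(\theta(g),g)$ with $\theta(g)\in N(M)$; being simplicial means precisely that $\theta$
bounds $\eta$. Its $\theta(g)$ are invertible, so the framing can be changed until the section
consists of the edges $(1,g)$, and then $\eta=1$ (`Section.IsRegular.exists_framing`).

With $\eta=1$, $t$ is an action and $E$ is a semidirect product: a simplex is a pair of simplices of
$M$ and $H$, on whose first component only operators that move the vertex 0 act with a twist
(`Framing.exists_isSemidirect`). The first component of a section is therefore a derivation. A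
homotopy of sections can be made vertical by composing with the reverse of its projection to $H$;
cutting it into prisms yields the words with the common product which define the relation on
derivations (`IsSemidirect.related_iff`). -/

/-- The simplex `α^* x`. -/
def res {X : SSet.{u}} {m n : ℕ} (α : ⦋m⦌ ⟶ ⦋n⦌) (x : X _⦋n⦌) : X _⦋m⦌ := X.map α.op x

section Res

variable {X Y : SSet.{u}} {l m n : ℕ}

lemma res_res (β : ⦋l⦌ ⟶ ⦋m⦌) (α : ⦋m⦌ ⟶ ⦋n⦌) (x : X _⦋n⦌) :
    res β (res α x) = res (β ≫ α) x := by
  simp [res]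

@[simp]
lemma res_id (x : X _⦋n⦌) : res (𝟙 ⦋n⦌) x = x := by
  simp [res]

lemma app_res (f : X ⟶ Y) (α : ⦋m⦌ ⟶ ⦋n⦌) (x : X _⦋n⦌) :
    f.app _ (res α x) = res α (f.app _ x) :=
  NatTrans.naturality_apply f α.op x

lemma spine_apply (x : X _⦋n⦌) (k : Fin n) :
    spine X x k = res (SimplexCategory.mkOfSucc k) x := rfl

lemma δ_eq_res (j : Fin (n + 2)) (x : X _⦋n + 1⦌) : X.δ j x = res (SimplexCategory.δ j) x := rfl

lemma σ_eq_res (j : Fin (n + 1)) (x : X _⦋n⦌) : X.σ j x = res (SimplexCategory.σ j) x := rfl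

lemma edge_eq_res (i j : Fin (n + 1)) (h : i ≤ j) (x : X _⦋n⦌) :
    edge X i j h x = res (SimplexCategory.mkOfLe i j h) x := rfl

lemma prod_eq_res (x : X _⦋n⦌) :
    prod X x = res (SimplexCategory.mkOfLe 0 (Fin.last n) (Fin.zero_le _)) x := rfl

lemma eq_mkOfLe (a : ⦋1⦌ ⟶ ⦋n⦌) :
    a = SimplexCategory.mkOfLe (a.toOrderHom 0) (a.toOrderHom 1)
      (a.toOrderHom.monotone (Fin.zero_le 1)) :=
  SimplexCategory.Hom.ext_one_left _ _

lemma mkOfLe_comp (α : ⦋m⦌ ⟶ ⦋n⦌) (i j : Fin (m + 1)) (h : i ≤ j) :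
    SimplexCategory.mkOfLe i j h ≫ α =
      SimplexCategory.mkOfLe (α.toOrderHom i) (α.toOrderHom j) (α.toOrderHom.monotone h) :=
  SimplexCategory.Hom.ext_one_left _ _

lemma edge_res (α : ⦋m⦌ ⟶ ⦋n⦌) (i j : Fin (m + 1)) (h : i ≤ j) (x : X _⦋n⦌) :
    edge X i j h (res α x) =
      edge X (α.toOrderHom i) (α.toOrderHom j) (α.toOrderHom.monotone h) x := by
  simp only [edge_eq_res, res_res, mkOfLe_comp]

lemma spine_res (α : ⦋m⦌ ⟶ ⦋n⦌) (k : Fin m) (x : X _⦋n⦌) :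
    spine X (res α x) k =
      edge X (α.toOrderHom k.castSucc) (α.toOrderHom k.succ)
        (α.toOrderHom.monotone (Fin.castSucc_le_succ k)) x :=
  edge_res α _ _ (Fin.castSucc_le_succ k) x

lemma app_edge (f : X ⟶ Y) (i j : Fin (n + 1)) (h : i ≤ j) (x : X _⦋n⦌) :
    f.app _ (edge X i j h x) = edge Y i j h (f.app _ x) := app_res _ _ _

lemma app_spine (f : X ⟶ Y) (x : X _⦋n⦌) (k : Fin n) :
    f.app _ (spine X x k) = spine Y (f.app _ x) k := app_res _ _ _

lemma spine_eq_edge (x : X _⦋n⦌) (k : Fin n) :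
    spine X x k = edge X k.castSucc k.succ (Fin.castSucc_le_succ k) x := rfl

lemma prod_eq_edge (x : X _⦋n⦌) : prod X x = edge X 0 (Fin.last n) (Fin.zero_le _) x := rfl

lemma spine_one (x : X _⦋1⦌) (k : Fin 1) : spine X x k = x := by
  obtain rfl := Subsingleton.elim k 0
  rw [spine_apply, SimplexCategory.mkOfSucc_eq_id, res_id]

lemma prod_one (x : X _⦋1⦌) : prod X x = x := by
  rw [prod_eq_res, show SimplexCategory.mkOfLe 0 (Fin.last 1) (Fin.zero_le _) = 𝟙 ⦋1⦌ from
    SimplexCategory.Hom.ext_one_left _ _, res_id]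

end Res

/-! ### Products of two edges -/

/-- `Mul2 X x y p`: the simplex `[x|y]` exists, with product `p`. -/
def Mul2 (X : SSet.{u}) (x y p : X _⦋1⦌) : Prop :=
  ∃ s : X _⦋2⦌, X.δ 2 s = x ∧ X.δ 0 s = y ∧ X.δ 1 s = p

section Mul2

variable {X Y : SSet.{u}} {n : ℕ}

lemma spine_two (s : X _⦋2⦌) : spine X s = ![X.δ 2 s, X.δ 0 s] := by
  ext k
  fin_cases k
  · exact congrArg (fun a => res a s) SimplexCategory.mkOfSucc_zero_eq_δ
  · exact congrArg (fun a => res a s) SimplexCategory.mkOfSucc_one_eq_δ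

lemma prod_two (s : X _⦋2⦌) : prod X s = X.δ 1 s :=
  congrArg (fun a => res a s) (SimplexCategory.Hom.ext_one_left _ _)

lemma isProd_two_iff {x y p : X _⦋1⦌} : IsProd X ![x, y] p ↔ Mul2 X x y p := by
  simp only [IsProd, Mul2, spine_two, prod_two]
  refine exists_congr fun s => ?_
  constructor
  · rintro ⟨h, h'⟩
    exact ⟨congrFun h 0, congrFun h 1, h'⟩
  · rintro ⟨rfl, rfl, rfl⟩
    exact ⟨rfl, rfl⟩

lemma mul2_edge (x : X _⦋n⦌) (i j k : Fin (n + 1)) (hij : i ≤ j) (hjk : j ≤ k) :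
    Mul2 X (edge X i j hij x) (edge X j k hjk x) (edge X i k (hij.trans hjk) x) := by
  refine ⟨res (SimplexCategory.mkOfLeComp i j k hij hjk) x, ?_, ?_, ?_⟩ <;>
  · rw [δ_eq_res, res_res, edge_eq_res]
    exact congrArg (fun a => res a x) (SimplexCategory.Hom.ext_one_left _ _)

lemma Mul2.app {x y p : X _⦋1⦌} (h : Mul2 X x y p) (f : X ⟶ Y) :
    Mul2 Y (f.app _ x) (f.app _ y) (f.app _ p) := by
  obtain ⟨s, rfl, rfl, rfl⟩ := h
  exact ⟨f.app _ s, (app_res f _ s).symm, (app_res f _ s).symm, (app_res f _ s).symm⟩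

lemma mul2_δ (s : X _⦋2⦌) : Mul2 X (X.δ 2 s) (X.δ 0 s) (X.δ 1 s) := ⟨s, rfl, rfl, rfl⟩

end Mul2

/-! ### Partial monoids -/

section PartialMonoid

variable {X Y : SSet.{u}} [PartialMonoid X] {m n : ℕ}

lemma vertex_eq (x y : X _⦋0⦌) : x = y :=
  (PartialMonoid.existsUnique_vertex (X := X)).unique trivial trivial

lemma eq_of_spine {x y : X _⦋n⦌} (h : ∀ k, spine X x k = spine X y k) : x = y := by
  cases n with
  | zero => exact vertex_eq x y
  | succ n => exact PartialMonoid.spine_injective (n + 1) (by lia) (funext h)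

lemma IsProd.unique {w : Fin n → X _⦋1⦌} {p q : X _⦋1⦌} (hp : IsProd X w p) (hq : IsProd X w q) :
    p = q := by
  obtain ⟨s, hs, rfl⟩ := hp
  obtain ⟨s', hs', rfl⟩ := hq
  rw [eq_of_spine fun k => (congrFun hs k).trans (congrFun hs' k).symm]

lemma Mul2.unique {x y p q : X _⦋1⦌} (hp : Mul2 X x y p) (hq : Mul2 X x y q) : p = q :=
  (isProd_two_iff.2 hp).unique (isProd_two_iff.2 hq)

lemma res_zero_eq_unit (α : ⦋1⦌ ⟶ ⦋0⦌) (x : X _⦋0⦌) : res α x = unit X := by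
  rw [unit, σ_eq_res, vertex_eq x (vertex X)]
  exact congrArg (fun a => res a _) (Subsingleton.elim _ _)

lemma res_eq_unit {α : ⦋1⦌ ⟶ ⦋n⦌} (h : α.toOrderHom 0 = α.toOrderHom 1) (x : X _⦋n⦌) :
    res α x = unit X := by
  have : α = SimplexCategory.const ⦋1⦌ ⦋0⦌ 0 ≫
      SimplexCategory.const ⦋0⦌ ⦋n⦌ (α.toOrderHom 0) :=
    SimplexCategory.Hom.ext_one_left _ _ rfl h.symm
  rw [this, ← res_res]
  exact res_zero_eq_unit _ _

lemma edge_self (i : Fin (n + 1)) (x : X _⦋n⦌) : edge X i i le_rfl x = unit X :=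
  res_eq_unit rfl x

lemma edge_eq_unit {i j : Fin (n + 1)} (h : i ≤ j) (h' : i = j) (x : X _⦋n⦌) :
    edge X i j h x = unit X := by
  subst h'
  exact edge_self i x

lemma app_unit [PartialMonoid Y] (f : X ⟶ Y) : f.app _ (unit X) = unit Y := by
  rw [unit, σ_eq_res, app_res]
  exact res_zero_eq_unit _ _

lemma unit_mul2 (x : X _⦋1⦌) : Mul2 X (unit X) x x := by
  have := mul2_edge x 0 0 1 le_rfl (Fin.zero_le 1)
  rwa [edge_self, show edge X 0 1 _ x = x from prod_one x] at this

lemma mul2_unit (x : X _⦋1⦌) : Mul2 X x (unit X) x := by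
  have := mul2_edge x 0 1 1 (Fin.zero_le 1) le_rfl
  rwa [edge_self, show edge X 0 1 _ x = x from prod_one x] at this

/-- By uniqueness of products the spine determines all longer edges, one vertex at a time; so any
multiplicative family with the right consecutive values is the family of edges of `x`. -/
lemma eq_of_edges {x : X _⦋n⦌} {f : ∀ i j : Fin (n + 1), i ≤ j → X _⦋1⦌}
    (h_self : ∀ i, f i i le_rfl = unit X)
    (h_spine : ∀ k : Fin n, spine X x k = f k.castSucc k.succ (Fin.castSucc_le_succ k))
    (h_mul : ∀ i j k (hij : i ≤ j) (hjk : j ≤ k),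
      Mul2 X (f i j hij) (f j k hjk) (f i k (hij.trans hjk)))
    (i j : Fin (n + 1)) (hij : i ≤ j) : edge X i j hij x = f i j hij := by
  induction j using Fin.induction with
  | zero =>
    obtain rfl : i = 0 := le_antisymm hij (Fin.zero_le _)
    rw [edge_self, h_self]
  | succ j ih =>
    rcases hij.lt_or_eq with hlt | rfl
    · have hij' : i ≤ j.castSucc := Fin.le_castSucc_iff.2 hlt
      have h1 := mul2_edge x i j.castSucc j.succ hij' (Fin.castSucc_le_succ j)
      have h2 := h_mul i j.castSucc j.succ hij' (Fin.castSucc_le_succ j)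
      rw [ih hij', ← spine_eq_edge, h_spine] at h1
      exact h1.unique h2
    · rw [edge_self, h_self]

/-! ### Construction of simplicial maps into partial monoids -/

/-- A map on edges which extends to a simplicial map. -/
def IsEdgeMap (f : Y _⦋1⦌ → X _⦋1⦌) : Prop :=
  ∀ (n : ℕ) (y : Y _⦋n⦌), ∃ x : X _⦋n⦌, ∀ a : ⦋1⦌ ⟶ ⦋n⦌, res a x = f (res a y)

lemma isEdgeMap_of_spine {f : Y _⦋1⦌ → X _⦋1⦌}
    (h_unit : ∀ y : Y _⦋0⦌, f (res (SimplexCategory.σ 0) y) = unit X)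
    (h_spine : ∀ (n : ℕ) (y : Y _⦋n⦌), ∃ x : X _⦋n⦌, ∀ k, spine X x k = f (spine Y y k))
    (h_mul : ∀ y : Y _⦋2⦌, Mul2 X (f (Y.δ 2 y)) (f (Y.δ 0 y)) (f (Y.δ 1 y))) :
    IsEdgeMap f := by
  intro n y
  obtain ⟨x, hx⟩ := h_spine n y
  refine ⟨x, fun a => ?_⟩
  rw [eq_mkOfLe a]
  refine eq_of_edges (f := fun i j h => f (edge Y i j h y)) (fun i => ?_) hx
    (fun i j k hij hjk => ?_) _ _ _
  · rw [← h_unit (res (SimplexCategory.const ⦋0⦌ ⦋n⦌ i) y), res_res]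
    exact congrArg f (congrArg (fun a => res a y) (SimplexCategory.Hom.ext_one_left _ _))
  · obtain ⟨s, h2, h0, h1⟩ := mul2_edge y i j k hij hjk
    simpa only [h0, h1, h2] using h_mul s

/-- The simplicial map with given values on edges. -/
noncomputable def IsEdgeMap.hom {f : Y _⦋1⦌ → X _⦋1⦌} (hf : IsEdgeMap f) : Y ⟶ X where
  app n := ↾fun y => (hf n.unop.len y).choose
  naturality := by
    rintro ⟨⟨m⟩⟩ ⟨⟨n⟩⟩ ⟨α⟩
    ext y
    refine eq_of_spine (n := n) fun k => ?_
    exact ((hf n (res α y)).choose_spec _).trans ((congrArg f (res_res _ _ _)).trans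
      (((hf m y).choose_spec _).symm.trans (res_res _ _ _).symm))

lemma IsEdgeMap.hom_app {f : Y _⦋1⦌ → X _⦋1⦌} (hf : IsEdgeMap f) (y : Y _⦋1⦌) :
    hf.hom.app _ y = f y := by
  have := (hf 1 y).choose_spec (𝟙 _)
  rwa [res_id, res_id] at this

lemma hom_ext_of_edges {f g : Y ⟶ X} (h : ∀ y : Y _⦋1⦌, f.app _ y = g.app _ y) : f = g := by
  ext ⟨⟨n⟩⟩ y
  refine eq_of_spine (n := n) fun k => ?_
  exact (app_spine f (n := n) y k).symm.trans ((h _).trans (app_spine g (n := n) y k))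

end PartialMonoid

/-! ### Maps defined on `Y ⊗ Δ[n]` -/

section Tensor

variable {X Y Z : SSet.{u}} {m n r q : ℕ}

/-- The value of `f : Y ⊗ Δ[n] ⟶ X` at a pair of simplices. -/
def ev (f : Y ⊗ (Δ[n] : SSet.{u}) ⟶ X) (y : Y _⦋r⦌) (α : ⦋r⦌ ⟶ ⦋n⦌) : X _⦋r⦌ :=
  f.app (op ⦋r⦌) (y, SSet.stdSimplex.objEquiv.symm α)

lemma res_ev (f : Y ⊗ (Δ[n] : SSet.{u}) ⟶ X) (β : ⦋q⦌ ⟶ ⦋r⦌) (y : Y _⦋r⦌) (α : ⦋r⦌ ⟶ ⦋n⦌) :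
    res β (ev f y α) = ev f (res β y) (β ≫ α) :=
  (app_res f β _).symm

lemma spine_ev (f : Y ⊗ (Δ[n] : SSet.{u}) ⟶ X) (y : Y _⦋r⦌) (α : ⦋r⦌ ⟶ ⦋n⦌) (k : Fin r) :
    spine X (ev f y α) k = ev f (spine Y y k) (SimplexCategory.mkOfSucc k ≫ α) :=
  res_ev _ _ _ _

/-- The map `Y ⊗ Δ[n] ⟶ X` with given values. -/
def tensorHom (P : ∀ r : ℕ, Y _⦋r⦌ → (⦋r⦌ ⟶ ⦋n⦌) → X _⦋r⦌)
    (hP : ∀ (q r : ℕ) (β : ⦋q⦌ ⟶ ⦋r⦌) (y : Y _⦋r⦌) (α : ⦋r⦌ ⟶ ⦋n⦌),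
      P q (res β y) (β ≫ α) = res β (P r y α)) : Y ⊗ (Δ[n] : SSet.{u}) ⟶ X where
  app r := ↾fun z => P r.unop.len z.1 (SSet.stdSimplex.objEquiv z.2)
  naturality := by
    rintro ⟨⟨r⟩⟩ ⟨⟨q⟩⟩ ⟨β⟩
    ext z
    exact hP q r β z.1 (SSet.stdSimplex.objEquiv z.2)

lemma ev_tensorHom (P : ∀ r : ℕ, Y _⦋r⦌ → (⦋r⦌ ⟶ ⦋n⦌) → X _⦋r⦌)
    (hP : ∀ (q r : ℕ) (β : ⦋q⦌ ⟶ ⦋r⦌) (y : Y _⦋r⦌) (α : ⦋r⦌ ⟶ ⦋n⦌),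
      P q (res β y) (β ≫ α) = res β (P r y α)) (y : Y _⦋r⦌) (α : ⦋r⦌ ⟶ ⦋n⦌) :
    ev (tensorHom P hP) y α = P r y α := rfl

/-- The criterion `isEdgeMap_of_spine` for a product with a simplex, whose edges are pairs. -/
lemma exists_tensorHom_of_edges [PartialMonoid X] (f : Y _⦋1⦌ → (⦋1⦌ ⟶ ⦋n⦌) → X _⦋1⦌)
    (h_unit : ∀ (y : Y _⦋0⦌) (α : ⦋0⦌ ⟶ ⦋n⦌),
      f (res (SimplexCategory.σ 0) y) (SimplexCategory.σ 0 ≫ α) = unit X)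
    (h_spine : ∀ (r : ℕ) (y : Y _⦋r⦌) (α : ⦋r⦌ ⟶ ⦋n⦌), ∃ x : X _⦋r⦌,
      ∀ k, spine X x k = f (spine Y y k) (SimplexCategory.mkOfSucc k ≫ α))
    (h_mul : ∀ (y : Y _⦋2⦌) (α : ⦋2⦌ ⟶ ⦋n⦌),
      Mul2 X (f (Y.δ 2 y) (SimplexCategory.δ 2 ≫ α)) (f (Y.δ 0 y) (SimplexCategory.δ 0 ≫ α))
        (f (Y.δ 1 y) (SimplexCategory.δ 1 ≫ α))) :
    ∃ F : Y ⊗ (Δ[n] : SSet.{u}) ⟶ X, ∀ (y : Y _⦋1⦌) (α : ⦋1⦌ ⟶ ⦋n⦌), ev F y α = f y α := by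
  have : IsEdgeMap (Y := Y ⊗ (Δ[n] : SSet.{u})) (X := X)
      (fun z => f z.1 (SSet.stdSimplex.objEquiv z.2)) :=
    isEdgeMap_of_spine (fun z => h_unit z.1 (SSet.stdSimplex.objEquiv z.2))
      (fun r z => h_spine r z.1 (SSet.stdSimplex.objEquiv z.2))
      (fun z => h_mul z.1 (SSet.stdSimplex.objEquiv z.2))
  exact ⟨this.hom, fun y α => this.hom_app _⟩

/-- The vertex `j` of `Δ[n]`, as a simplex of dimension `r`. -/
abbrev cst (r n : ℕ) (j : Fin (n + 1)) : ⦋r⦌ ⟶ ⦋n⦌ := SimplexCategory.const ⦋r⦌ ⦋n⦌ j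

lemma ι₀_comp_eq_iff {F : Y ⊗ (Δ[1] : SSet.{u}) ⟶ X} {f : Y ⟶ X} :
    SSet.ι₀ ≫ F = f ↔ ∀ (r : ℕ) (y : Y _⦋r⦌), ev F y (cst r 1 0) = f.app _ y := by
  constructor
  · rintro rfl r y
    rfl
  · intro h
    ext ⟨⟨r⟩⟩ y
    exact h r y

lemma ι₁_comp_eq_iff {F : Y ⊗ (Δ[1] : SSet.{u}) ⟶ X} {f : Y ⟶ X} :
    SSet.ι₁ ≫ F = f ↔ ∀ (r : ℕ) (y : Y _⦋r⦌), ev F y (cst r 1 1) = f.app _ y := by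
  constructor
  · rintro rfl r y
    rfl
  · intro h
    ext ⟨⟨r⟩⟩ y
    exact h r y

/-- The homotopy given by a map with prescribed ends. -/
def homotopyOf {f g : Y ⟶ X} (F : Y ⊗ (Δ[1] : SSet.{u}) ⟶ X)
    (h0 : ∀ (r : ℕ) (y : Y _⦋r⦌), ev F y (cst r 1 0) = f.app _ y)
    (h1 : ∀ (r : ℕ) (y : Y _⦋r⦌), ev F y (cst r 1 1) = g.app _ y) : SSet.Homotopy f g where
  h := F
  h₀ := ι₀_comp_eq_iff.2 h0
  h₁ := ι₁_comp_eq_iff.2 h1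
  rel := by
    ext _ ⟨⟨_, h⟩, _⟩
    simp at h

lemma determinesHomotopy_iff [PartialMonoid Y] {η : X _⦋1⦌} {f g : Y ⟶ X} :
    DeterminesHomotopy η f g ↔ ∃ F : Y ⊗ (Δ[1] : SSet.{u}) ⟶ X,
      (∀ (r : ℕ) (y : Y _⦋r⦌), ev F y (cst r 1 0) = f.app _ y) ∧
      (∀ (r : ℕ) (y : Y _⦋r⦌), ev F y (cst r 1 1) = g.app _ y) ∧
      ev F (unit Y) (𝟙 ⦋1⦌) = η := by
  constructor
  · rintro ⟨F, hF⟩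
    exact ⟨F.h, ι₀_comp_eq_iff.1 F.h₀, ι₁_comp_eq_iff.1 F.h₁, hF⟩
  · rintro ⟨F, h0, h1, hF⟩
    exact ⟨homotopyOf F h0 h1, hF⟩

lemma nonempty_homotopy_iff {f g : Y ⟶ X} :
    Nonempty (SSet.Homotopy f g) ↔ ∃ F : Y ⊗ (Δ[1] : SSet.{u}) ⟶ X,
      (∀ (r : ℕ) (y : Y _⦋r⦌), ev F y (cst r 1 0) = f.app _ y) ∧
      (∀ (r : ℕ) (y : Y _⦋r⦌), ev F y (cst r 1 1) = g.app _ y) := by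
  constructor
  · rintro ⟨F⟩
    exact ⟨F.h, ι₀_comp_eq_iff.1 F.h₀, ι₁_comp_eq_iff.1 F.h₁⟩
  · rintro ⟨F, h0, h1⟩
    exact ⟨homotopyOf F h0 h1⟩

end Tensor

lemma edge_ev {X Y : SSet.{u}} {n r : ℕ} (f : Y ⊗ (Δ[n] : SSet.{u}) ⟶ X) (y : Y _⦋r⦌)
    (α : ⦋r⦌ ⟶ ⦋n⦌) (i j : Fin (r + 1)) (h : i ≤ j) :
    edge X i j h (ev f y α) = ev f (edge Y i j h y) (SimplexCategory.mkOfLe i j h ≫ α) :=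
  res_ev _ _ _ _

lemma edge_zero_one {X : SSet.{u}} (x : X _⦋1⦌) (h : (0 : Fin 2) ≤ 1) : edge X 0 1 h x = x :=
  prod_one x

lemma hom_one_one_cases (α : ⦋1⦌ ⟶ ⦋1⦌) : α = cst 1 1 0 ∨ α = cst 1 1 1 ∨ α = 𝟙 ⦋1⦌ := by
  have h := α.toOrderHom.monotone (Fin.zero_le 1)
  have h0 : α.toOrderHom 0 = 0 ∨ α.toOrderHom 0 = 1 := by
    generalize α.toOrderHom 0 = a
    change Fin 2 at a
    fin_cases a <;> simp
  have h1 : α.toOrderHom 1 = 0 ∨ α.toOrderHom 1 = 1 := by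
    generalize α.toOrderHom 1 = a
    change Fin 2 at a
    fin_cases a <;> simp
  rcases h0 with h0 | h0 <;> rcases h1 with h1 | h1
  · exact Or.inl (SimplexCategory.Hom.ext_one_left _ _ h0 h1)
  · exact Or.inr (Or.inr (SimplexCategory.Hom.ext_one_left _ _ h0 h1))
  · rw [h0, h1] at h
    exact absurd h (by decide)
  · exact Or.inr (Or.inl (SimplexCategory.Hom.ext_one_left _ _ h0 h1))

/-! ### Inversion in partial groups -/

section PartialGroup

variable {X Y : SSet.{u}} [PartialGroup X] [PartialGroup Y] {m n : ℕ}

/-- The inversion of a partial group, as an operation on simplices. -/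
def nu (x : X _⦋n⦌) : X _⦋n⦌ :=
  SSet.opObjEquiv ((PartialGroup.inversion (X := X)).app (op ⦋n⦌) x)

lemma inv_eq_nu (x : X _⦋1⦌) : inv X x = nu x := rfl

lemma nu_nu (x : X _⦋n⦌) : nu (nu x) = x := PartialGroup.inversion_inversion n x

lemma inv_inv (x : X _⦋1⦌) : inv X (inv X x) = x := nu_nu x

lemma nu_res (α : ⦋m⦌ ⟶ ⦋n⦌) (x : X _⦋n⦌) :
    nu (res α x) = res (SimplexCategory.rev.map α : ⦋m⦌ ⟶ ⦋n⦌) (nu x) :=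
  NatTrans.naturality_apply (PartialGroup.inversion (X := X)) α.op x

/-- The inversion reverses the order of the vertices, so words are inverted letter by letter and
read backwards. -/
lemma edge_nu (i j : Fin (n + 1)) (h : i ≤ j) (x : X _⦋n⦌) :
    edge X i j h (nu x) = inv X (edge X j.rev i.rev (Fin.rev_le_rev.2 h) x) := by
  rw [inv_eq_nu, edge_eq_res, edge_eq_res, nu_res]
  refine congrArg (fun a => res a (nu x)) (SimplexCategory.Hom.ext_one_left _ _ ?_ ?_)
  · exact (Fin.rev_rev i).symm
  · exact (Fin.rev_rev j).symm

lemma inv_mul2_self (x : X _⦋1⦌) : Mul2 X (inv X x) x (unit X) := by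
  rw [← isProd_two_iff]
  convert PartialGroup.inversion_mul 1 le_rfl x using 1
  ext k
  fin_cases k
  · exact (spine_one (nu x) 0).symm
  · exact (spine_one x 0).symm

lemma mul2_inv_self (x : X _⦋1⦌) : Mul2 X x (inv X x) (unit X) := by
  have := inv_mul2_self (inv X x)
  rwa [inv_inv] at this

lemma Mul2.inv {x y p : X _⦋1⦌} (h : Mul2 X x y p) : Mul2 X (inv X y) (inv X x) (inv X p) := by
  obtain ⟨s, rfl, rfl, rfl⟩ := h
  refine ⟨nu s, ?_, ?_, ?_⟩ <;> rw [δ_eq_res, δ_eq_res, inv_eq_nu, nu_res] <;>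
  exact congrArg (fun a => res a (nu s)) (SimplexCategory.Hom.ext_one_left _ _ rfl rfl)

/-- For $u=[x|y]$ the simplex $[\nu(u)|u]$ has spine $(y^{-1},x^{-1},x,y)$. Bracketing its part
$[x^{-1}|x|y]$ in the two possible ways gives $x^{-1}\cdot p=1\cdot y$. All cancellation laws follow
from this. -/
lemma Mul2.inv_left {x y p : X _⦋1⦌} (h : Mul2 X x y p) : Mul2 X (PartialGroups.inv X x) p y := by
  obtain ⟨u, h2, h0, h1⟩ := h
  obtain ⟨s, hs, -⟩ := PartialGroup.inversion_mul 2 (by lia) u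
  have hν := edge_nu 0 1 (by decide) u
  have hν' := edge_nu 1 2 (by decide) u
  have e12 : edge X 1 2 (by decide) s = PartialGroups.inv X x := by
    refine (congrFun hs 1).trans (Eq.trans (b := edge X 1 2 (by decide) (nu u)) rfl ?_)
    rw [hν', ← h2]
    exact congrArg (fun a => PartialGroups.inv X (res a u))
      (SimplexCategory.Hom.ext_one_left _ _ rfl rfl)
  have e23 : edge X 2 3 (by decide) s = x := by
    refine (congrFun hs 2).trans (Eq.trans (b := spine X u 0) rfl ?_)
    rw [spine_two]
    exact h2
  have e34 : edge X 3 4 (by decide) s = y := by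
    refine (congrFun hs 3).trans (Eq.trans (b := spine X u 1) rfl ?_)
    rw [spine_two]
    exact h0
  have m24 := mul2_edge s 2 3 4 (by decide) (by decide)
  have m13 := mul2_edge s 1 2 3 (by decide) (by decide)
  have m14 := mul2_edge s 1 2 4 (by decide) (by decide)
  have m14' := mul2_edge s 1 3 4 (by decide) (by decide)
  rw [e23, e34] at m24
  rw [e12, e23] at m13
  rw [m24.unique ⟨u, h2, h0, h1⟩, e12] at m14
  rw [m13.unique (inv_mul2_self x), e34] at m14'
  rwa [m14'.unique (unit_mul2 y)] at m14

lemma Mul2.inv_right {x y p : X _⦋1⦌} (h : Mul2 X x y p) : Mul2 X p (PartialGroups.inv X y) x := by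
  have := h.inv.inv_left.inv
  rwa [inv_inv, inv_inv, inv_inv] at this

lemma Mul2.left_cancel {x y z p : X _⦋1⦌} (h : Mul2 X x y p) (h' : Mul2 X x z p) : y = z :=
  h.inv_left.unique h'.inv_left

lemma Mul2.right_cancel {x y z p : X _⦋1⦌} (h : Mul2 X x z p) (h' : Mul2 X y z p) : x = y :=
  h.inv_right.unique h'.inv_right

lemma inv_unit : inv X (unit X) = unit X :=
  (inv_mul2_self (unit X)).right_cancel (unit_mul2 (unit X))

lemma app_inv (f : Y ⟶ X) (y : Y _⦋1⦌) : f.app _ (inv Y y) = inv X (f.app _ y) := by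
  have h := (inv_mul2_self y).app f
  rw [app_unit] at h
  exact h.right_cancel (inv_mul2_self _)

lemma app_nu (f : Y ⟶ X) (y : Y _⦋n⦌) : f.app _ (nu y) = nu (f.app _ y) := by
  refine eq_of_spine fun k => ?_
  rw [← app_spine, spine_eq_edge, spine_eq_edge, edge_nu, edge_nu, app_inv, app_edge]

end PartialGroup

/-! ### Calculus of homotopies -/

/-- `F` is a homotopy `f ←η g`. -/
structure IsHomotopy {X Y : SSet.{u}} [PartialMonoid Y] (F : Y ⊗ (Δ[1] : SSet.{u}) ⟶ X)
    (f g : Y ⟶ X) (η : X _⦋1⦌) : Prop where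
  zero : ∀ (r : ℕ) (y : Y _⦋r⦌), ev F y (cst r 1 0) = f.app _ y
  one : ∀ (r : ℕ) (y : Y _⦋r⦌), ev F y (cst r 1 1) = g.app _ y
  edge : ev F (unit Y) (𝟙 ⦋1⦌) = η

section Homotopy

variable {W X Y Z : SSet.{u}}

lemma determinesHomotopy_iff_exists [PartialMonoid Y] {η : X _⦋1⦌} {f g : Y ⟶ X} :
    DeterminesHomotopy η f g ↔ ∃ F, IsHomotopy F f g η := by
  rw [determinesHomotopy_iff]
  exact exists_congr fun F => ⟨fun h => ⟨h.1, h.2.1, h.2.2⟩, fun h => ⟨h.1, h.2, h.3⟩⟩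

lemma IsHomotopy.determines [PartialMonoid Y] {η : X _⦋1⦌} {f g : Y ⟶ X}
    {F : Y ⊗ (Δ[1] : SSet.{u}) ⟶ X} (h : IsHomotopy F f g η) : DeterminesHomotopy η f g :=
  determinesHomotopy_iff_exists.2 ⟨F, h⟩

/-- The composite `(z, α) ↦ F (G (z, α), α)`. -/
noncomputable def compTensor {n : ℕ} (F : Y ⊗ (Δ[n] : SSet.{u}) ⟶ X)
    (G : Z ⊗ (Δ[n] : SSet.{u}) ⟶ Y) : Z ⊗ (Δ[n] : SSet.{u}) ⟶ X :=
  lift G (snd _ _) ≫ F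

lemma ev_compTensor {n r : ℕ} (F : Y ⊗ (Δ[n] : SSet.{u}) ⟶ X) (G : Z ⊗ (Δ[n] : SSet.{u}) ⟶ Y)
    (z : Z _⦋r⦌) (α : ⦋r⦌ ⟶ ⦋n⦌) : ev (compTensor F G) z α = ev F (ev G z α) α := rfl

lemma ev_whiskerRight_comp {n r : ℕ} (f : Z ⟶ Y) (F : Y ⊗ (Δ[n] : SSet.{u}) ⟶ X)
    (z : Z _⦋r⦌) (α : ⦋r⦌ ⟶ ⦋n⦌) :
    ev (f ▷ (Δ[n] : SSet.{u}) ≫ F) z α = ev F (f.app _ z) α := rfl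

lemma ev_comp {n r : ℕ} (F : Y ⊗ (Δ[n] : SSet.{u}) ⟶ X) (f : X ⟶ W)
    (y : Y _⦋r⦌) (α : ⦋r⦌ ⟶ ⦋n⦌) : ev (F ≫ f) y α = f.app _ (ev F y α) := rfl

lemma ev_fst_comp {n r : ℕ} (f : Y ⟶ X) (y : Y _⦋r⦌) (α : ⦋r⦌ ⟶ ⦋n⦌) :
    ev (fst Y (Δ[n] : SSet.{u}) ≫ f) y α = f.app _ y := rfl

namespace IsHomotopy

variable [PartialMonoid Y] {f g : Y ⟶ X} {η : X _⦋1⦌} {F : Y ⊗ (Δ[1] : SSet.{u}) ⟶ X}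

/-- The square over an edge $y$ in $Y\times\Delta[1]$ consists of two triangles with a common
diagonal. One of them shows that `F` takes the value $f(y)\cdot\eta$ on the diagonal; the other one
(`mul2_right`) gives $\eta\cdot g(y)$. -/
lemma mul2_left (h : IsHomotopy F f g η) (y : Y _⦋1⦌) :
    Mul2 X (f.app _ y) η (ev F y (𝟙 ⦋1⦌)) := by
  have := mul2_edge (ev F (res (SimplexCategory.σ 1) y) (SimplexCategory.σ 0 : ⦋2⦌ ⟶ ⦋1⦌))
    0 1 2 (by decide) (by decide)
  simp only [edge_ev, edge_res] at this
  convert this using 1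
  · rw [← h.zero, show SimplexCategory.mkOfLe (0 : Fin 3) 1 (by decide) ≫ SimplexCategory.σ 0 =
      cst 1 1 0 from SimplexCategory.Hom.ext_one_left _ _ rfl rfl]
    exact congrArg (fun a => ev F a _) (edge_zero_one _ _).symm
  · rw [← h.edge, show SimplexCategory.mkOfLe (1 : Fin 3) 2 (by decide) ≫ SimplexCategory.σ 0 =
      𝟙 ⦋1⦌ from SimplexCategory.Hom.ext_one_left _ _ rfl rfl]
    exact congrArg (fun a => ev F a _) (edge_eq_unit _ rfl _).symm
  · rw [show SimplexCategory.mkOfLe (0 : Fin 3) 2 (by decide) ≫ SimplexCategory.σ 0 =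
      𝟙 ⦋1⦌ from SimplexCategory.Hom.ext_one_left _ _ rfl rfl]
    exact congrArg (fun a => ev F a _) (edge_zero_one _ _).symm

lemma mul2_right (h : IsHomotopy F f g η) (y : Y _⦋1⦌) :
    Mul2 X η (g.app _ y) (ev F y (𝟙 ⦋1⦌)) := by
  have := mul2_edge (ev F (res (SimplexCategory.σ 0) y) (SimplexCategory.σ 1 : ⦋2⦌ ⟶ ⦋1⦌))
    0 1 2 (by decide) (by decide)
  simp only [edge_ev, edge_res] at this
  convert this using 1
  · rw [← h.edge, show SimplexCategory.mkOfLe (0 : Fin 3) 1 (by decide) ≫ SimplexCategory.σ 1 =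
      𝟙 ⦋1⦌ from SimplexCategory.Hom.ext_one_left _ _ rfl rfl]
    exact congrArg (fun a => ev F a _) (edge_eq_unit _ rfl _).symm
  · rw [← h.one, show SimplexCategory.mkOfLe (1 : Fin 3) 2 (by decide) ≫ SimplexCategory.σ 1 =
      cst 1 1 1 from SimplexCategory.Hom.ext_one_left _ _ rfl rfl]
    exact congrArg (fun a => ev F a _) (edge_zero_one _ _).symm
  · rw [show SimplexCategory.mkOfLe (0 : Fin 3) 2 (by decide) ≫ SimplexCategory.σ 1 =
      𝟙 ⦋1⦌ from SimplexCategory.Hom.ext_one_left _ _ rfl rfl]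
    exact congrArg (fun a => ev F a _) (edge_zero_one _ _).symm

/-- On edges, the ends cover the two constant operators, and the remaining value is the product
$f(y)\cdot\eta$. -/
lemma ext [PartialMonoid X] {F' : Y ⊗ (Δ[1] : SSet.{u}) ⟶ X} (h : IsHomotopy F f g η)
    (h' : IsHomotopy F' f g η) : F = F' := by
  have key (y : Y _⦋1⦌) (α : ⦋1⦌ ⟶ ⦋1⦌) : ev F y α = ev F' y α := by
    rcases hom_one_one_cases α with rfl | rfl | rfl
    · rw [h.zero, h'.zero]
    · rw [h.one, h'.one]
    · exact (h.mul2_left y).unique (h'.mul2_left y)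
  exact hom_ext_of_edges fun z => key z.1 (SSet.stdSimplex.objEquiv z.2)

lemma refl (f : Y ⟶ X) [PartialMonoid X] :
    IsHomotopy (fst Y (Δ[1] : SSet.{u}) ≫ f) f f (unit X) :=
  ⟨fun _ _ => rfl, fun _ _ => rfl, app_unit f⟩

lemma precomp [PartialMonoid Z] (h : IsHomotopy F f g η) (k : Z ⟶ Y) :
    IsHomotopy (k ▷ (Δ[1] : SSet.{u}) ≫ F) (k ≫ f) (k ≫ g) η where
  zero r y := h.zero r (k.app _ y)
  one r y := h.one r (k.app _ y)
  edge := by rw [ev_whiskerRight_comp, app_unit, h.edge]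

lemma postcomp (h : IsHomotopy F f g η) (k : X ⟶ W) :
    IsHomotopy (F ≫ k) (f ≫ k) (g ≫ k) (k.app _ η) where
  zero r y := congrArg (k.app _) (h.zero r y)
  one r y := congrArg (k.app _) (h.one r y)
  edge := congrArg (k.app _) h.edge

/-- By `mul2_right` the new edge is $\eta\cdot g(\zeta)$. For $g=\mathrm{id}$, composing homotopies
thus multiplies their edges, which makes $N(M)$ closed under products. -/
lemma comp [PartialMonoid Z] {f' g' : Z ⟶ Y} {ζ : Y _⦋1⦌} {G : Z ⊗ (Δ[1] : SSet.{u}) ⟶ Y}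
    (h : IsHomotopy F f g η) (h' : IsHomotopy G f' g' ζ) :
    IsHomotopy (compTensor F G) (f' ≫ f) (g' ≫ g) (ev F ζ (𝟙 ⦋1⦌)) where
  zero r y := by rw [ev_compTensor, h'.zero, h.zero]; rfl
  one r y := by rw [ev_compTensor, h'.one, h.one]; rfl
  edge := by rw [ev_compTensor, h'.edge]

lemma eq_of_unit [PartialMonoid X] (h : IsHomotopy F f g (unit X)) : f = g :=
  hom_ext_of_edges fun y => ((mul2_unit _).unique (h.mul2_left y)).trans
    ((unit_mul2 _).unique (h.mul2_right y)).symm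

/-- Conjugate by the inversions: in $\nu(F(\nu(y),\mathrm{rev}\,\alpha))$ the two reversals of the
order cancel, so this is again simplicial, with the ends exchanged. -/
lemma reverse {X Y : SSet.{u}} [PartialGroup X] [PartialGroup Y] {f g : Y ⟶ X} {η : X _⦋1⦌}
    {F : Y ⊗ (Δ[1] : SSet.{u}) ⟶ X} (h : IsHomotopy F f g η) :
    ∃ F' : Y ⊗ (Δ[1] : SSet.{u}) ⟶ X, IsHomotopy F' g f (inv X η) := by
  refine ⟨tensorHom (fun r y α => nu (ev F (nu y) (SimplexCategory.rev.map α : ⦋r⦌ ⟶ ⦋1⦌)))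
    (fun q r β y α => ?_), fun r y => ?_, fun r y => ?_, ?_⟩
  · rw [nu_res, Functor.map_comp]
    change nu (ev F _ ((SimplexCategory.rev.map β : ⦋q⦌ ⟶ ⦋r⦌) ≫
      (SimplexCategory.rev.map α : ⦋r⦌ ⟶ ⦋1⦌))) = _
    rw [← res_ev, nu_res]
    exact congrArg (fun b => res b _) (SimplexCategory.rev_map_rev_map β)
  · rw [ev_tensorHom, show (SimplexCategory.rev.map (cst r 1 0) : ⦋r⦌ ⟶ ⦋1⦌) = cst r 1 1 from rfl,
      h.one, app_nu, nu_nu]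
  · rw [ev_tensorHom, show (SimplexCategory.rev.map (cst r 1 1) : ⦋r⦌ ⟶ ⦋1⦌) = cst r 1 0 from rfl,
      h.zero, app_nu, nu_nu]
  · rw [ev_tensorHom, show (SimplexCategory.rev.map (𝟙 ⦋1⦌) : ⦋1⦌ ⟶ ⦋1⦌) = 𝟙 ⦋1⦌ from
      SimplexCategory.rev.map_id _, ← inv_eq_nu, ← inv_eq_nu, inv_unit, h.edge]

end IsHomotopy

end Homotopy

/-! ### The normalizer of a partial monoid -/

section Normalizer

variable {M : SSet.{u}}

lemma mem_normalizer_iff {M E : SSet.{u}} [PartialMonoid M] {i : M ⟶ E} {η : E _⦋1⦌} :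
    η ∈ normalizer i ↔ ∃ f F, IsHomotopy F f i η :=
  exists_congr fun _ => determinesHomotopy_iff_exists

section PartialMonoid

variable [PartialMonoid M]

lemma unit_mem_normalizer : unit M ∈ normalizer (𝟙 M) :=
  mem_normalizer_iff.2 ⟨_, _, IsHomotopy.refl (𝟙 M)⟩

lemma exists_mul2_of_mem_normalizer {a : M _⦋1⦌} (ha : a ∈ normalizer (𝟙 M)) (x : M _⦋1⦌) :
    ∃ p, Mul2 M a x p := by
  obtain ⟨f, F, hF⟩ := mem_normalizer_iff.1 ha
  exact ⟨_, hF.mul2_right x⟩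

lemma mul_mem_normalizer {a b p : M _⦋1⦌} (ha : a ∈ normalizer (𝟙 M))
    (hb : b ∈ normalizer (𝟙 M)) (h : Mul2 M a b p) : p ∈ normalizer (𝟙 M) := by
  obtain ⟨f, F, hF⟩ := mem_normalizer_iff.1 ha
  obtain ⟨g, G, hG⟩ := mem_normalizer_iff.1 hb
  have := hF.comp hG
  rw [Category.comp_id] at this
  exact mem_normalizer_iff.2 ⟨_, _, (hF.mul2_right b).unique h ▸ this⟩

lemma app_mem_normalizer (t : Aut M) {a : M _⦋1⦌} (ha : a ∈ normalizer (𝟙 M)) :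
    applyAut t a ∈ normalizer (𝟙 M) := by
  obtain ⟨f, F, hF⟩ := mem_normalizer_iff.1 ha
  have := (hF.precomp t.inv).postcomp t.hom
  rw [Category.comp_id, t.inv_hom_id] at this
  exact mem_normalizer_iff.2 ⟨_, _, this⟩

/-- Apply the homotopy to the degenerate simplex $[1|m]$, paired with the operator that sends only
the vertex 0 to 0. Its first edge yields $a$, and the other edges lie at the end where the homotopy
is the identity. -/
lemma exists_cons {a : M _⦋1⦌} (ha : a ∈ normalizer (𝟙 M)) {n : ℕ} (m : M _⦋n⦌) :
    ∃ s : M _⦋n + 1⦌, spine M s 0 = a ∧ ∀ k : Fin n, spine M s k.succ = spine M m k := by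
  obtain ⟨f, F, hF⟩ := mem_normalizer_iff.1 ha
  let α : ⦋n + 1⦌ ⟶ ⦋1⦌ := SimplexCategory.Hom.mk
    ⟨fun v => if v = 0 then 0 else 1, fun v w h => by
      change (if v = 0 then (0 : Fin 2) else 1) ≤ (if w = 0 then (0 : Fin 2) else 1)
      by_cases h1 : v = 0
      · rw [if_pos h1]
        exact Fin.zero_le _
      · rw [if_neg h1, if_neg fun h2 => h1 (le_antisymm (h.trans (le_of_eq h2)) (Fin.zero_le _))]⟩
  refine ⟨ev F (res (SimplexCategory.σ 0) m) α, ?_, fun k => ?_⟩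
  · have h : spine M (res (SimplexCategory.σ 0) m) 0 = unit M :=
      (spine_res _ _ _).trans (edge_eq_unit _ rfl _)
    rw [spine_ev, h, ← hF.edge]
    exact congrArg (ev F _) (SimplexCategory.Hom.ext_one_left _ _ rfl rfl)
  · rw [spine_ev, show SimplexCategory.mkOfSucc k.succ ≫ α = cst 1 1 1 from
      SimplexCategory.Hom.ext_one_left _ _ rfl rfl, hF.one, spine_res]
    rfl

/-- Words in $N(M)$ always exist. Cocycle conditions thereby become identities in an ordinary
monoid. -/
lemma exists_of_forall_mem_normalizer {n : ℕ} (w : Fin n → M _⦋1⦌)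
    (hw : ∀ k, w k ∈ normalizer (𝟙 M)) : ∃ s : M _⦋n⦌, spine M s = w := by
  induction n with
  | zero => exact ⟨vertex M, funext fun k => k.elim0⟩
  | succ n ih =>
    obtain ⟨m, hm⟩ := ih (fun k => w k.succ) (fun k => hw _)
    obtain ⟨s, h0, hs⟩ := exists_cons (hw 0) m
    refine ⟨s, funext fun k => ?_⟩
    induction k using Fin.cases with
    | zero => exact h0
    | succ k => rw [hs, hm]

variable (M) in
/-- The edges of the normalizer `N(M)`, as a type. -/
def NMon := {a : M _⦋1⦌ // a ∈ normalizer (𝟙 M)}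

lemma isProd_three_of_mul2 {X : SSet.{u}} [PartialMonoid X] {x y z p q : X _⦋1⦌}
    (h : ∃ s : X _⦋3⦌, spine X s = ![x, y, z]) (h1 : Mul2 X x y q) (h2 : Mul2 X q z p) :
    IsProd X ![x, y, z] p := by
  obtain ⟨s, hs⟩ := h
  refine ⟨s, hs, ?_⟩
  have m02 := mul2_edge s 0 1 2 (by decide) (by decide)
  have m03 := mul2_edge s 0 2 3 (by decide) (by decide)
  rw [show edge X 0 1 _ s = x from congrFun hs 0,
    show edge X 1 2 _ s = y from congrFun hs 1] at m02
  rw [m02.unique h1, show edge X 2 3 _ s = z from congrFun hs 2] at m03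
  exact m03.unique h2

lemma IsProd.exists_mul2_left {X : SSet.{u}} {x y z p : X _⦋1⦌}
    (h : IsProd X ![x, y, z] p) : ∃ q, Mul2 X x y q ∧ Mul2 X q z p := by
  obtain ⟨s, hs, rfl⟩ := h
  have m02 := mul2_edge s 0 1 2 (by decide) (by decide)
  have m03 := mul2_edge s 0 2 3 (by decide) (by decide)
  rw [show edge X 0 1 _ s = x from congrFun hs 0,
    show edge X 1 2 _ s = y from congrFun hs 1] at m02
  rw [show edge X 2 3 _ s = z from congrFun hs 2] at m03
  exact ⟨_, m02, m03⟩

lemma IsProd.exists_mul2_right {X : SSet.{u}} {x y z p : X _⦋1⦌}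
    (h : IsProd X ![x, y, z] p) : ∃ q, Mul2 X y z q ∧ Mul2 X x q p := by
  obtain ⟨s, hs, rfl⟩ := h
  have m02 := mul2_edge s 1 2 3 (by decide) (by decide)
  have m03 := mul2_edge s 0 1 3 (by decide) (by decide)
  rw [show edge X 1 2 _ s = y from congrFun hs 1,
    show edge X 2 3 _ s = z from congrFun hs 2] at m02
  rw [show edge X 0 1 _ s = x from congrFun hs 0] at m03
  exact ⟨_, m02, m03⟩

lemma exists_mul_NMon (a b : NMon M) : ∃ c : NMon M, Mul2 M a.1 b.1 c.1 := by
  obtain ⟨p, hp⟩ := exists_mul2_of_mem_normalizer a.2 b.1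
  exact ⟨⟨p, mul_mem_normalizer a.2 b.2 hp⟩, hp⟩

noncomputable instance : Mul (NMon M) := ⟨fun a b => (exists_mul_NMon a b).choose⟩

noncomputable instance : One (NMon M) := ⟨⟨unit M, unit_mem_normalizer⟩⟩

lemma NMon.mul2 (a b : NMon M) : Mul2 M a.1 b.1 (a * b).1 := (exists_mul_NMon a b).choose_spec

lemma NMon.mul2_iff {a b c : NMon M} : Mul2 M a.1 b.1 c.1 ↔ a * b = c :=
  ⟨fun h => Subtype.ext ((NMon.mul2 a b).unique h), fun h => h ▸ NMon.mul2 a b⟩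

lemma NMon.exists_three (a b c : NMon M) : ∃ s : M _⦋3⦌, spine M s = ![a.1, b.1, c.1] :=
  exists_of_forall_mem_normalizer _ fun k => by
    fin_cases k
    exacts [a.2, b.2, c.2]

noncomputable instance : Monoid (NMon M) where
  mul_assoc a b c := by
    obtain ⟨q, h1, h2⟩ := (isProd_three_of_mul2 (NMon.exists_three a b c) (NMon.mul2 a b)
      (NMon.mul2 (a * b) c)).exists_mul2_right
    obtain rfl := h1.unique (NMon.mul2 b c)
    exact (NMon.mul2_iff.1 h2).symm
  one_mul a := NMon.mul2_iff.1 (unit_mul2 a.1)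
  mul_one a := NMon.mul2_iff.1 (mul2_unit a.1)

lemma NMon.isProd_three_iff {a b c d : NMon M} :
    IsProd M ![a.1, b.1, c.1] d.1 ↔ a * b * c = d := by
  have h := isProd_three_of_mul2 (NMon.exists_three a b c) (NMon.mul2 a b) (NMon.mul2 (a * b) c)
  exact ⟨fun h' => Subtype.ext (h.unique h'), fun h' => h' ▸ h⟩

/-- The action of automorphisms on `N(M)`. -/
def NMon.map (t : Aut M) (a : NMon M) : NMon M := ⟨applyAut t a.1, app_mem_normalizer t a.2⟩

lemma NMon.map_mul (t : Aut M) (a b : NMon M) : NMon.map t (a * b) = NMon.map t a * NMon.map t b :=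
  (NMon.mul2_iff.1 ((NMon.mul2 a b).app t.hom)).symm

end PartialMonoid

section PartialGroup

variable [PartialGroup M]

/-- A right inverse of an edge must be its inverse in $M$, which is two-sided. -/
lemma NMon.isUnit_of_mul_eq_one {a b : NMon M} (h : a * b = 1) : IsUnit a := by
  have h1 : Mul2 M a.1 b.1 (unit M) := NMon.mul2_iff.2 h
  have h2 : b.1 = inv M a.1 := h1.left_cancel (mul2_inv_self a.1)
  have h3 : Mul2 M b.1 a.1 (unit M) := h2 ▸ inv_mul2_self a.1
  exact ⟨⟨a, b, h, NMon.mul2_iff.1 h3⟩, rfl⟩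

/-- Homotopies for $a$ and for its inverse compose, in either order, to homotopies with edge 1
ending at the identity. These are constant by `IsHomotopy.ext`, so the two homotopies are mutually
inverse over every simplex of $\Delta[1]$. -/
lemma exists_isHomotopy_of_isUnit {a : NMon M} (ha : IsUnit a) :
    ∃ (c : Aut M) (F : M ⊗ (Δ[1] : SSet.{u}) ⟶ M), IsHomotopy F c.hom (𝟙 M) a.1 ∧
      ∀ (r : ℕ) (α : ⦋r⦌ ⟶ ⦋1⦌), Function.Bijective (fun x : M _⦋r⦌ => ev F x α) := by
  obtain ⟨b, hab, hba⟩ := isUnit_iff_exists.1 ha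
  obtain ⟨f, F, hF⟩ := mem_normalizer_iff.1 a.2
  obtain ⟨g, G, hG⟩ := mem_normalizer_iff.1 b.2
  have key {f g : M ⟶ M} {F G : M ⊗ (Δ[1] : SSet.{u}) ⟶ M} {a b : NMon M}
      (hF : IsHomotopy F f (𝟙 M) a.1) (hG : IsHomotopy G g (𝟙 M) b.1) (hab : a * b = 1) :
      g ≫ f = 𝟙 M ∧ compTensor F G = fst _ _ ≫ 𝟙 M := by
    have := hF.comp hG
    rw [Category.comp_id, (hF.mul2_right b.1).unique (NMon.mul2_iff.2 hab : Mul2 M a.1 b.1 _)]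
      at this
    have h := this.eq_of_unit
    rw [h] at this
    exact ⟨h, this.ext (IsHomotopy.refl (𝟙 M))⟩
  obtain ⟨h1, h2⟩ := key hF hG hab
  obtain ⟨h3, h4⟩ := key hG hF hba
  refine ⟨⟨f, g, h3, h1⟩, F, hF, fun r α => ?_⟩
  rw [Function.bijective_iff_has_inverse]
  refine ⟨fun x => ev G x α, fun x => ?_, fun x => ?_⟩
  · exact (ev_compTensor G F x α).symm.trans (by rw [h4]; rfl)
  · exact (ev_compTensor F G x α).symm.trans (by rw [h2]; rfl)

/-- Precomposition with $t^{-1}$ makes the homotopy end at the identity. The reversed homotopy,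
treated likewise with $t'^{-1}$, puts the inverse edge in $N(M)$ too. -/
lemma isUnit_of_determinesHomotopy {t t' : Aut M} {a : M _⦋1⦌}
    (h : DeterminesHomotopy a t'.hom t.hom) :
    ∃ ha : a ∈ normalizer (𝟙 M), IsUnit (M := NMon M) ⟨a, ha⟩ := by
  obtain ⟨F, hF⟩ := determinesHomotopy_iff_exists.1 h
  obtain ⟨G, hG⟩ := hF.reverse
  have hF' := hF.precomp t.inv
  have hG' := hG.precomp t'.inv
  rw [t.inv_hom_id] at hF'
  rw [t'.inv_hom_id] at hG'
  have ha := mem_normalizer_iff.2 ⟨_, _, hF'⟩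
  have hb := mem_normalizer_iff.2 ⟨_, _, hG'⟩
  exact ⟨ha, NMon.isUnit_of_mul_eq_one (a := ⟨a, ha⟩) (b := ⟨inv M a, hb⟩)
    (NMon.mul2_iff.1 (mul2_inv_self a))⟩

end PartialGroup

end Normalizer

/-! ### Automorphisms acting on simplices -/

section ApplyAut

variable {M : SSet.{u}} {m n : ℕ}

lemma applyAut_mul (a b : Aut M) (x : M _⦋n⦌) : applyAut (a * b) x = applyAut a (applyAut b x) := rfl

@[simp]
lemma applyAut_one (x : M _⦋n⦌) : applyAut 1 x = x := rfl

@[simp]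
lemma applyAut_inv_applyAut (a : Aut M) (x : M _⦋n⦌) : applyAut a⁻¹ (applyAut a x) = x := by
  rw [← applyAut_mul, inv_mul_cancel, applyAut_one]

@[simp]
lemma applyAut_applyAut_inv (a : Aut M) (x : M _⦋n⦌) : applyAut a (applyAut a⁻¹ x) = x := by
  rw [← applyAut_mul, mul_inv_cancel, applyAut_one]

lemma applyAut_injective (a : Aut M) : Function.Injective (applyAut a : M _⦋n⦌ → M _⦋n⦌) :=
  Function.LeftInverse.injective (applyAut_inv_applyAut a)

lemma applyAut_res (a : Aut M) (α : ⦋m⦌ ⟶ ⦋n⦌) (x : M _⦋n⦌) :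
    applyAut a (res α x) = res α (applyAut a x) := app_res _ _ _

lemma spine_applyAut (a : Aut M) (x : M _⦋n⦌) (k : Fin n) :
    spine M (applyAut a x) k = applyAut a (spine M x k) := (app_spine _ _ _).symm

lemma aut_ext [PartialMonoid M] {a b : Aut M} (h : ∀ x : M _⦋1⦌, applyAut a x = applyAut b x) :
    a = b :=
  Iso.ext (hom_ext_of_edges h)

/-- The product of the first `k` of the automorphisms `a`. -/
def cumul (a : Fin n → Aut M) (k : ℕ) : Aut M := ((List.ofFn a).take k).prod

lemma cumul_zero (a : Fin n → Aut M) : cumul a 0 = 1 := rfl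

lemma cumul_succ (a : Fin n → Aut M) (k : Fin n) :
    cumul a (k + 1 : ℕ) = cumul a k * a k := by
  simp [cumul, List.take_add_one, List.prod_append]

end ApplyAut

/-! ### Extensions, element by element -/

section Extension

variable {M E H : SSet.{u}}

/-- `P : M ⊗ Δ[n] ⟶ E` identifies `M ⊗ Δ[n]` with the pullback of `τ` along the simplex `b`. -/
structure IsTriv {n : ℕ} (P : M ⊗ (Δ[n] : SSet.{u}) ⟶ E) (τ : E ⟶ H) (b : H _⦋n⦌) : Prop where
  proj : ∀ (r : ℕ) (x : M _⦋r⦌) (α : ⦋r⦌ ⟶ ⦋n⦌), τ.app _ (ev P x α) = res α b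
  injective : ∀ (r : ℕ) (α : ⦋r⦌ ⟶ ⦋n⦌), Function.Injective (fun x : M _⦋r⦌ => ev P x α)
  surjective : ∀ (r : ℕ) (α : ⦋r⦌ ⟶ ⦋n⦌) (s : E _⦋r⦌), τ.app _ s = res α b → ∃ x, ev P x α = s

/-- The simplex of dimension `r` on the vertex of a partial monoid. -/
noncomputable def pt (X : SSet.{u}) [PartialMonoid X] (r : ℕ) : X _⦋r⦌ :=
  res (SimplexCategory.const ⦋r⦌ ⦋0⦌ 0) (vertex X)

lemma res_pt {X : SSet.{u}} [PartialMonoid X] {q r : ℕ} (β : ⦋q⦌ ⟶ ⦋r⦌) :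
    res β (pt X r) = pt X q := res_res _ _ _

lemma res_cst {X : SSet.{u}} [PartialMonoid X] {r n : ℕ} (j : Fin (n + 1)) (x : X _⦋n⦌) :
    res (cst r n j) x = pt X r := by
  rw [pt, vertex_eq (vertex X) (res (cst 0 n j) x), res_res]
  rfl

lemma res_unit {X : SSet.{u}} [PartialMonoid X] {r : ℕ} (α : ⦋r⦌ ⟶ ⦋1⦌) :
    res α (unit X) = pt X r := by
  rw [unit, σ_eq_res, res_res, pt]
  exact congrArg (fun a => res a _) (Subsingleton.elim _ _)

lemma pt_one {X : SSet.{u}} [PartialMonoid X] : pt X 1 = unit X := by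
  rw [← res_unit (𝟙 _), res_id]

/-- The elementwise form of an extension. -/
structure IsExt [PartialMonoid H] (i : M ⟶ E) (τ : E ⟶ H) : Prop where
  injective : ∀ r : ℕ, Function.Injective (fun x : M _⦋r⦌ => i.app _ x)
  proj : ∀ (r : ℕ) (x : M _⦋r⦌), τ.app _ (i.app _ x) = pt H r
  surjective : ∀ (r : ℕ) (s : E _⦋r⦌), τ.app _ s = pt H r → ∃ x, i.app _ x = s
  exists_triv : ∀ (n : ℕ) (b : H _⦋n⦌), ∃ P : M ⊗ (Δ[n] : SSet.{u}) ⟶ E, IsTriv P τ b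

lemma isPullback_elementwise {A B C D : SSet.{u}} {f : A ⟶ B} {g : A ⟶ C} {h : B ⟶ D} {k : C ⟶ D}
    (sq : IsPullback f g h k) (r : ℕ) (x : B _⦋r⦌) (y : C _⦋r⦌) (hxy : h.app _ x = k.app _ y) :
    ∃! z : A _⦋r⦌, f.app _ z = x ∧ g.app _ z = y := by
  have sq' := sq.map ((evaluation _ _).obj (op ⦋r⦌))
  rw [Limits.Types.isPullback_iff] at sq'
  obtain ⟨-, h1, h2⟩ := sq'
  obtain ⟨z, hz1, hz2⟩ := h2 x y hxy
  exact ⟨z, ⟨hz1, hz2⟩, fun z' hz' => h1 _ _ ⟨hz'.1.trans hz1.symm, hz'.2.trans hz2.symm⟩⟩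

lemma IsExtension.isExt [PartialMonoid H] {i : M ⟶ E} {τ : E ⟶ H} (h : IsExtension i τ) :
    IsExt i τ := by
  obtain ⟨c, v, sq⟩ := h.isPullback
  have hv (r : ℕ) (y : (Δ[0] : SSet.{u}) _⦋r⦌) : v.app _ y = pt H r := by
    have : y = res (SSet.stdSimplex.objEquiv y)
        (SSet.stdSimplex.objEquiv.symm (𝟙 ⦋0⦌) : (Δ[0] : SSet.{u}) _⦋0⦌) :=
      SSet.stdSimplex.objEquiv.injective (Subsingleton.elim (α := ⦋r⦌ ⟶ ⦋0⦌) _ _)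
    rw [this, app_res, pt]
    exact congrArg₂ res (Subsingleton.elim _ _) (vertex_eq _ _)
  have hc (r : ℕ) (x x' : (Δ[0] : SSet.{u}) _⦋r⦌) : x = x' :=
    SSet.stdSimplex.objEquiv.injective (Subsingleton.elim (α := ⦋r⦌ ⟶ ⦋0⦌) _ _)
  have comm (r : ℕ) (x : M _⦋r⦌) : τ.app _ (i.app _ x) = v.app _ (c.app _ x) :=
    ConcreteCategory.congr_hom (NatTrans.congr_app sq.w (op ⦋r⦌)) x
  refine ⟨fun r x x' hx => ?_, fun r x => (comm r x).trans (hv r _), fun r s hs => ?_,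
    fun n b => ?_⟩
  · obtain ⟨z, -, hz⟩ := isPullback_elementwise sq r (i.app _ x) (c.app _ x) (comm r x)
    exact (hz x ⟨rfl, rfl⟩).trans (hz x' ⟨hx.symm, hc _ _ _⟩).symm
  · obtain ⟨z, hz, -⟩ := isPullback_elementwise sq r s
      (SSet.stdSimplex.objEquiv.symm (SimplexCategory.const ⦋r⦌ ⦋0⦌ 0)) (hs.trans (hv r _).symm)
    exact ⟨z, hz.1⟩
  · obtain ⟨P, sqP⟩ := h.isFibreBundle.locally_trivial n (SSet.yonedaEquiv.symm b)
    have commP (r : ℕ) (x : M _⦋r⦌) (α : ⦋r⦌ ⟶ ⦋n⦌) : τ.app _ (ev P x α) = res α b :=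
      ConcreteCategory.congr_hom (NatTrans.congr_app sqP.w (op ⦋r⦌))
        ((x, SSet.stdSimplex.objEquiv.symm α) : (M ⊗ (Δ[n] : SSet.{u}) : SSet.{u}) _⦋r⦌)
    refine ⟨P, commP, fun r α x x' hx => ?_, fun r α s hs => ?_⟩
    · obtain ⟨z, -, hz⟩ := isPullback_elementwise sqP r (ev P x α)
        (SSet.stdSimplex.objEquiv.symm α) (commP r x α)
      exact congrArg Prod.fst ((hz (x, SSet.stdSimplex.objEquiv.symm α) ⟨rfl, rfl⟩).trans
        (hz (x', SSet.stdSimplex.objEquiv.symm α) ⟨hx.symm, rfl⟩).symm)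
    · obtain ⟨z, hz, -⟩ := isPullback_elementwise sqP r s (SSet.stdSimplex.objEquiv.symm α) hs
      refine ⟨z.1, Eq.trans ?_ hz.1⟩
      rw [ev, ← hz.2]
      rfl

/-- The universal property of the pullback, restricted to the face or degeneracy `β` of the base
simplex. Injectivity of `P` makes the chosen lifts natural. -/
lemma IsTriv.exists_lift {n k : ℕ} {P : M ⊗ (Δ[n] : SSet.{u}) ⟶ E} {τ : E ⟶ H} {b : H _⦋n⦌}
    (hP : IsTriv P τ b) {Y : SSet.{u}} (F : Y ⊗ (Δ[k] : SSet.{u}) ⟶ E) (β : ⦋k⦌ ⟶ ⦋n⦌)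
    (hF : ∀ (r : ℕ) (y : Y _⦋r⦌) (α : ⦋r⦌ ⟶ ⦋k⦌), τ.app _ (ev F y α) = res (α ≫ β) b) :
    ∃ G : Y ⊗ (Δ[k] : SSet.{u}) ⟶ M, ∀ (r : ℕ) (y : Y _⦋r⦌) (α : ⦋r⦌ ⟶ ⦋k⦌),
      ev P (ev G y α) (α ≫ β) = ev F y α := by
  choose G hG using fun r (y : Y _⦋r⦌) (α : ⦋r⦌ ⟶ ⦋k⦌) => hP.surjective r (α ≫ β) _ (hF r y α)
  refine ⟨tensorHom G fun q r β' y α => ?_, hG⟩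
  refine hP.injective q ((β' ≫ α) ≫ β) ?_
  change ev P (G q (res β' y) (β' ≫ α)) ((β' ≫ α) ≫ β) = ev P (res β' (G r y α)) ((β' ≫ α) ≫ β)
  rw [hG, Category.assoc, ← res_ev, ← res_ev, hG]

lemma IsExt.exists_lift [PartialMonoid H] {i : M ⟶ E} {τ : E ⟶ H} (h : IsExt i τ) {Y : SSet.{u}}
    (f : Y ⟶ E) (hf : ∀ (r : ℕ) (y : Y _⦋r⦌), τ.app _ (f.app _ y) = pt H r) :
    ∃ g : Y ⟶ M, g ≫ i = f := by
  choose g hg using fun r (y : Y _⦋r⦌) => h.surjective r _ (hf r y)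
  refine ⟨⟨fun n => ↾(g n.unop.len), ?_⟩, ?_⟩
  · rintro ⟨⟨r⟩⟩ ⟨⟨q⟩⟩ ⟨α⟩
    ext y
    refine h.injective q ?_
    exact (hg q (res α y)).trans ((app_res f α y).trans
      ((congrArg (res α) (hg r y)).symm.trans (app_res i α (g r y)).symm))
  · ext ⟨⟨r⟩⟩ y
    exact hg r y

/-- Simplices with equal spines have the same image $b$ in $H$. They therefore lie in one
trivialization over $b$, where their components in $M$ have equal spines. -/
lemma IsExt.partialMonoid [PartialMonoid M] [PartialMonoid H] {i : M ⟶ E} {τ : E ⟶ H}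
    (h : IsExt i τ) : PartialMonoid E where
  existsUnique_vertex := by
    refine ⟨i.app _ (vertex M), trivial, fun s _ => ?_⟩
    obtain ⟨x, rfl⟩ := h.surjective 0 s (vertex_eq _ _)
    rw [vertex_eq x (vertex M)]
  spine_injective n hn s s' hs := by
    obtain ⟨P, hP⟩ := h.exists_triv n (τ.app _ s)
    have hb : τ.app _ s = τ.app _ s' := eq_of_spine fun k => by
      rw [← app_spine, ← app_spine, hs]
    obtain ⟨x, hx⟩ := hP.surjective n (𝟙 _) s (res_id _).symm
    obtain ⟨x', hx'⟩ := hP.surjective n (𝟙 _) s' (hb.symm.trans (res_id _).symm)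
    have : x = x' := eq_of_spine fun k => by
      have := congrFun hs k
      rw [← hx, ← hx', spine_ev, spine_ev] at this
      exact hP.injective 1 _ this
    rw [← hx, ← hx', this]

/-- As $H$ has only one vertex, `i` and the restriction of `P` to any vertex of $\Delta[n]$ identify
$M$ with the same fibre. -/
lemma IsTriv.exists_aut [PartialMonoid H] {i : M ⟶ E} {τ : E ⟶ H} (h : IsExt i τ) {n : ℕ}
    {P : M ⊗ (Δ[n] : SSet.{u}) ⟶ E} {b : H _⦋n⦌} (hP : IsTriv P τ b) (j : Fin (n + 1)) :
    ∃ c : Aut M, ∀ (r : ℕ) (x : M _⦋r⦌), ev P (applyAut c x) (cst r n j) = i.app _ x := by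
  obtain ⟨d, hd⟩ := h.exists_lift (Y := M) ⟨fun r => ↾fun x => ev P x (cst r.unop.len n j), by
    rintro ⟨⟨r⟩⟩ ⟨⟨q⟩⟩ ⟨α⟩
    ext x
    exact (res_ev P α x (cst r n j)).symm⟩ (fun r x => (hP.proj r x _).trans (res_cst _ _))
  have hd' (r : ℕ) (x : M _⦋r⦌) : i.app _ (d.app _ x) = ev P x (cst r n j) :=
    ConcreteCategory.congr_hom (NatTrans.congr_app hd (op ⦋r⦌)) x
  -- The inverse comparison, lifting `i` through `P`; `Y ⊗ Δ[0]` stands for `Y`.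
  obtain ⟨c, hc⟩ := hP.exists_lift (k := 0) (fst M _ ≫ i) (cst 0 n j) (fun r y α => by
    rw [ev_fst_comp, h.proj]
    exact (res_cst j b).symm)
  have hc' (r : ℕ) (x : M _⦋r⦌) : ev P (ev c x (cst r 0 0)) (cst r n j) = i.app _ x :=
    hc r x (cst r 0 0)
  let c' : M ⟶ M := ⟨fun r => ↾fun x => ev c x (cst r.unop.len 0 0), by
    rintro ⟨⟨r⟩⟩ ⟨⟨q⟩⟩ ⟨α⟩
    ext x
    exact (res_ev c α x (cst r 0 0)).symm⟩
  refine ⟨⟨c', d, ?_, ?_⟩, hc'⟩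
  · ext ⟨⟨r⟩⟩ x
    exact h.injective r ((hd' r _).trans (hc' r x))
  · ext ⟨⟨r⟩⟩ x
    exact hP.injective r (cst r n j) ((hc' r _).trans (hd' r x))

/-! ### Framings and their extension over simplices -/

/-- A family of trivializations of an extension over the edges of the base, normalized to be the
inclusion of the fibre over the vertex `1`. -/
structure Framing [PartialMonoid H] (i : M ⟶ E) (τ : E ⟶ H) where
  t : H _⦋1⦌ → Aut M
  F : H _⦋1⦌ → (M ⊗ (Δ[1] : SSet.{u}) ⟶ E)
  zero : ∀ (g : H _⦋1⦌) (r : ℕ) (x : M _⦋r⦌), ev (F g) x (cst r 1 0) = i.app _ (applyAut (t g) x)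
  one : ∀ (g : H _⦋1⦌) (r : ℕ) (x : M _⦋r⦌), ev (F g) x (cst r 1 1) = i.app _ x
  triv : ∀ g, IsTriv (F g) τ g
  unit : F (PartialGroups.unit H) = fst _ _ ≫ i

lemma IsTriv.precomp {τ : E ⟶ H} {n : ℕ}
    {P : M ⊗ (Δ[n] : SSet.{u}) ⟶ E} {b : H _⦋n⦌} (hP : IsTriv P τ b) (c : Aut M) :
    IsTriv (c.hom ▷ (Δ[n] : SSet.{u}) ≫ P) τ b where
  proj r x α := hP.proj r _ α
  injective r α x x' hx := applyAut_injective c (hP.injective r α hx)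
  surjective r α s hs := by
    obtain ⟨x, rfl⟩ := hP.surjective r α s hs
    exact ⟨applyAut c⁻¹ x, by
      rw [ev_whiskerRight_comp]; exact congrArg (ev P · α) (applyAut_applyAut_inv c x)⟩

lemma IsExt.nonempty_framing [PartialMonoid H] {i : M ⟶ E} {τ : E ⟶ H} (h : IsExt i τ) :
    Nonempty (Framing i τ) := by
  have key (g : H _⦋1⦌) : ∃ (t : Aut M) (F : M ⊗ (Δ[1] : SSet.{u}) ⟶ E),
      (∀ (r : ℕ) (x : M _⦋r⦌), ev F x (cst r 1 0) = i.app _ (applyAut t x)) ∧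
      (∀ (r : ℕ) (x : M _⦋r⦌), ev F x (cst r 1 1) = i.app _ x) ∧ IsTriv F τ g ∧
      (g = unit H → F = fst _ _ ≫ i) := by
    -- Over the unit edge the constant trivialization is imposed; this will give $t(1)=1$ and the
    -- normalization of the cocycle.
    by_cases hg : g = unit H
    · subst hg
      refine ⟨1, fst _ _ ≫ i, fun _ _ => rfl, fun _ _ => rfl, ⟨fun r x α => ?_, fun r α => ?_,
        fun r α s hs => ?_⟩, fun _ => rfl⟩
      · rw [ev_fst_comp, h.proj, res_unit]
      · exact h.injective r
      · exact h.surjective r s (hs.trans (res_unit _))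
    · obtain ⟨P, hP⟩ := h.exists_triv 1 g
      obtain ⟨c, hc⟩ := hP.exists_aut h 1
      have hP' := hP.precomp c
      obtain ⟨d, hd⟩ := hP'.exists_aut h 0
      refine ⟨d⁻¹, _, fun r x => ?_, hc, hP', fun h => absurd h hg⟩
      rw [← hd, applyAut_applyAut_inv]
  choose t F h0 h1 h2 h3 using key
  exact ⟨⟨t, F, h0, h1, h2, h3 _ rfl⟩⟩

/-- The map `Δ[n] ⟶ Δ[1]` which collapses the vertices up to `k`, and those after `k`. -/
def collapse (n k : ℕ) : ⦋n⦌ ⟶ ⦋1⦌ :=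
  SimplexCategory.Hom.mk ⟨fun v => if v.val ≤ k then 0 else 1, fun v w h => by
    change (if v.val ≤ k then (0 : Fin 2) else 1) ≤ (if w.val ≤ k then (0 : Fin 2) else 1)
    by_cases h1 : w.val ≤ k
    · rw [if_pos (show v.val ≤ k from le_trans (show v.val ≤ w.val from h) h1)]
      exact Fin.zero_le _
    · rw [if_neg h1]
      exact Fin.le_last _⟩

lemma collapse_of_le {n k : ℕ} {v : Fin (n + 1)} (h : v.val ≤ k) :
    (collapse n k).toOrderHom v = 0 := if_pos h

lemma collapse_of_lt {n k : ℕ} {v : Fin (n + 1)} (h : k < v.val) :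
    (collapse n k).toOrderHom v = 1 := if_neg (not_le.2 h)

lemma mkOfSucc_collapse (n : ℕ) (k : Fin n) :
    SimplexCategory.mkOfSucc k ≫ collapse n k = 𝟙 ⦋1⦌ :=
  SimplexCategory.Hom.ext_one_left _ _ (collapse_of_le le_rfl) (collapse_of_lt (Nat.lt_succ_self _))

lemma mkOfSucc_collapse_of_lt {n k : ℕ} (j : Fin n) (h : j.val < k) :
    SimplexCategory.mkOfSucc j ≫ collapse n k = cst 1 1 0 :=
  SimplexCategory.Hom.ext_one_left _ _ (collapse_of_le h.le) (collapse_of_le h)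

lemma cst_comp {r n m : ℕ} (j : Fin (n + 1)) (α : ⦋n⦌ ⟶ ⦋m⦌) :
    cst r n j ≫ α = cst r m (α.toOrderHom j) := rfl

/-- Induction along the vertices. A trivialization that already follows the framing on the first $k$
edges is compared with the framing over the next edge. The comparison is an automorphism of
$M\times\Delta[1]$ over $\Delta[1]$; pulled back along `collapse n k` it corrects that edge and
leaves the earlier ones alone. The twist by `cumul` arises because the trivialization is normalized
at the vertex 0, but the framing at the vertex 1. -/
lemma Framing.exists_triv [PartialMonoid H] {i : M ⟶ E} {τ : E ⟶ H} (h : IsExt i τ)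
    (𝓕 : Framing i τ) {n : ℕ} (b : H _⦋n⦌) :
    ∃ P : M ⊗ (Δ[n] : SSet.{u}) ⟶ E, IsTriv P τ b ∧
      (∀ (k : Fin n) (x : M _⦋1⦌), ev P x (SimplexCategory.mkOfSucc k) = ev (𝓕.F (spine H b k))
        (applyAut (cumul (fun j => 𝓕.t (spine H b j)) (k + 1 : ℕ))⁻¹ x) (𝟙 _)) ∧
      (∀ (r : ℕ) (x : M _⦋r⦌), ev P x (cst r n 0) = i.app _ x) ∧
      ∀ (r : ℕ) (x : M _⦋r⦌), ev P x (cst r n (Fin.last n)) =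
        i.app _ (applyAut (cumul (fun j => 𝓕.t (spine H b j)) n)⁻¹ x) := by
  set T := cumul (fun j => 𝓕.t (spine H b j)) with hT
  have key (k : Fin (n + 1)) : ∃ P : M ⊗ (Δ[n] : SSet.{u}) ⟶ E, IsTriv P τ b ∧
      (∀ (j : Fin n), j.val < k.val → ∀ (x : M _⦋1⦌), ev P x (SimplexCategory.mkOfSucc j) =
        ev (𝓕.F (spine H b j)) (applyAut (T (j + 1 : ℕ))⁻¹ x) (𝟙 _)) ∧
      (∀ (r : ℕ) (x : M _⦋r⦌), ev P x (cst r n 0) = i.app _ x) ∧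
      ∀ (r : ℕ) (x : M _⦋r⦌), ev P x (cst r n k) = i.app _ (applyAut (T k)⁻¹ x) := by
    induction k using Fin.induction with
    | zero =>
      obtain ⟨P, hP⟩ := h.exists_triv n b
      obtain ⟨c, hc⟩ := hP.exists_aut h 0
      refine ⟨_, hP.precomp c, fun j hj => absurd hj (Nat.not_lt_zero _), hc, fun r x => ?_⟩
      refine (hc r x).trans ?_
      simp [hT, cumul_zero]
    | succ k ih =>
      obtain ⟨P, hP, hP1, hP0, hP2⟩ := ih
      obtain ⟨G, hG⟩ := hP.exists_lift
        ((T (k + 1 : ℕ))⁻¹.hom ▷ (Δ[1] : SSet.{u}) ≫ 𝓕.F (spine H b k))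
        (SimplexCategory.mkOfSucc k) (fun r y α => by
          rw [ev_whiskerRight_comp, (𝓕.triv _).proj, spine_apply, res_res])
      have hG' (r : ℕ) (x : M _⦋r⦌) (α : ⦋r⦌ ⟶ ⦋1⦌) :
          ev P (ev G x α) (α ≫ SimplexCategory.mkOfSucc k) =
            ev (𝓕.F (spine H b k)) (applyAut (T (k + 1 : ℕ))⁻¹ x) α := hG r x α
      have hTk : T (k + 1 : ℕ) = T k * 𝓕.t (spine H b k) := cumul_succ _ k
      -- The comparison is the identity over the vertex 0: both sides are $\imath\circ T(k)^{-1}$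
      -- there, since $T(k+1)=T(k)\,t(g)$. Hence the correction does not affect the edges before
      -- `k`.
      have hG0 (r : ℕ) (x : M _⦋r⦌) : ev G x (cst r 1 0) = x := by
        have := hG' r x (cst r 1 0)
        rw [show cst r 1 0 ≫ SimplexCategory.mkOfSucc k = cst r n k.castSucc from rfl, hP2,
          𝓕.zero, hTk, mul_inv_rev, applyAut_mul, applyAut_applyAut_inv] at this
        exact applyAut_injective _ (h.injective r this)
      have hGi (r : ℕ) (α : ⦋r⦌ ⟶ ⦋1⦌) : Function.Injective (fun x : M _⦋r⦌ => ev G x α) := by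
        intro x x' hx
        have h1 := hG' r x α
        rw [show ev G x α = ev G x' α from hx, hG'] at h1
        exact (applyAut_injective _ ((𝓕.triv _).injective r α h1)).symm
      have hGs (r : ℕ) (α : ⦋r⦌ ⟶ ⦋1⦌) (m : M _⦋r⦌) : ∃ x, ev G x α = m := by
        obtain ⟨y, hy⟩ := (𝓕.triv (spine H b k)).surjective r α
          (ev P m (α ≫ SimplexCategory.mkOfSucc k)) (by rw [hP.proj, spine_apply, res_res])
        refine ⟨applyAut (T (k + 1 : ℕ)) y, hP.injective r (α ≫ SimplexCategory.mkOfSucc k) ?_⟩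
        exact (hG' r _ α).trans (by rw [applyAut_inv_applyAut, hy])
      let Q : M ⊗ (Δ[n] : SSet.{u}) ⟶ E :=
        compTensor P (M ◁ SSet.stdSimplex.map (collapse n k) ≫ G)
      have hQ (r : ℕ) (x : M _⦋r⦌) (α : ⦋r⦌ ⟶ ⦋n⦌) :
          ev Q x α = ev P (ev G x (α ≫ collapse n k)) α := rfl
      refine ⟨Q, ⟨fun r x α => ?_, fun r α x x' hx => ?_, fun r α s hs => ?_⟩, fun j hj x => ?_,
        fun r x => ?_, fun r x => ?_⟩
      · rw [hQ, hP.proj]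
      · exact hGi r _ (hP.injective r α hx)
      · obtain ⟨m, rfl⟩ := hP.surjective r α s hs
        obtain ⟨x, rfl⟩ := hGs r (α ≫ collapse n k) m
        exact ⟨x, hQ r x α⟩
      · rw [hQ]
        rcases (Nat.lt_succ_iff.1 hj).lt_or_eq with hj | hj
        · rw [mkOfSucc_collapse_of_lt j hj, hG0]
          exact hP1 j hj x
        · obtain rfl : j = k := Fin.ext hj
          rw [mkOfSucc_collapse]
          have := hG' 1 x (𝟙 _)
          rwa [Category.id_comp] at this
      · rw [hQ, cst_comp, collapse_of_le (Nat.zero_le _), hG0, hP0]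
      · have := hG' r x (cst r 1 1)
        rw [show cst r 1 1 ≫ SimplexCategory.mkOfSucc k = cst r n k.succ from rfl, 𝓕.one] at this
        rw [hQ, cst_comp, collapse_of_lt (Nat.lt_succ_self _), this]
        rfl
  obtain ⟨P, hP, h1, h2, h3⟩ := key (Fin.last n)
  exact ⟨P, hP, fun k x => h1 k k.2 x, h2, h3⟩

end Extension

/-! ### Twisted products and framings -/

lemma res_eq_self {X : SSet.{u}} {α : ⦋1⦌ ⟶ ⦋1⦌} (h0 : α.toOrderHom 0 = 0)
    (h1 : α.toOrderHom 1 = 1) (x : X _⦋1⦌) : res α x = x := by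
  rw [show α = 𝟙 _ from SimplexCategory.Hom.ext_one_left _ _ h0 h1, res_id]

lemma δ_two_σ_zero {X : SSet.{u}} [PartialMonoid X] (g : X _⦋1⦌) : X.δ 2 (X.σ 0 g) = unit X := by
  rw [δ_eq_res, σ_eq_res, res_res]
  exact res_eq_unit rfl _

lemma δ_zero_σ_zero {X : SSet.{u}} (g : X _⦋1⦌) : X.δ 0 (X.σ 0 g) = g := by
  rw [δ_eq_res, σ_eq_res, res_res]
  exact res_eq_self rfl rfl g

lemma δ_one_σ_zero {X : SSet.{u}} (g : X _⦋1⦌) : X.δ 1 (X.σ 0 g) = g := by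
  rw [δ_eq_res, σ_eq_res, res_res]
  exact res_eq_self rfl rfl g

lemma cumul_two {M : SSet.{u}} {a : Fin 2 → Aut M} : cumul a 2 = a 0 * a 1 := by
  have := cumul_succ a 1
  rw [show ((1 : Fin 2) + 1 : ℕ) = 2 from rfl] at this
  rw [this, show ((1 : Fin 2) : ℕ) = (0 : Fin 2) + 1 from rfl, cumul_succ]
  simp [cumul_zero]

section TwistedProduct

variable {M E H : SSet.{u}} [PartialGroup M] [PartialGroup H]

/-- The bijection `e` on edges identifies `E` with the twisted product of `φ`. -/
structure IsTPEquiv (i : M ⟶ E) (τ : E ⟶ H) (φ : TwistingPair H M)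
    (e : M _⦋1⦌ × H _⦋1⦌ ≃ E _⦋1⦌) : Prop where
  incl : ∀ x : M _⦋1⦌, i.app (op ⦋1⦌) x = e (x, unit H)
  proj : ∀ (x : M _⦋1⦌) (g : H _⦋1⦌), τ.app (op ⦋1⦌) (e (x, g)) = g
  words : ∀ (n : ℕ) (w : Fin n → M _⦋1⦌ × H _⦋1⦌),
      (∃ s : E _⦋n⦌, spine E s = fun k => e (w k)) ↔
        (∃ b : H _⦋n⦌, spine H b = fun k => (w k).2) ∧
        (∃ m : M _⦋n⦌, spine M m = fun k : Fin n =>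
          applyAut (cumul (fun j => φ.t (w j).2) k) (w k).1)
  mul : ∀ (b : H _⦋2⦌) (x z : M _⦋1⦌) (s : E _⦋2⦌),
      spine E s = ![e (x, H.δ 2 b), e (z, H.δ 0 b)] →
        ∃ p : M _⦋1⦌, IsProd M ![x, applyAut (φ.t (H.δ 2 b)) z, φ.η b] p ∧
          prod E s = e (p, H.δ 1 b)

lemma isTwistedProduct_iff {i : M ⟶ E} {τ : E ⟶ H} {φ : TwistingPair H M} :
    IsTwistedProduct i τ φ ↔ PartialMonoid E ∧ ∃ e, IsTPEquiv i τ φ e :=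
  and_congr_right fun _ => exists_congr fun _ =>
    ⟨fun h => ⟨h.1, h.2.1, h.2.2.1, h.2.2.2⟩, fun h => ⟨h.1, h.2, h.3, h.4⟩⟩

namespace IsTPEquiv

variable {i : M ⟶ E} {τ : E ⟶ H} {φ : TwistingPair H M} {e : M _⦋1⦌ × H _⦋1⦌ ≃ E _⦋1⦌}

lemma exists_mul2 (h : IsTPEquiv i τ φ e) {b : H _⦋2⦌} {x z : M _⦋1⦌} {q : E _⦋1⦌}
    (hq : Mul2 E (e (x, H.δ 2 b)) (e (z, H.δ 0 b)) q) :
    ∃ p : M _⦋1⦌, IsProd M ![x, applyAut (φ.t (H.δ 2 b)) z, φ.η b] p ∧ q = e (p, H.δ 1 b) := by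
  obtain ⟨s, h2, h0, rfl⟩ := hq
  obtain ⟨p, hp, hs⟩ := h.mul b x z s (by rw [spine_two, h2, h0])
  exact ⟨p, hp, by rw [← hs, prod_two]⟩

end IsTPEquiv

end TwistedProduct

/-! ### The twisting pair of a framing -/

namespace Framing

section

variable {M E H : SSet.{u}} [PartialMonoid H] {i : M ⟶ E} {τ : E ⟶ H} (𝓕 : Framing i τ)

/-- The edge `i(x) ⬝ σ(g)`, where `σ(g)` is the value of the trivialization over `g` at the
nondegenerate edge of `Δ[1]`. -/
def e (x : M _⦋1⦌) (g : H _⦋1⦌) : E _⦋1⦌ := ev (𝓕.F g) (applyAut (𝓕.t g)⁻¹ x) (𝟙 _)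

lemma ev_F (g : H _⦋1⦌) (x : M _⦋1⦌) : ev (𝓕.F g) x (𝟙 _) = 𝓕.e (applyAut (𝓕.t g) x) g := by
  rw [e, applyAut_inv_applyAut]

lemma proj_e (x : M _⦋1⦌) (g : H _⦋1⦌) : τ.app _ (𝓕.e x g) = g := by
  rw [e, (𝓕.triv g).proj, res_id]

lemma e_injective {x y : M _⦋1⦌} {g : H _⦋1⦌} (h : 𝓕.e x g = 𝓕.e y g) : x = y :=
  applyAut_injective _ ((𝓕.triv g).injective 1 (𝟙 _) h)

/-- The bijection between the edges of `E` and those of the product of `M` and `H`. -/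
noncomputable def equiv : M _⦋1⦌ × H _⦋1⦌ ≃ E _⦋1⦌ :=
  Equiv.ofBijective (fun z => 𝓕.e z.1 z.2) (by
    constructor
    · rintro ⟨x, g⟩ ⟨y, k⟩ h
      have hg := congrArg (fun s => τ.app _ s) h
      simp only [proj_e] at hg
      subst hg
      have hxy : x = y := 𝓕.e_injective h
      rw [hxy]
    · intro s
      obtain ⟨x, hx⟩ := (𝓕.triv (τ.app _ s)).surjective 1 (𝟙 _) s (res_id _).symm
      exact ⟨(applyAut (𝓕.t (τ.app _ s)) x, τ.app _ s), (𝓕.ev_F _ x).symm.trans hx⟩)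

lemma t_unit [PartialMonoid M] (h : IsExt i τ) : 𝓕.t (PartialGroups.unit H) = 1 := by
  refine aut_ext fun x => h.injective 1 ?_
  have := 𝓕.zero (PartialGroups.unit H) 1 x
  rw [𝓕.unit] at this
  exact this.symm

lemma e_unit [PartialMonoid M] (h : IsExt i τ) (x : M _⦋1⦌) :
    𝓕.e x (PartialGroups.unit H) = i.app _ x := by
  rw [e, 𝓕.t_unit h, 𝓕.unit, ev_fst_comp, inv_one, applyAut_one]

lemma exists_triv_e (h : IsExt i τ) {n : ℕ} (b : H _⦋n⦌) :
    ∃ P : M ⊗ (Δ[n] : SSet.{u}) ⟶ E, IsTriv P τ b ∧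
      (∀ (k : Fin n) (x : M _⦋1⦌), ev P x (SimplexCategory.mkOfSucc k) =
        𝓕.e (applyAut (cumul (fun j => 𝓕.t (spine H b j)) k)⁻¹ x) (spine H b k)) ∧
      (∀ (r : ℕ) (x : M _⦋r⦌), ev P x (cst r n 0) = i.app _ x) ∧
      ∀ (r : ℕ) (x : M _⦋r⦌), ev P x (cst r n (Fin.last n)) =
        i.app _ (applyAut (cumul (fun j => 𝓕.t (spine H b j)) n)⁻¹ x) := by
  obtain ⟨P, hP, h1, h2⟩ := 𝓕.exists_triv h b
  refine ⟨P, hP, fun k x => ?_, h2⟩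
  rw [h1, ev_F, cumul_succ, mul_inv_rev, applyAut_mul, applyAut_applyAut_inv]

/-- The simplices over $b$ are the values at simplices $m$ of $M$ of the trivialization adapted to
the spine of $b$. Reading off their spines in the coordinates `e` untwists the letters of $m$ by the
accumulated automorphisms. -/
lemma words [PartialMonoid M] (h : IsExt i τ) (n : ℕ) (w : Fin n → M _⦋1⦌ × H _⦋1⦌) :
    (∃ s : E _⦋n⦌, spine E s = fun k => 𝓕.e (w k).1 (w k).2) ↔
      (∃ b : H _⦋n⦌, spine H b = fun k => (w k).2) ∧
      (∃ m : M _⦋n⦌, spine M m = fun k : Fin n =>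
        applyAut (cumul (fun j => 𝓕.t (w j).2) k) (w k).1) := by
  constructor
  · rintro ⟨s, hs⟩
    have hb : spine H (τ.app _ s) = fun k => (w k).2 := by
      ext k
      rw [← app_spine, hs, proj_e]
    refine ⟨⟨_, hb⟩, ?_⟩
    obtain ⟨P, hP, hP1, -⟩ := 𝓕.exists_triv_e h (τ.app _ s)
    obtain ⟨m, rfl⟩ := hP.surjective n (𝟙 _) s (res_id _).symm
    refine ⟨m, funext fun k => ?_⟩
    have hk := congrFun hs k
    rw [spine_ev, Category.comp_id, hP1] at hk
    simp only [hb] at hk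
    rw [← 𝓕.e_injective hk, applyAut_applyAut_inv]
  · rintro ⟨⟨b, hb⟩, ⟨m, hm⟩⟩
    obtain ⟨P, hP, hP1, -⟩ := 𝓕.exists_triv_e h b
    refine ⟨ev P m (𝟙 _), funext fun k => ?_⟩
    rw [spine_ev, Category.comp_id, hP1, hm]
    simp only [hb]
    rw [applyAut_inv_applyAut]

end

section

variable {M E H : SSet.{u}} [PartialGroup M] [PartialGroup H] {i : M ⟶ E} {τ : E ⟶ H}
  (𝓕 : Framing i τ)

/-- The trivialization over $[g|h]$ follows the framing on the two spine edges, but not on the long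
edge. There the comparison `K` with the framing over $gh$, followed by $t(gh)$, is a homotopy of $M$
starting at the identity, and $\eta$ is its edge. Moving the product of the component in $M$ through
this homotopy multiplies it by $\eta$ on the right. -/
lemma exists_η (h : IsExt i τ) (b : H _⦋2⦌) : ∃ η : M _⦋1⦌,
    DeterminesHomotopy η (𝓕.t (H.δ 2 b) * 𝓕.t (H.δ 0 b)).hom (𝓕.t (H.δ 1 b)).hom ∧
    ∀ (x z : M _⦋1⦌) (s : E _⦋2⦌), spine E s = ![𝓕.e x (H.δ 2 b), 𝓕.e z (H.δ 0 b)] →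
      ∃ p : M _⦋1⦌, IsProd M ![x, applyAut (𝓕.t (H.δ 2 b)) z, η] p ∧
        prod E s = 𝓕.e p (H.δ 1 b) := by
  obtain ⟨P, hP, hP1, hP2, hP3⟩ := 𝓕.exists_triv_e h b
  have hb0 : spine H b 0 = H.δ 2 b := congrFun (spine_two b) 0
  have hb1 : spine H b 1 = H.δ 0 b := congrFun (spine_two b) 1
  have hT : cumul (fun j => 𝓕.t (spine H b j)) 2 = 𝓕.t (H.δ 2 b) * 𝓕.t (H.δ 0 b) := by
    rw [cumul_two, hb0, hb1]
  rw [hT] at hP3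
  set T := 𝓕.t (H.δ 2 b) * 𝓕.t (H.δ 0 b)
  obtain ⟨K, hK⟩ := (𝓕.triv (H.δ 1 b)).exists_lift
    (M ◁ SSet.stdSimplex.map (SimplexCategory.δ (1 : Fin 3)) ≫ P) (𝟙 _) (fun r y α =>
      (hP.proj r y (α ≫ SimplexCategory.δ 1)).trans (by
        rw [δ_eq_res, res_res, Category.comp_id]))
  have hK' (r : ℕ) (x : M _⦋r⦌) (α : ⦋r⦌ ⟶ ⦋1⦌) :
      ev (𝓕.F (H.δ 1 b)) (ev K x α) α = ev P x (α ≫ SimplexCategory.δ 1) := by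
    have := hK r x α
    rw [Category.comp_id] at this
    exact this
  have hom : IsHomotopy (K ≫ (𝓕.t (H.δ 1 b)).hom) (𝟙 M) (T⁻¹.hom ≫ (𝓕.t (H.δ 1 b)).hom)
      (applyAut (𝓕.t (H.δ 1 b)) (ev K (PartialGroups.unit M) (𝟙 _))) := by
    refine ⟨fun r x => h.injective r ?_, fun r x => ?_, rfl⟩
    · exact (𝓕.zero _ r _).symm.trans ((hK' r x _).trans (hP2 r x))
    · exact congrArg (applyAut (𝓕.t (H.δ 1 b))) (h.injective r ((𝓕.one _ r _).symm.trans
        ((hK' r x _).trans (hP3 r x))))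
  refine ⟨applyAut (𝓕.t (H.δ 1 b)) (ev K (PartialGroups.unit M) (𝟙 _)), ?_, fun x z s hs => ?_⟩
  · have := hom.precomp T.hom
    rw [Category.comp_id, show T.hom ≫ T⁻¹.hom ≫ (𝓕.t (H.δ 1 b)).hom = (𝓕.t (H.δ 1 b)).hom from
      T.hom_inv_id_assoc _] at this
    exact this.determines
  · have hb : τ.app _ s = b := eq_of_spine fun k => by
      rw [← app_spine, hs, spine_two]
      fin_cases k <;> exact 𝓕.proj_e _ _
    obtain ⟨m, rfl⟩ := hP.surjective 2 (𝟙 _) s (hb.trans (res_id _).symm)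
    have hs0 := congrFun hs 0
    have hs1 := congrFun hs 1
    rw [spine_ev, Category.comp_id, hP1] at hs0 hs1
    rw [hb0] at hs0
    rw [hb1, show ((1 : Fin 2) : ℕ) = (0 : Fin 2) + 1 from rfl, cumul_succ, hb0] at hs1
    have hm0 : spine M m 0 = x := 𝓕.e_injective hs0
    have hm1 : applyAut (𝓕.t (H.δ 2 b))⁻¹ (spine M m 1) = z := 𝓕.e_injective hs1
    refine ⟨ev (K ≫ (𝓕.t (H.δ 1 b)).hom) (prod M m) (𝟙 _), ?_, ?_⟩
    · rw [← hm1, ← hm0, applyAut_applyAut_inv]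
      -- The simplex $[x|t(g)(z)|\eta]$ is the homotopy applied to $m$ with a degenerate last edge:
      -- the first two edges lie at the end where it is the identity, and the last one runs along
      -- $\Delta[1]$ over the unit.
      refine isProd_three_of_mul2 ⟨ev (K ≫ (𝓕.t (H.δ 1 b)).hom)
        (res (SimplexCategory.σ 2) m) (collapse 3 2), funext fun k => ?_⟩
        (mul2_edge m 0 1 2 (by decide) (by decide)) (hom.mul2_left (prod M m))
      rw [spine_ev]
      fin_cases k
      · refine Eq.trans ?_ (hom.zero 1 (spine M m 0))
        exact congrArg₂ (ev _) (spine_res (SimplexCategory.σ 2) 0 m)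
          (SimplexCategory.Hom.ext_one_left _ _ rfl rfl)
      · refine Eq.trans ?_ (hom.zero 1 (spine M m 1))
        exact congrArg₂ (ev _) (spine_res (SimplexCategory.σ 2) 1 m)
          (SimplexCategory.Hom.ext_one_left _ _ rfl rfl)
      · refine Eq.trans ?_ hom.edge
        exact congrArg₂ (ev _) ((spine_res _ _ _).trans (edge_eq_unit _ rfl _))
          (SimplexCategory.Hom.ext_one_left _ _ rfl rfl)
    · rw [ev_comp, ← applyAut, ← ev_F, hK', prod_eq_res, res_ev]
      exact congrArg (ev _ _) (SimplexCategory.Hom.ext_one_left _ _ rfl rfl)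

/-- The cocycle of a framing. -/
noncomputable def η (h : IsExt i τ) (b : H _⦋2⦌) : M _⦋1⦌ := (𝓕.exists_η h b).choose

lemma η_mem (h : IsExt i τ) (b : H _⦋2⦌) : 𝓕.η h b ∈ normalizer (𝟙 M) :=
  (isUnit_of_determinesHomotopy (𝓕.exists_η h b).choose_spec.1).1

lemma exists_of_mul2 (h : IsExt i τ) (b : H _⦋2⦌) {x z : M _⦋1⦌} {q : E _⦋1⦌}
    (hq : Mul2 E (𝓕.e x (H.δ 2 b)) (𝓕.e z (H.δ 0 b)) q) :
    ∃ p : M _⦋1⦌, IsProd M ![x, applyAut (𝓕.t (H.δ 2 b)) z, 𝓕.η h b] p ∧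
      q = 𝓕.e p (H.δ 1 b) := by
  obtain ⟨s, h2, h0, rfl⟩ := hq
  obtain ⟨p, hp, hs⟩ := (𝓕.exists_η h b).choose_spec.2 x z s (by rw [spine_two, h2, h0])
  exact ⟨p, hp, by rw [← hs, prod_two]⟩

lemma applyAut_unit (t : Aut M) : applyAut t (PartialGroups.unit M) = PartialGroups.unit M :=
  app_unit t.hom

lemma isProd_unit_left {X : SSet.{u}} [PartialMonoid X] {y z p : X _⦋1⦌}
    (h : IsProd X ![PartialGroups.unit X, y, z] p) : Mul2 X y z p := by
  obtain ⟨q, h1, h2⟩ := h.exists_mul2_left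
  rwa [h1.unique (unit_mul2 y)] at h2

lemma isProd_unit_middle {X : SSet.{u}} [PartialMonoid X] {y z p : X _⦋1⦌}
    (h : IsProd X ![y, PartialGroups.unit X, z] p) : Mul2 X y z p := by
  obtain ⟨q, h1, h2⟩ := h.exists_mul2_left
  rwa [h1.unique (mul2_unit y)] at h2

lemma isProd_unit_right {X : SSet.{u}} [PartialMonoid X] {y z p : X _⦋1⦌}
    (h : IsProd X ![y, z, PartialGroups.unit X] p) : Mul2 X y z p := by
  obtain ⟨q, h1, h2⟩ := h.exists_mul2_right
  rwa [h1.unique (mul2_unit z)] at h2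

lemma eq_e_η_of_mul2 (h : IsExt i τ) (b : H _⦋2⦌) {q : E _⦋1⦌}
    (hq : Mul2 E (𝓕.e (PartialGroups.unit M) (H.δ 2 b)) (𝓕.e (PartialGroups.unit M) (H.δ 0 b)) q) :
    q = 𝓕.e (𝓕.η h b) (H.δ 1 b) := by
  obtain ⟨p, hp, rfl⟩ := 𝓕.exists_of_mul2 h b hq
  rw [applyAut_unit] at hp
  rw [(isProd_unit_left hp).unique (unit_mul2 _)]

lemma exists_unit_word (h : IsExt i τ) {n : ℕ} (b : H _⦋n⦌) : ∃ s : E _⦋n⦌,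
    spine E s = fun k => 𝓕.e (PartialGroups.unit M) (spine H b k) :=
  (𝓕.words h n fun k => (PartialGroups.unit M, spine H b k)).2 ⟨⟨b, rfl⟩,
    pt M n, funext fun k => by
      rw [applyAut_unit, spine_apply, res_pt, pt_one]⟩

lemma mul2_η (h : IsExt i τ) (b : H _⦋2⦌) :
    Mul2 E (𝓕.e (PartialGroups.unit M) (H.δ 2 b)) (𝓕.e (PartialGroups.unit M) (H.δ 0 b))
      (𝓕.e (𝓕.η h b) (H.δ 1 b)) := by
  obtain ⟨s, hs⟩ := 𝓕.exists_unit_word h b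
  have := mul2_δ s
  rw [spine_two, spine_two] at hs
  rw [show E.δ 2 s = _ from congrFun hs 0, show E.δ 0 s = _ from congrFun hs 1] at this
  have h2 := this
  rwa [𝓕.eq_e_η_of_mul2 h b this] at h2

/-- The twisting pair of a framing. -/
noncomputable def twistingPair (h : IsExt i τ) : TwistingPair H M where
  t := 𝓕.t
  η := 𝓕.η h
  η_mem := 𝓕.η_mem h
  homotopy s := (𝓕.exists_η h s).choose_spec.1
  t_unit := 𝓕.t_unit h
  η_unit_left g := by
    have := h.partialMonoid
    have := 𝓕.mul2_η h (H.σ 0 g)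
    have h2 : H.δ 2 (H.σ 0 g) = PartialGroups.unit H := by
      rw [δ_eq_res, σ_eq_res, res_res]
      exact res_eq_unit rfl _
    have h0 : H.δ 0 (H.σ 0 g) = g := by
      rw [δ_eq_res, σ_eq_res, res_res]
      exact res_eq_self rfl rfl g
    have h1 : H.δ 1 (H.σ 0 g) = g := by
      rw [δ_eq_res, σ_eq_res, res_res]
      exact res_eq_self rfl rfl g
    rw [h2, h0, h1, 𝓕.e_unit h, app_unit] at this
    exact 𝓕.e_injective (this.unique (unit_mul2 _))
  η_unit_right g := by
    have := h.partialMonoid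
    have := 𝓕.mul2_η h (H.σ 1 g)
    have h2 : H.δ 2 (H.σ 1 g) = g := by
      rw [δ_eq_res, σ_eq_res, res_res]
      exact res_eq_self rfl rfl g
    have h0 : H.δ 0 (H.σ 1 g) = PartialGroups.unit H := by
      rw [δ_eq_res, σ_eq_res, res_res]
      exact res_eq_unit rfl _
    have h1 : H.δ 1 (H.σ 1 g) = g := by
      rw [δ_eq_res, σ_eq_res, res_res]
      exact res_eq_self rfl rfl g
    rw [h2, h0, h1, 𝓕.e_unit h, app_unit] at this
    exact 𝓕.e_injective (this.unique (mul2_unit _))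
  cocycle s := by
    -- The lift of $[g|h|k]$ with letters $(1,g)$, $(1,h)$, $(1,k)$: its long edge, bracketed in two
    -- ways, has the two sides of the cocycle identity as component in $M$.
    obtain ⟨S, hS⟩ := 𝓕.exists_unit_word h s
    have e01 : edge E 0 1 (by decide) S = 𝓕.e (PartialGroups.unit M) (spine H s 0) := congrFun hS 0
    have e12 : edge E 1 2 (by decide) S = 𝓕.e (PartialGroups.unit M) (spine H s 1) := congrFun hS 1
    have e23 : edge E 2 3 (by decide) S = 𝓕.e (PartialGroups.unit M) (spine H s 2) := congrFun hS 2
    have m02 := mul2_edge S 0 1 2 (by decide) (by decide)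
    have m13 := mul2_edge S 1 2 3 (by decide) (by decide)
    have m03 := mul2_edge S 0 1 3 (by decide) (by decide)
    have m03' := mul2_edge S 0 2 3 (by decide) (by decide)
    have face {a b : ⦋1⦌ ⟶ ⦋3⦌} (h0 : a.toOrderHom 0 = b.toOrderHom 0)
        (h1 : a.toOrderHom 1 = b.toOrderHom 1) : res a s = res b s :=
      congrArg (fun a => res a s) (SimplexCategory.Hom.ext_one_left _ _ h0 h1)
    have f32 : H.δ 2 (H.δ 3 s) = spine H s 0 := (res_res _ _ _).trans (face rfl rfl)
    have f30 : H.δ 0 (H.δ 3 s) = spine H s 1 := (res_res _ _ _).trans (face rfl rfl)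
    have f02 : H.δ 2 (H.δ 0 s) = spine H s 1 := (res_res _ _ _).trans (face rfl rfl)
    have f00 : H.δ 0 (H.δ 0 s) = spine H s 2 := (res_res _ _ _).trans (face rfl rfl)
    have f22 : H.δ 2 (H.δ 2 s) = spine H s 0 := (res_res _ _ _).trans (face rfl rfl)
    have f20 : H.δ 0 (H.δ 2 s) = H.δ 1 (H.δ 0 s) := by
      simp only [δ_eq_res, res_res]
      exact face rfl rfl
    have f12 : H.δ 2 (H.δ 1 s) = H.δ 1 (H.δ 3 s) := by
      simp only [δ_eq_res, res_res]
      exact face rfl rfl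
    have f10 : H.δ 0 (H.δ 1 s) = spine H s 2 := (res_res _ _ _).trans (face rfl rfl)
    have f11 : H.δ 1 (H.δ 1 s) = H.δ 1 (H.δ 2 s) := by
      simp only [δ_eq_res, res_res]
      exact face rfl rfl
    have e02 := 𝓕.eq_e_η_of_mul2 h (H.δ 3 s) (q := edge E 0 2 (by decide) S)
      (by rw [f32, f30, ← e01, ← e12]; exact m02)
    have e13 := 𝓕.eq_e_η_of_mul2 h (H.δ 0 s) (q := edge E 1 3 (by decide) S)
      (by rw [f02, f00, ← e12, ← e23]; exact m13)
    rw [e01, e13, ← f20, ← f22] at m03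
    rw [e02, e23, ← f12, ← f10] at m03'
    obtain ⟨p, hp, hq⟩ := 𝓕.exists_of_mul2 h (H.δ 2 s) m03
    obtain ⟨p', hp', hq'⟩ := 𝓕.exists_of_mul2 h (H.δ 1 s) m03'
    rw [hq, f11] at hq'
    obtain rfl := 𝓕.e_injective hq'
    refine ⟨p, ?_, ?_⟩
    · rw [← f22, isProd_two_iff]
      exact isProd_unit_left hp
    · rw [isProd_two_iff]
      rw [applyAut_unit] at hp'
      exact isProd_unit_middle hp'

lemma isTPEquiv (h : IsExt i τ) : IsTPEquiv i τ (𝓕.twistingPair h) 𝓕.equiv where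
  incl x := (𝓕.e_unit h x).symm
  proj := 𝓕.proj_e
  words := 𝓕.words h
  mul b := (𝓕.exists_η h b).choose_spec.2

end

end Framing

/-! ### The framing of a twisted product -/

section

variable {M E H : SSet.{u}} [PartialGroup M] [PartialGroup H] {i : M ⟶ E} {τ : E ⟶ H}

/-- The automorphism through which the vertex `a` of an edge acts. -/
def endAut (t : Aut M) (a : Fin 2) : Aut M := if a = 0 then t else 1

lemma t_mul_endAut (φ : TwistingPair H M) (g : H _⦋1⦌) (β : ⦋1⦌ ⟶ ⦋1⦌) :
    φ.t (res β g) * endAut (φ.t g) (β.toOrderHom 1) = endAut (φ.t g) (β.toOrderHom 0) := by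
  rcases hom_one_one_cases β with rfl | rfl | rfl
  · rw [res_cst, pt_one, φ.t_unit, one_mul]
    rfl
  · rw [res_cst, pt_one, φ.t_unit, one_mul]
    rfl
  · rw [res_id]
    exact mul_one _

/-- A telescoping product: along a simplex of $\Delta[1]$ the twist is $t(g)$ at the step from 0 to
1 and trivial at all other steps. -/
lemma cumul_mul_endAut (φ : TwistingPair H M) (g : H _⦋1⦌) {r : ℕ} (α : ⦋r⦌ ⟶ ⦋1⦌)
    (k : Fin (r + 1)) :
    cumul (fun j => φ.t (res (SimplexCategory.mkOfSucc j ≫ α) g)) k *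
      endAut (φ.t g) (α.toOrderHom k) = endAut (φ.t g) (α.toOrderHom 0) := by
  induction k using Fin.induction with
  | zero => exact one_mul _
  | succ k ih =>
    rw [← ih, Fin.val_succ, cumul_succ, mul_assoc]
    exact congrArg _ (t_mul_endAut φ g (SimplexCategory.mkOfSucc k ≫ α))

/-- Every 2-simplex of $\Delta[1]$ is degenerate, so a normalized cocycle is trivial over a single
edge. -/
lemma η_res_eq_unit (φ : TwistingPair H M) (g : H _⦋1⦌) (α : ⦋2⦌ ⟶ ⦋1⦌) :
    φ.η (res α g) = unit M := by
  have h01 := α.toOrderHom.monotone (show (0 : Fin 3) ≤ 1 by decide)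
  have h12 := α.toOrderHom.monotone (show (1 : Fin 3) ≤ 2 by decide)
  have h : α.toOrderHom 0 = α.toOrderHom 1 ∨ α.toOrderHom 1 = α.toOrderHom 2 := by
    generalize α.toOrderHom 0 = a at *
    generalize α.toOrderHom 1 = b at *
    generalize α.toOrderHom 2 = c at *
    change Fin 2 at a b c
    revert a b c
    decide
  rcases h with h | h
  · have : α = SimplexCategory.σ 0 ≫ (SimplexCategory.δ 0 ≫ α) := by
      ext v
      change Fin 3 at v
      fin_cases v
      · exact congrArg Fin.val h
      · rfl
      · rfl
    rw [this, ← res_res]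
    exact φ.η_unit_left _
  · have : α = SimplexCategory.σ 1 ≫ (SimplexCategory.δ 2 ≫ α) := by
      ext v
      change Fin 3 at v
      fin_cases v
      · rfl
      · rfl
      · exact (congrArg Fin.val h).symm
    rw [this, ← res_res]
    exact φ.η_unit_right _

/-- The formula is forced: $\imath\circ t(g)$ over the vertex 0, $\imath$ over the vertex 1, and
$(t(g)(x),g)$ over the nondegenerate edge. It is multiplicative because $\eta$ vanishes on simplices
of $\Delta[1]$, and the description of words makes it bijective onto the simplices over $g$. -/
lemma IsTPEquiv.exists_F [PartialMonoid E] {φ : TwistingPair H M}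
    {e : M _⦋1⦌ × H _⦋1⦌ ≃ E _⦋1⦌} (he : IsTPEquiv i τ φ e) (g : H _⦋1⦌) :
    ∃ F : M ⊗ (Δ[1] : SSet.{u}) ⟶ E, IsTriv F τ g ∧ ∀ (x : M _⦋1⦌) (α : ⦋1⦌ ⟶ ⦋1⦌),
      ev F x α = e (applyAut (endAut (φ.t g) (α.toOrderHom 0)) x, res α g) := by
  have h_spine (r : ℕ) (x : M _⦋r⦌) (α : ⦋r⦌ ⟶ ⦋1⦌) : ∃ s : E _⦋r⦌, spine E s = fun k =>
      e (applyAut (endAut (φ.t g) (α.toOrderHom k.castSucc)) (spine M x k),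
        res (SimplexCategory.mkOfSucc k ≫ α) g) := by
    refine (he.words r fun k => (_, _)).2 ⟨⟨res α g, funext fun k => res_res _ _ _⟩,
      applyAut (endAut (φ.t g) (α.toOrderHom 0)) x, funext fun k => ?_⟩
    rw [spine_applyAut, ← applyAut_mul]
    exact congrArg (applyAut · _) (cumul_mul_endAut φ g α k.castSucc).symm
  obtain ⟨F, hF⟩ := exists_tensorHom_of_edges (Y := M) (X := E) (n := 1)
    (fun x α => e (applyAut (endAut (φ.t g) (α.toOrderHom 0)) x, res α g))
    (fun y α => by
      rw [res_zero_eq_unit, Framing.applyAut_unit, res_eq_unit rfl, ← he.incl, app_unit])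
    (fun r y α => (h_spine r y α).imp fun s hs k => congrFun hs k)
    (fun y α => by
      obtain ⟨s, hs⟩ := h_spine 2 y α
      have hy : Mul2 M (M.δ 2 y) (M.δ 0 y) (M.δ 1 y) := mul2_δ y
      have hm := mul2_δ s
      rw [spine_two, spine_two] at hs
      have hs2 : E.δ 2 s = e (applyAut (endAut (φ.t g) (α.toOrderHom 0)) (M.δ 2 y),
          H.δ 2 (res α g)) := (congrFun hs 0).trans (by
        rw [δ_eq_res _ (res α g), res_res, ← SimplexCategory.mkOfSucc_zero_eq_δ]
        rfl)
      have hs0 : E.δ 0 s = e (applyAut (endAut (φ.t g) (α.toOrderHom 1)) (M.δ 0 y),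
          H.δ 0 (res α g)) := (congrFun hs 1).trans (by
        rw [δ_eq_res _ (res α g), res_res, ← SimplexCategory.mkOfSucc_one_eq_δ]
        rfl)
      rw [hs2, hs0] at hm
      obtain ⟨p, hp, hq⟩ := he.exists_mul2 hm
      rw [hq] at hm
      rw [η_res_eq_unit, ← applyAut_mul,
        show φ.t (H.δ 2 (res α g)) * endAut (φ.t g) (α.toOrderHom 1) =
          endAut (φ.t g) (α.toOrderHom 0) from by
        rw [δ_eq_res, res_res]
        exact t_mul_endAut φ g (SimplexCategory.δ 2 ≫ α)] at hp
      rw [(Framing.isProd_unit_right hp).unique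
        (hy.app (endAut (φ.t g) (α.toOrderHom 0)).hom)] at hm
      simp only [δ_eq_res, res_res] at hm
      exact hm)
  have hFs (r : ℕ) (x : M _⦋r⦌) (α : ⦋r⦌ ⟶ ⦋1⦌) (k : Fin r) : spine E (ev F x α) k =
      e (applyAut (endAut (φ.t g) (α.toOrderHom k.castSucc)) (spine M x k),
        res (SimplexCategory.mkOfSucc k ≫ α) g) := by
    rw [spine_ev, hF]
    rfl
  refine ⟨F, ⟨fun r x α => ?_, fun r α x x' hx => ?_, fun r α s hs => ?_⟩, hF⟩
  · refine eq_of_spine fun k => ?_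
    rw [← app_spine, hFs, he.proj, spine_apply, res_res]
  · refine eq_of_spine fun k => ?_
    have := congrArg (spine E · k) hx
    simp only [hFs] at this
    exact applyAut_injective _ (congrArg Prod.fst (e.injective this))
  · have hk (k : Fin r) : spine E s k =
        e ((e.symm (spine E s k)).1, res (SimplexCategory.mkOfSucc k ≫ α) g) := by
      have h2 : (e.symm (spine E s k)).2 = res (SimplexCategory.mkOfSucc k ≫ α) g := by
        rw [← he.proj (e.symm (spine E s k)).1 (e.symm (spine E s k)).2, Prod.mk.eta,
          e.apply_symm_apply, app_spine, hs, spine_apply, res_res]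
      rw [← h2, Prod.mk.eta, e.apply_symm_apply]
    obtain ⟨-, m, hm⟩ := (he.words r fun k => ((e.symm (spine E s k)).1,
      res (SimplexCategory.mkOfSucc k ≫ α) g)).1 ⟨s, funext hk⟩
    refine ⟨applyAut (endAut (φ.t g) (α.toOrderHom 0))⁻¹ m, eq_of_spine fun k => ?_⟩
    rw [hFs, hk, spine_applyAut, hm, ← cumul_mul_endAut φ g α k.castSucc, mul_inv_rev,
      applyAut_mul, Fin.val_castSucc, applyAut_inv_applyAut, applyAut_applyAut_inv]

lemma IsTPEquiv.exists_framing [PartialMonoid E] {φ : TwistingPair H M}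
    {e : M _⦋1⦌ × H _⦋1⦌ ≃ E _⦋1⦌} (he : IsTPEquiv i τ φ e) :
    ∃ 𝓕 : Framing i τ, 𝓕.t = φ.t ∧ ∀ x g, 𝓕.e x g = e (x, g) := by
  choose F hF hFe using he.exists_F
  refine ⟨⟨φ.t, F, fun g r x => eq_of_spine fun k => ?_, fun g r x => eq_of_spine fun k => ?_, hF,
    hom_ext_of_edges fun z => ?_⟩, rfl, fun x g => ?_⟩
  · rw [spine_ev, hFe, ← app_spine, spine_applyAut, he.incl]
    exact congrArg e (Prod.ext rfl (res_eq_unit rfl _))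
  · rw [spine_ev, hFe, ← app_spine, he.incl]
    exact congrArg e (Prod.ext rfl (res_eq_unit rfl _))
  · refine (hFe (unit H) z.1 (SSet.stdSimplex.objEquiv z.2)).trans ?_
    rw [res_unit, pt_one, φ.t_unit]
    refine Eq.trans ?_ (he.incl z.1).symm
    rw [endAut, ite_self]
    rfl
  · refine (hFe g _ (𝟙 _)).trans (congrArg e (Prod.ext ?_ (res_id g)))
    exact applyAut_applyAut_inv (φ.t g) x

end

/-! ### Coboundaries -/

section Coboundary

variable {M H : SSet.{u}} [PartialGroup M] [PartialGroup H]

/-- The cocycle of a twisting pair, with values in the monoid `N(M)`. -/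
def TwistingPair.ηN (φ : TwistingPair H M) (s : H _⦋2⦌) : NMon M := ⟨φ.η s, φ.η_mem s⟩

lemma TwistingPair.isCoboundary_iff {φ : TwistingPair H M} :
    φ.IsCoboundary ↔ ∃ θ : H _⦋1⦌ → NMon M, ∀ s : H _⦋2⦌,
      θ (H.δ 2 s) * NMon.map (φ.t (H.δ 2 s)) (θ (H.δ 0 s)) * φ.ηN s = θ (H.δ 1 s) := by
  constructor
  · rintro ⟨θ, hθ, h⟩
    exact ⟨fun g => ⟨θ g, hθ g⟩, fun s => NMon.isProd_three_iff.1 (h s)⟩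
  · rintro ⟨θ, h⟩
    exact ⟨fun g => (θ g).1, fun g => (θ g).2, fun s => NMon.isProd_three_iff.2 (h s)⟩

/-- Translation into the monoid $N(M)$. The commutation rule equates the two expressions for the
diagonal of a homotopy, and invertibility of $\theta(g)$ comes from reversing it. -/
lemma TwistingPair.Cohomologous.exists_NMon {φ φ' : TwistingPair H M} (h : φ.Cohomologous φ') :
    ∃ θ : H _⦋1⦌ → NMon M, (∀ g, IsUnit (θ g)) ∧
      (∀ g a, NMon.map (φ'.t g) a * θ g = θ g * NMon.map (φ.t g) a) ∧
      ∀ s : H _⦋2⦌, φ'.ηN s * θ (H.δ 1 s) =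
        θ (H.δ 2 s) * NMon.map (φ.t (H.δ 2 s)) (θ (H.δ 0 s)) * φ.ηN s := by
  obtain ⟨θ, hθ, ht, h⟩ := h
  refine ⟨fun g => ⟨θ g, hθ g⟩, fun g => (isUnit_of_determinesHomotopy (ht g)).2,
    fun g a => ?_, fun s => ?_⟩
  · obtain ⟨F, hF⟩ := determinesHomotopy_iff_exists.1 (ht g)
    exact Subtype.ext (((NMon.mul2 _ _).unique (hF.mul2_left a.1)).trans
      ((NMon.mul2 _ _).unique (hF.mul2_right a.1)).symm)
  · obtain ⟨p, hp, hp'⟩ := h s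
    have h1 := (isProd_two_iff.1 hp).unique (NMon.mul2 (φ'.ηN s) ⟨θ (H.δ 1 s), hθ _⟩)
    subst h1
    exact (NMon.isProd_three_iff.1 hp').symm

/-- If $\zeta$ bounds $\eta'$, then $\zeta\theta$ bounds $\eta$, and $\zeta\mapsto\zeta\theta^{-1}$
goes back. The identity `key` moves $\theta$ past $t'(g)$. -/
lemma TwistingPair.Cohomologous.isCoboundary_iff {φ φ' : TwistingPair H M}
    (h : φ.Cohomologous φ') : φ.IsCoboundary ↔ φ'.IsCoboundary := by
  obtain ⟨θ, hu, hc, hθ⟩ := h.exists_NMon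
  have key (s : H _⦋2⦌) (a b : NMon M) :
      a * NMon.map (φ'.t (H.δ 2 s)) b * φ'.ηN s * θ (H.δ 1 s) =
        a * θ (H.δ 2 s) * NMon.map (φ.t (H.δ 2 s)) (b * θ (H.δ 0 s)) * φ.ηN s := by
    rw [mul_assoc _ (φ'.ηN s), hθ, NMon.map_mul]
    simp only [← mul_assoc]
    rw [mul_assoc a _ (θ (H.δ 2 s)), hc]
    simp only [← mul_assoc]
  rw [TwistingPair.isCoboundary_iff, TwistingPair.isCoboundary_iff]
  constructor
  · rintro ⟨ζ, hζ⟩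
    choose v hv using fun g => (hu g).exists_left_inv
    have hζv (g : H _⦋1⦌) : ζ g * v g * θ g = ζ g := by rw [mul_assoc, hv, mul_one]
    refine ⟨fun g => ζ g * v g, fun s => (hu (H.δ 1 s)).mul_right_cancel ?_⟩
    rw [key, hζv, hζv, hζv, hζ]
  · rintro ⟨ζ, hζ⟩
    exact ⟨fun g => ζ g * θ g, fun s => by beta_reduce; rw [← hζ s, key]⟩

lemma isCoboundary_of_η_eq_unit {φ : TwistingPair H M} (h : ∀ s, φ.η s = unit M) :
    φ.IsCoboundary :=
  TwistingPair.isCoboundary_iff.2 ⟨fun _ => 1, fun s => by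
    rw [show φ.ηN s = 1 from Subtype.ext (h s), show NMon.map (φ.t (H.δ 2 s)) 1 = 1 from
      Subtype.ext (Framing.applyAut_unit _), one_mul, one_mul]⟩

lemma TwistingPair.isCoboundary_of_vanishes {φ : TwistingPair H M}
    (h : H2.Vanishes (Quot.mk _ φ : H2 H M)) : φ.IsCoboundary := by
  obtain ⟨φ', h, h'⟩ := h
  -- Equality of classes only gives a chain of cohomologous pairs, so the invariance is carried
  -- along the chain.
  have key : ∀ φ φ' : TwistingPair H M, Relation.EqvGen TwistingPair.Cohomologous φ φ' →
      (φ.IsCoboundary ↔ φ'.IsCoboundary) := by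
    intro φ φ' h
    induction h with
    | rel _ _ h => exact h.isCoboundary_iff
    | refl _ => rfl
    | symm _ _ _ ih => exact ih.symm
    | trans _ _ _ _ _ ih ih' => exact ih.trans ih'
  exact (key _ _ (Quot.eqvGen_exact h)).1 (isCoboundary_of_η_eq_unit h')

end Coboundary

section

variable {M E H : SSet.{u}} [PartialGroup M] [PartialGroup H] {i : M ⟶ E} {τ : E ⟶ H}

/-! ### Comparison of homotopies with a framing -/

/-- The projection kills `i`, so the diagonals project to $\tau(s)$; cancelling $\tau(s)$ shows that
$\tau\circ f$ is trivial as well. -/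
lemma IsHomotopy.proj_eq (h : IsExt i τ) {F : M ⊗ (Δ[1] : SSet.{u}) ⟶ E} {f : M ⟶ E} {s : E _⦋1⦌}
    (hF : IsHomotopy F f i s) (r : ℕ) (x : M _⦋r⦌) (α : ⦋r⦌ ⟶ ⦋1⦌) :
    τ.app _ (ev F x α) = res α (τ.app _ s) := by
  have key (x : M _⦋1⦌) (α : ⦋1⦌ ⟶ ⦋1⦌) : τ.app _ (ev F x α) = res α (τ.app _ s) := by
    have hr := (hF.mul2_right x).app τ
    rw [h.proj, pt_one] at hr
    have hs : τ.app _ (ev F x (𝟙 _)) = τ.app _ s := hr.unique (mul2_unit _)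
    rcases hom_one_one_cases α with rfl | rfl | rfl
    · have hl := (hF.mul2_left x).app τ
      rw [hs] at hl
      rw [hF.zero, res_cst, pt_one]
      exact hl.right_cancel (unit_mul2 _)
    · rw [hF.one, res_cst, h.proj]
    · rw [hs, res_id]
  refine eq_of_spine fun k => ?_
  rw [← app_spine, spine_ev, key, spine_apply, res_res]

namespace Framing

variable (𝓕 : Framing i τ)

lemma isHomotopy (g : H _⦋1⦌) :
    IsHomotopy (𝓕.F g) ((𝓕.t g).hom ≫ i) i (𝓕.e (PartialGroups.unit M) g) where
  zero := 𝓕.zero g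
  one := 𝓕.one g
  edge := by rw [ev_F, applyAut_unit]

/-- Since the homotopy lies over the edge $\tau(s)$, it factors through the trivialization over that
edge, which leaves a homotopy inside $M$. -/
lemma exists_lift_homotopy (h : IsExt i τ) {F : M ⊗ (Δ[1] : SSet.{u}) ⟶ E} {f : M ⟶ E}
    {s : E _⦋1⦌} (hF : IsHomotopy F f i s) :
    ∃ (G : M ⊗ (Δ[1] : SSet.{u}) ⟶ M) (f' : M ⟶ M) (x : M _⦋1⦌),
      IsHomotopy G f' (𝟙 M) x ∧ f' ≫ (𝓕.t (τ.app _ s)).hom ≫ i = f ∧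
        𝓕.e (applyAut (𝓕.t (τ.app _ s)) x) (τ.app _ s) = s := by
  obtain ⟨G, hG⟩ := (𝓕.triv (τ.app _ s)).exists_lift F (𝟙 _) (fun r y α => by
    rw [hF.proj_eq h, Category.comp_id])
  simp only [Category.comp_id] at hG
  refine ⟨G, SSet.ι₀ ≫ G, _, ⟨fun r x => rfl, fun r x => h.injective r ?_, rfl⟩, ?_, ?_⟩
  · exact (𝓕.one _ r _).symm.trans ((hG r x _).trans (hF.one r x))
  · ext ⟨⟨r⟩⟩ x
    exact (𝓕.zero _ r _).symm.trans ((hG r x _).trans (hF.zero r x))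
  · rw [← ev_F, hG, hF.edge]

/-- The framing edge $(1,g)$ itself defines a homotopy to `i`. Composing with it, or factoring it
out, exchanges homotopies to `i` over $g$ with homotopies to the identity of $M$. -/
lemma e_mem_normalizer_iff (h : IsExt i τ) {x : M _⦋1⦌} {g : H _⦋1⦌} :
    𝓕.e x g ∈ normalizer i ↔ x ∈ normalizer (𝟙 M) := by
  constructor
  · intro hx
    obtain ⟨f, F, hF⟩ := mem_normalizer_iff.1 hx
    obtain ⟨G, f', y, hG, -, hy⟩ := 𝓕.exists_lift_homotopy h hF
    rw [proj_e] at hy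
    rw [← 𝓕.e_injective hy]
    exact app_mem_normalizer _ (mem_normalizer_iff.2 ⟨_, _, hG⟩)
  · intro hx
    obtain ⟨f, F, hF⟩ := mem_normalizer_iff.1 (app_mem_normalizer (𝓕.t g)⁻¹ hx)
    have := (𝓕.isHomotopy g).comp hF
    rw [ev_F, applyAut_applyAut_inv, Category.id_comp] at this
    exact mem_normalizer_iff.2 ⟨_, _, this⟩

lemma exists_determinesHomotopy (h : IsExt i τ) (𝓕' : Framing i τ) (g : H _⦋1⦌) :
    ∃ θ : M _⦋1⦌, DeterminesHomotopy θ (𝓕'.t g).hom (𝓕.t g).hom ∧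
      𝓕.e θ g = 𝓕'.e (PartialGroups.unit M) g := by
  obtain ⟨G, f', x, hG, hf, hx⟩ := 𝓕.exists_lift_homotopy h (𝓕'.isHomotopy g)
  rw [proj_e] at hf hx
  refine ⟨_, ?_, hx⟩
  have := hG.postcomp (𝓕.t g).hom
  rw [Category.id_comp, show f' ≫ (𝓕.t g).hom = (𝓕'.t g).hom from hom_ext_of_edges fun y =>
    h.injective 1 (ConcreteCategory.congr_hom (NatTrans.congr_app hf (op ⦋1⦌)) y)] at this
  exact this.determines

end Framing

/-! ### Products in a twisted product -/

namespace IsTPEquiv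

variable {φ : TwistingPair H M} {e : M _⦋1⦌ × H _⦋1⦌ ≃ E _⦋1⦌}

lemma exists_mul2_of_mul2 (h : IsTPEquiv i τ φ e) (b : H _⦋2⦌) {x z r : M _⦋1⦌}
    (hr : Mul2 M x (applyAut (φ.t (H.δ 2 b)) z) r) :
    ∃ p : M _⦋1⦌, IsProd M ![x, applyAut (φ.t (H.δ 2 b)) z, φ.η b] p ∧
      Mul2 E (e (x, H.δ 2 b)) (e (z, H.δ 0 b)) (e (p, H.δ 1 b)) := by
  obtain ⟨m, hm2, hm0, -⟩ := hr
  obtain ⟨s, hs⟩ := (h.words 2 ![(x, H.δ 2 b), (z, H.δ 0 b)]).2 ⟨⟨b, by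
    rw [spine_two]
    ext k
    fin_cases k <;> rfl⟩, m, by
    rw [spine_two, hm2, hm0]
    ext k
    fin_cases k
    · rfl
    · simp [cumul]⟩
  rw [spine_two] at hs
  have := mul2_δ s
  rw [show E.δ 2 s = e (x, H.δ 2 b) from congrFun hs 0,
    show E.δ 0 s = e (z, H.δ 0 b) from congrFun hs 1] at this
  obtain ⟨p, hp, hq⟩ := h.exists_mul2 this
  rw [hq] at this
  exact ⟨p, hp, this⟩

lemma incl_mul2 (h : IsTPEquiv i τ φ e) {x z p : M _⦋1⦌} (hp : Mul2 M x z p) (g : H _⦋1⦌) :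
    Mul2 E (i.app _ x) (e (z, g)) (e (p, g)) := by
  have := h.exists_mul2_of_mul2 (H.σ 0 g) (x := x) (z := z) (r := p)
    (by rwa [δ_two_σ_zero, φ.t_unit])
  rw [φ.η_unit_left, δ_two_σ_zero, φ.t_unit, δ_zero_σ_zero, δ_one_σ_zero] at this
  obtain ⟨q, hq, hq'⟩ := this
  rwa [h.incl, hp.unique (Framing.isProd_unit_right hq)]

lemma exists_mul2_of_incl (h : IsTPEquiv i τ φ e) {x z : M _⦋1⦌} {g : H _⦋1⦌} {q : E _⦋1⦌}
    (hq : Mul2 E (i.app _ x) (e (z, g)) q) : ∃ p, Mul2 M x z p ∧ q = e (p, g) := by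
  obtain ⟨p, hp, hq⟩ := h.exists_mul2 (b := H.σ 0 g) (x := x) (z := z) (q := q)
    (by rwa [δ_two_σ_zero, δ_zero_σ_zero, ← h.incl])
  rw [φ.η_unit_left, δ_two_σ_zero, φ.t_unit] at hp
  rw [δ_one_σ_zero] at hq
  exact ⟨p, Framing.isProd_unit_right hp, hq⟩

lemma mul2_unit_unit (h : IsTPEquiv i τ φ e) (b : H _⦋2⦌) :
    Mul2 E (e (unit M, H.δ 2 b)) (e (unit M, H.δ 0 b)) (e (φ.η b, H.δ 1 b)) := by
  obtain ⟨p, hp, hq⟩ := h.exists_mul2_of_mul2 b (x := unit M) (z := unit M) (unit_mul2 _)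
  rw [Framing.applyAut_unit] at hp
  rwa [(Framing.isProd_unit_left hp).unique (unit_mul2 _)] at hq

/-- Take for $\theta(g)$ the component in $M$ of the second lift $e'(1,g)$ in the coordinates $e$.
The edge $e'(1,g)\cdot e'(1,h)=\imath(\eta'(g,h))\cdot e'(1,gh)$, written in the coordinates $e$, is
the required relation. -/
lemma cohomologous (h : IsExt i τ) (he : IsTPEquiv i τ φ e) {φ' : TwistingPair H M}
    {e' : M _⦋1⦌ × H _⦋1⦌ ≃ E _⦋1⦌} (he' : IsTPEquiv i τ φ' e') : φ.Cohomologous φ' := by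
  have := h.partialMonoid
  obtain ⟨𝓕, ht, h𝓕⟩ := he.exists_framing
  obtain ⟨𝓕', ht', h𝓕'⟩ := he'.exists_framing
  choose θ hθ hθe using 𝓕.exists_determinesHomotopy h 𝓕'
  simp only [h𝓕, h𝓕'] at hθe
  rw [ht, ht'] at hθ
  refine ⟨θ, fun g => (isUnit_of_determinesHomotopy (hθ g)).1, hθ, fun s => ?_⟩
  have h1 := he'.mul2_unit_unit s
  rw [← hθe, ← hθe] at h1
  obtain ⟨p, hp, hq⟩ := he.exists_mul2 h1
  refine ⟨p, ?_, hp⟩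
  have h2 := he'.incl_mul2 (mul2_unit (φ'.η s)) (H.δ 1 s)
  rw [← hθe, hq] at h2
  obtain ⟨p', hp', hq'⟩ := he.exists_mul2_of_incl h2
  have hpp : p = p' := congrArg Prod.fst (e.injective hq')
  rw [isProd_two_iff, hpp]
  exact hp'

/-! ### Regular sections and coboundaries -/

/-- Here $\theta$ is the component of the section in $M$: regularity places it in $N(M)$, and
compatibility with products is the coboundary equation. -/
lemma isCoboundary_of_section (h : IsExt i τ) (he : IsTPEquiv i τ φ e) {σ : Section τ}
    (hσ : σ.IsRegular i) :
    ∃ θ : H _⦋1⦌ → NMon M, (∀ g, σ.1.app _ g = e ((θ g).1, g)) ∧ ∀ s : H _⦋2⦌,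
      θ (H.δ 2 s) * NMon.map (φ.t (H.δ 2 s)) (θ (H.δ 0 s)) * φ.ηN s = θ (H.δ 1 s) := by
  have := h.partialMonoid
  obtain ⟨𝓕, ht, h𝓕⟩ := he.exists_framing
  have hθ (g : H _⦋1⦌) : ∃ x, σ.1.app _ g = e (x, g) := by
    have h2 : (e.symm (σ.1.app _ g)).2 = g := by
      rw [← he.proj (e.symm (σ.1.app _ g)).1 (e.symm (σ.1.app _ g)).2, Prod.mk.eta,
        e.apply_symm_apply]
      exact ConcreteCategory.congr_hom (NatTrans.congr_app σ.2 (op ⦋1⦌)) g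
    exact ⟨_, (e.apply_symm_apply _).symm.trans (congrArg e (Prod.ext rfl h2))⟩
  choose θ hθ using hθ
  have hN (g : H _⦋1⦌) : θ g ∈ normalizer (𝟙 M) := by
    rw [← 𝓕.e_mem_normalizer_iff h (g := g), h𝓕, ← hθ]
    have := hσ 1 g 0
    rwa [spine_one] at this
  refine ⟨fun g => ⟨_, hN g⟩, hθ, fun s => ?_⟩
  have hm := (mul2_δ s).app σ.1
  rw [hθ, hθ, hθ] at hm
  obtain ⟨p, hp, hq⟩ := he.exists_mul2 hm
  have hpp : θ (H.δ 1 s) = p := congrArg Prod.fst (e.injective hq)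
  rw [← hpp] at hp
  exact NMon.isProd_three_iff.1 hp

lemma exists_section (h : IsExt i τ) (he : IsTPEquiv i τ φ e) (hφ : φ.IsCoboundary) :
    ∃ σ : Section τ, σ.IsRegular i := by
  have := h.partialMonoid
  obtain ⟨𝓕, ht, h𝓕⟩ := he.exists_framing
  obtain ⟨θ, hθN, hθ⟩ := hφ
  -- The equation for $[1|1]$ reads $\theta(1)\theta(1)=\theta(1)$.
  have hθ1 : θ (unit H) = unit M := by
    have := hθ (H.σ 0 (unit H))
    rw [φ.η_unit_left, δ_two_σ_zero, δ_zero_σ_zero, δ_one_σ_zero, φ.t_unit] at this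
    exact (Framing.isProd_unit_right this).left_cancel (mul2_unit _)
  have hE : IsEdgeMap (fun g => e (θ g, g)) := by
    refine isEdgeMap_of_spine (fun y => ?_) (fun n y => ?_) (fun y => ?_)
    · rw [res_zero_eq_unit, hθ1, ← he.incl, app_unit]
    · obtain ⟨s, hs⟩ := (he.words n fun k => (θ (spine H y k), spine H y k)).2 ⟨⟨y, rfl⟩,
        exists_of_forall_mem_normalizer _ fun k => app_mem_normalizer _ (hθN _)⟩
      exact ⟨s, fun k => congrFun hs k⟩
    · obtain ⟨r, hr⟩ := exists_mul2_of_mem_normalizer (hθN (H.δ 2 y))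
        (applyAut (φ.t (H.δ 2 y)) (θ (H.δ 0 y)))
      obtain ⟨p, hp, hq⟩ := he.exists_mul2_of_mul2 y hr
      rwa [hp.unique (hθ y)] at hq
  refine ⟨⟨hE.hom, hom_ext_of_edges fun y => ?_⟩, fun n y k => ?_⟩
  · exact (congrArg (τ.app (op ⦋1⦌)) (hE.hom_app y)).trans (he.proj _ _)
  · rw [← app_spine, hE.hom_app, ← h𝓕, 𝓕.e_mem_normalizer_iff h]
    exact hθN _

end IsTPEquiv

/-- A regular section gives a framing. -/
lemma Section.IsRegular.exists_framing (h : IsExt i τ) {σ : Section τ} (hσ : σ.IsRegular i) :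
    ∃ 𝓕 : Framing i τ, (∀ g, 𝓕.e (unit M) g = σ.1.app _ g) ∧ ∀ s, 𝓕.η h s = unit M := by
  have := h.partialMonoid
  obtain ⟨𝓕⟩ := h.nonempty_framing
  obtain ⟨θ, hσθ, hθ⟩ := (𝓕.isTPEquiv h).isCoboundary_of_section h hσ
  have hθ1 : θ (unit H) = 1 := by
    have := hσθ (unit H)
    rw [app_unit, ← app_unit i, (𝓕.isTPEquiv h).incl] at this
    exact Subtype.ext (congrArg Prod.fst (𝓕.equiv.injective this)).symm
  -- The equation for $[g|g^{-1}]$ has right side $\theta(1)=1$ and exhibits a right inverse of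
  -- $\theta(g)$.
  have hu (g : H _⦋1⦌) : IsUnit (θ g) := by
    obtain ⟨s, h2, h0, h1⟩ := mul2_inv_self g
    have := hθ s
    rw [h2, h1, hθ1, mul_assoc] at this
    exact NMon.isUnit_of_mul_eq_one this
  choose c G hG hGb using fun g => exists_isHomotopy_of_isUnit (hu g)
  -- The new trivialization over $g$ is the old one after conjugation by $\theta(g)$, transported
  -- through $t(g)$; it has edge $\sigma(g)$ and starts at $\imath\circ c_g\circ t(g)$.
  have hom (g : H _⦋1⦌) : IsHomotopy (compTensor (𝓕.F g) ((𝓕.t g).hom ▷ (Δ[1] : SSet.{u}) ≫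
      G g ≫ (𝓕.t g)⁻¹.hom)) ((c g * 𝓕.t g).hom ≫ i) i (σ.1.app _ g) := by
    refine ⟨fun r x => ?_, fun r x => ?_, ?_⟩
    · refine (congrArg (fun y => ev (𝓕.F g) (applyAut (𝓕.t g)⁻¹ y) _) ((hG g).zero r _)).trans ?_
      rw [𝓕.zero, applyAut_applyAut_inv]
      rfl
    · refine (congrArg (fun y => ev (𝓕.F g) (applyAut (𝓕.t g)⁻¹ y) _) ((hG g).one r _)).trans ?_
      rw [𝓕.one]
      exact congrArg (i.app _) (applyAut_inv_applyAut (𝓕.t g) x)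
    · refine (congrArg (fun y => ev (𝓕.F g) (applyAut (𝓕.t g)⁻¹ (ev (G g) y (𝟙 _))) (𝟙 _))
        (Framing.applyAut_unit (𝓕.t g))).trans ?_
      rw [(hG g).edge, hσθ]
      rfl
  let 𝓕' : Framing i τ :=
    { t := fun g => c g * 𝓕.t g
      F := fun g => compTensor (𝓕.F g) ((𝓕.t g).hom ▷ (Δ[1] : SSet.{u}) ≫ G g ≫ (𝓕.t g)⁻¹.hom)
      zero := fun g => (hom g).zero
      one := fun g => (hom g).one
      triv := fun g =>
        { proj := fun r x α => (𝓕.triv g).proj r _ α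
          injective := fun r α x x' hx => applyAut_injective _ ((hGb g r α).1
            (applyAut_injective _ ((𝓕.triv g).injective r α hx)))
          surjective := fun r α s hs => by
            obtain ⟨y, rfl⟩ := (𝓕.triv g).surjective r α s hs
            obtain ⟨x, hx⟩ := (hGb g r α).2 (applyAut (𝓕.t g) y)
            refine ⟨applyAut (𝓕.t g)⁻¹ x, ?_⟩
            refine (congrArg (fun z => ev (𝓕.F g) (applyAut (𝓕.t g)⁻¹ (ev (G g) z α)) α)
              (applyAut_applyAut_inv (𝓕.t g) x)).trans ?_
            rw [show ev (G g) x α = _ from hx, applyAut_inv_applyAut] }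
      unit := by
        have h1 := hom (unit H)
        rw [app_unit] at h1
        rw [h1.eq_of_unit] at h1
        exact h1.ext (IsHomotopy.refl i) }
  have he (g : H _⦋1⦌) : 𝓕'.e (unit M) g = σ.1.app _ g := by
    rw [Framing.e, Framing.applyAut_unit]
    exact (hom g).edge
  refine ⟨𝓕', he, fun s => 𝓕'.e_injective (g := H.δ 1 s) ?_⟩
  -- In the new coordinates $(1,g)=\sigma(g)$, and $\sigma(g)\sigma(h)=\sigma(gh)$ leaves no room
  -- for a cocycle.
  have h1 := 𝓕'.mul2_η h s
  rw [he, he] at h1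
  rw [he]
  exact h1.unique ((mul2_δ s).app σ.1)

/-! ### The obstruction class -/

theorem obstruction (h : IsExt i τ) :
    (∃! c : H2 H M, IsObstructionClass i τ c) ∧
      (∀ c : H2 H M, IsObstructionClass i τ c →
        ((∃ σ : Section τ, σ.IsRegular i) ↔ c.Vanishes)) ∧
      (∀ φ : TwistingPair H M, IsTwistedProduct i τ φ →
        ((∃ σ : Section τ, σ.IsRegular i) ↔ φ.IsCoboundary)) := by
  have := h.partialMonoid
  refine ⟨?_, ?_, ?_⟩
  · obtain ⟨𝓕⟩ := h.nonempty_framing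
    refine ⟨Quot.mk _ (𝓕.twistingPair h), ⟨_, isTwistedProduct_iff.2 ⟨this, _, 𝓕.isTPEquiv h⟩, rfl⟩,
      ?_⟩
    rintro _ ⟨φ, hφ, rfl⟩
    obtain ⟨-, e, he⟩ := isTwistedProduct_iff.1 hφ
    exact Quot.sound (he.cohomologous h (𝓕.isTPEquiv h))
  · rintro _ ⟨φ, hφ, rfl⟩
    obtain ⟨-, e, he⟩ := isTwistedProduct_iff.1 hφ
    constructor
    · rintro ⟨σ, hσ⟩
      obtain ⟨𝓕, -, hη⟩ := hσ.exists_framing h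
      exact ⟨𝓕.twistingPair h, (Quot.sound (he.cohomologous h (𝓕.isTPEquiv h))).symm, hη⟩
    · intro hv
      exact he.exists_section h (TwistingPair.isCoboundary_of_vanishes hv)
  · intro φ hφ
    obtain ⟨-, e, he⟩ := isTwistedProduct_iff.1 hφ
    constructor
    · rintro ⟨σ, hσ⟩
      obtain ⟨θ, -, hθ⟩ := he.isCoboundary_of_section h hσ
      exact TwistingPair.isCoboundary_iff.2 ⟨θ, hθ⟩
    · exact he.exists_section h

end

/-! ### Actions -/

section Bar

variable {G : Type u} [Group G]

instance : PartialMonoid (bar G) where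
  existsUnique_vertex :=
    ⟨ComposableArrows.mk₀ (SingleObj.star Gᵐᵒᵖ), trivial, fun _ _ => ComposableArrows.ext₀ rfl⟩
  spine_injective n hn s s' h := by
    obtain ⟨n, rfl⟩ := Nat.exists_eq_add_of_le' hn
    refine (Nerve.strictSegal (SingleObj Gᵐᵒᵖ)).spineInjective ?_
    exact SSet.Path.ext' fun k => congrFun h k

lemma barLabel_injective {s s' : (bar G) _⦋1⦌} (h : barLabel s = barLabel s') : s = s' := by
  refine ComposableArrows.ext₁ rfl rfl ?_
  simp only [eqToHom_refl, Category.id_comp, Category.comp_id]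
  exact MulOpposite.unop_injective h

lemma barLabel_surjective (g : G) : ∃ s : (bar G) _⦋1⦌, barLabel s = g :=
  ⟨ComposableArrows.mk₁ (X₀ := SingleObj.star Gᵐᵒᵖ) (X₁ := SingleObj.star Gᵐᵒᵖ)
    (MulOpposite.op g), rfl⟩

lemma exists_spine_bar {n : ℕ} (w : Fin n → (bar G) _⦋1⦌) :
    ∃ s : (bar G) _⦋n⦌, ∀ k, spine (bar G) s k = w k := by
  let p : SSet.Path (bar G) n :=
    { vertex := fun _ => vertex (bar G)
      arrow := w
      arrow_src := fun _ => vertex_eq (X := bar G) _ _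
      arrow_tgt := fun _ => vertex_eq (X := bar G) _ _ : SSet.Truncated.Path₁ _ n }
  exact ⟨(Nerve.strictSegal (SingleObj Gᵐᵒᵖ)).spineToSimplex p, fun k =>
    (Nerve.strictSegal (SingleObj Gᵐᵒᵖ)).spineToSimplex_arrow k p⟩

lemma barLabel_δ_one (s : (bar G) _⦋2⦌) :
    barLabel ((bar G).δ 1 s) = barLabel ((bar G).δ 2 s) * barLabel ((bar G).δ 0 s) := by
  have h : (show ComposableArrows (SingleObj Gᵐᵒᵖ) 2 from s).map' 0 2 =
    (show ComposableArrows (SingleObj Gᵐᵒᵖ) 2 from s).map' 0 1 ≫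
      (show ComposableArrows (SingleObj Gᵐᵒᵖ) 2 from s).map' 1 2 :=
    ComposableArrows.map'_comp _ 0 1 2
  exact congrArg MulOpposite.unop h

lemma barLabel_unit : barLabel (unit (bar G)) = 1 := by
  have h := barLabel_δ_one ((bar G).σ 0 (unit (bar G)))
  rw [δ_two_σ_zero, δ_zero_σ_zero, δ_one_σ_zero] at h
  exact mul_eq_left.1 h.symm

lemma mul2_bar_iff {a b c : (bar G) _⦋1⦌} :
    Mul2 (bar G) a b c ↔ barLabel c = barLabel a * barLabel b := by
  constructor
  · rintro ⟨s, rfl, rfl, rfl⟩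
    exact barLabel_δ_one s
  · intro h
    obtain ⟨s, hs⟩ := exists_spine_bar ![a, b]
    have h0 : (bar G).δ 2 s = a := (congrFun (spine_two s) 0).symm.trans (hs 0)
    have h1 : (bar G).δ 0 s = b := (congrFun (spine_two s) 1).symm.trans (hs 1)
    refine ⟨s, h0, h1, barLabel_injective ?_⟩
    rw [h, barLabel_δ_one, h0, h1]

end Bar

namespace Action

variable {H M : SSet.{u}}

lemma aut_of_mul2 (ρ : Action H M) {x y p : H _⦋1⦌} (h : Mul2 H x y p) :
    ρ.aut p = ρ.aut x * ρ.aut y := mul2_bar_iff.1 (h.app ρ)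

lemma aut_edge_mul (ρ : Action H M) {n : ℕ} {i j k : Fin (n + 1)} (hij : i ≤ j) (hjk : j ≤ k)
    (h : H _⦋n⦌) :
    ρ.aut (edge H i j hij h) * ρ.aut (edge H j k hjk h) =
      ρ.aut (edge H i k (hij.trans hjk) h) :=
  (ρ.aut_of_mul2 (mul2_edge h i j k hij hjk)).symm

lemma aut_unit [PartialMonoid H] (ρ : Action H M) : ρ.aut (unit H) = 1 := by
  rw [aut, app_unit, barLabel_unit]

lemma aut_edge_of_eq [PartialMonoid H] (ρ : Action H M) {n : ℕ} {i j : Fin (n + 1)} (hij : i ≤ j)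
    (h : i = j) (b : H _⦋n⦌) : ρ.aut (edge H i j hij b) = 1 := by
  rw [edge_eq_unit _ h, aut_unit]

lemma ext {ρ ρ' : Action H M} (h : ∀ g, ρ.aut g = ρ'.aut g) : ρ = ρ' :=
  hom_ext_of_edges fun g => barLabel_injective (h g)

/-- All words exist in a bar construction, so only multiplicativity on 2-simplices has to be
checked. -/
lemma exists_aut_eq [PartialMonoid H] (t : H _⦋1⦌ → Aut M) (h1 : t (unit H) = 1)
    (h : ∀ s : H _⦋2⦌, t (H.δ 1 s) = t (H.δ 2 s) * t (H.δ 0 s)) :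
    ∃ ρ : Action H M, ∀ g, ρ.aut g = t g := by
  choose f hf using fun g => barLabel_surjective (t g)
  have : IsEdgeMap (X := bar (Aut M)) f := by
    refine isEdgeMap_of_spine (fun y => ?_) (fun n y => exists_spine_bar _) (fun y => ?_)
    · refine barLabel_injective ?_
      rw [hf, res_zero_eq_unit, h1, barLabel_unit]
    · rw [mul2_bar_iff, hf, hf, hf, h]
  exact ⟨this.hom, fun g => (congrArg barLabel (this.hom_app g)).trans (hf g)⟩

end Action

/-! ### Semidirect products -/

/-- The simplices of `E` are the pairs `S m b` of simplices of `M` and `H`, and a simplicial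
operator `α` acts on the first component by the inverse of the action of the edge of `b` from
`0` to `α(0)`. -/
structure IsSemidirect {M E H : SSet.{u}} [PartialMonoid H] (i : M ⟶ E) (τ : E ⟶ H)
    (ρ : Action H M) (S : ∀ n : ℕ, M _⦋n⦌ → H _⦋n⦌ → E _⦋n⦌) : Prop where
  proj : ∀ (n : ℕ) (m : M _⦋n⦌) (b : H _⦋n⦌), τ.app _ (S n m b) = b
  injective : ∀ (n : ℕ) (m m' : M _⦋n⦌) (b : H _⦋n⦌), S n m b = S n m' b → m = m'
  surjective : ∀ (n : ℕ) (s : E _⦋n⦌), ∃ m, S n m (τ.app _ s) = s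
  map : ∀ (q n : ℕ) (α : ⦋q⦌ ⟶ ⦋n⦌) (m : M _⦋n⦌) (b : H _⦋n⦌),
    res α (S n m b) = S q (applyAut
      (ρ.aut (edge H 0 (α.toOrderHom 0) (Fin.zero_le _) b))⁻¹ (res α m)) (res α b)
  incl : ∀ x : M _⦋1⦌, S 1 x (unit H) = i.app _ x

section

variable {M E H : SSet.{u}} [PartialGroup M] [PartialGroup H] {i : M ⟶ E} {τ : E ⟶ H}

lemma Framing.t_mul (𝓕 : Framing i τ) (h : IsExt i τ) {s : H _⦋2⦌}
    (hη : 𝓕.η h s = PartialGroups.unit M) :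
    𝓕.t (H.δ 1 s) = 𝓕.t (H.δ 2 s) * 𝓕.t (H.δ 0 s) := by
  have := (𝓕.twistingPair h).homotopy s
  rw [show (𝓕.twistingPair h).η s = PartialGroups.unit M from hη,
    determinesHomotopy_iff_exists] at this
  obtain ⟨F, hF⟩ := this
  exact (Iso.ext hF.eq_of_unit).symm

lemma Framing.mul2_e (𝓕 : Framing i τ) (h : IsExt i τ) (hη : ∀ s, 𝓕.η h s = PartialGroups.unit M)
    {g g' g'' : H _⦋1⦌} (hg : Mul2 H g g' g'') {x z p : M _⦋1⦌}
    (hp : Mul2 M x (applyAut (𝓕.t g) z) p) : Mul2 E (𝓕.e x g) (𝓕.e z g') (𝓕.e p g'') := by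
  have := h.partialMonoid
  obtain ⟨s, rfl, rfl, rfl⟩ := hg
  obtain ⟨q, hq, hE⟩ := (𝓕.isTPEquiv h).exists_mul2_of_mul2 s hp
  rw [show (𝓕.twistingPair h).η s = PartialGroups.unit M from hη s] at hq
  rwa [(Framing.isProd_unit_right hq).unique hp] at hE

/-- For $\eta=1$ the product is $(x,g)(z,g')=(x\cdot t(g)(z),gg')$. This gives a formula for all
edges of the adapted simplices, not only for the spine (`hedge`), and thus the effect of an
arbitrary simplicial operator. -/
lemma Framing.exists_isSemidirect (𝓕 : Framing i τ) (h : IsExt i τ)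
    (hη : ∀ s, 𝓕.η h s = PartialGroups.unit M) :
    ∃ (ρ : Action H M) (S : ∀ n : ℕ, M _⦋n⦌ → H _⦋n⦌ → E _⦋n⦌),
      IsSemidirect i τ ρ S ∧ (∀ g, ρ.aut g = 𝓕.t g) ∧ ∀ x g, S 1 x g = 𝓕.e x g := by
  have := h.partialMonoid
  obtain ⟨ρ, hρ⟩ := Action.exists_aut_eq 𝓕.t (𝓕.t_unit h) fun s => 𝓕.t_mul h (hη s)
  have hc {n : ℕ} (b : H _⦋n⦌) (k : ℕ) (hk : k < n + 1) :
      cumul (fun j => 𝓕.t (spine H b j)) k = ρ.aut (edge H 0 ⟨k, hk⟩ (Fin.zero_le _) b) := by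
    induction k with
    | zero => exact (ρ.aut_edge_of_eq _ rfl b).symm
    | succ k ih =>
      rw [cumul_succ _ (⟨k, by lia⟩ : Fin n), ih (by lia), ← hρ]
      exact ρ.aut_edge_mul (Fin.zero_le _) (Fin.castSucc_le_succ (⟨k, by lia⟩ : Fin n)) b
  choose P hP hPe _ _ using fun n (b : H _⦋n⦌) => 𝓕.exists_triv_e h b
  have hproj {n : ℕ} (m : M _⦋n⦌) (b : H _⦋n⦌) : τ.app _ (ev (P n b) m (𝟙 _)) = b :=
    ((hP n b).proj n m (𝟙 _)).trans (res_id b)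
  have hedge {n : ℕ} (m : M _⦋n⦌) (b : H _⦋n⦌) (j k : Fin (n + 1)) (hjk : j ≤ k) :
      edge E j k hjk (ev (P n b) m (𝟙 _)) =
        𝓕.e (applyAut (ρ.aut (edge H 0 j (Fin.zero_le _) b))⁻¹ (edge M j k hjk m))
          (edge H j k hjk b) := by
    refine eq_of_edges (f := fun j k hjk => 𝓕.e (applyAut
      (ρ.aut (edge H 0 j (Fin.zero_le _) b))⁻¹ (edge M j k hjk m)) (edge H j k hjk b))
      (fun j => ?_) (fun k => ?_) (fun j k l hjk hkl => ?_) j k hjk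
    · rw [edge_self, edge_self, Framing.applyAut_unit, 𝓕.e_unit h, app_unit]
    · rw [spine_ev, Category.comp_id, hPe, hc b k (by lia)]
      rfl
    · refine 𝓕.mul2_e h hη (mul2_edge b j k l hjk hkl) ?_
      rw [← hρ, ← applyAut_mul,
        ← ρ.aut_edge_mul (Fin.zero_le j) hjk, mul_inv_rev, mul_inv_cancel_left]
      exact (mul2_edge m j k l hjk hkl).app _
  have hS (x : M _⦋1⦌) (g : H _⦋1⦌) : ev (P 1 g) x (𝟙 _) = 𝓕.e x g := by
    have h1 := hedge x g 0 1 (Fin.zero_le _)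
    rw [edge_zero_one, edge_zero_one, edge_zero_one, ρ.aut_edge_of_eq _ rfl, inv_one,
      applyAut_one] at h1
    exact h1
  refine ⟨ρ, fun n m b => ev (P n b) m (𝟙 _), ⟨fun n m b => hproj m b,
    fun n m m' b hm => (hP n b).injective n _ hm, fun n s => ?_, fun q n α m b => ?_, fun x => ?_⟩,
    hρ, hS⟩
  · exact (hP n _).surjective n (𝟙 _) s (res_id _).symm
  · refine eq_of_spine fun k => ?_
    rw [spine_res, hedge, spine_eq_edge, hedge]
    refine congrArg₂ 𝓕.e ?_ (edge_res α _ _ _ b).symm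
    have h1 : edge M k.castSucc k.succ (Fin.castSucc_le_succ k) (applyAut
        (ρ.aut (edge H 0 (α.toOrderHom 0) (Fin.zero_le _) b))⁻¹ (res α m)) =
        applyAut (ρ.aut (edge H 0 (α.toOrderHom 0) (Fin.zero_le _) b))⁻¹
          (edge M (α.toOrderHom k.castSucc) (α.toOrderHom k.succ)
            (α.toOrderHom.monotone (Fin.castSucc_le_succ k)) m) :=
      (app_edge _ _ _ _ _).symm.trans (congrArg _ (edge_res α _ _ _ m))
    rw [h1, edge_res, ← applyAut_mul, ← mul_inv_rev,
      ρ.aut_edge_mul (Fin.zero_le _) (α.toOrderHom.monotone (Fin.zero_le _))]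
  · exact (hS _ _).trans (𝓕.e_unit h x)

end

/-! ### Words and conjugation in a semidirect product -/

namespace IsSemidirect

variable {M E H : SSet.{u}} [PartialGroup H] {i : M ⟶ E} {τ : E ⟶ H}
  {ρ : Action H M} {S : ∀ n : ℕ, M _⦋n⦌ → H _⦋n⦌ → E _⦋n⦌}

lemma spine_S (h : IsSemidirect i τ ρ S) {n : ℕ} (m : M _⦋n⦌) (b : H _⦋n⦌) (k : Fin n) :
    spine E (S n m b) k = S 1 (applyAut
      (ρ.aut (edge H 0 k.castSucc (Fin.zero_le _) b))⁻¹ (spine M m k)) (spine H b k) :=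
  h.map _ _ _ _ _

lemma map_of_zero (h : IsSemidirect i τ ρ S) {q n : ℕ} {α : ⦋q⦌ ⟶ ⦋n⦌}
    (hα : α.toOrderHom 0 = 0) (m : M _⦋n⦌) (b : H _⦋n⦌) :
    res α (S n m b) = S q (res α m) (res α b) := by
  rw [h.map, ρ.aut_edge_of_eq _ hα.symm, inv_one, applyAut_one]

lemma isProd_iff (h : IsSemidirect i τ ρ S) {n : ℕ} {b : H _⦋n⦌} {w : Fin n → M _⦋1⦌}
    {p : M _⦋1⦌} : IsProd E (fun k => S 1 (w k) (spine H b k)) (S 1 p (prod H b)) ↔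
      IsProd M (fun k => applyAut (ρ.aut (edge H 0 k.castSucc (Fin.zero_le _) b)) (w k)) p := by
  have hprod (m : M _⦋n⦌) : prod E (S n m b) = S 1 (prod M m) (prod H b) :=
    h.map_of_zero rfl m b
  constructor
  · rintro ⟨s, hs, hp⟩
    obtain rfl : τ.app _ s = b := eq_of_spine fun k => by
      rw [← app_spine, hs, h.proj]
    obtain ⟨m, hm⟩ := h.surjective n s
    refine ⟨m, funext fun k => ?_, h.injective 1 _ _ (prod H (τ.app _ s)) ?_⟩
    · have hk := congrFun hs k
      rw [← hm, h.spine_S, hm] at hk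
      rw [← h.injective 1 _ _ _ hk, applyAut_applyAut_inv]
    · rw [← hprod, hm, hp]
  · rintro ⟨m, hm, rfl⟩
    refine ⟨S n m b, funext fun k => ?_, hprod m⟩
    rw [h.spine_S, hm, applyAut_inv_applyAut]

lemma mul2_incl_iff (h : IsSemidirect i τ ρ S) {x z p : M _⦋1⦌} {g : H _⦋1⦌} :
    Mul2 E (i.app _ x) (S 1 z g) (S 1 p g) ↔ Mul2 M x z p := by
  have h1 := h.isProd_iff (b := H.σ 0 g) (w := ![x, z]) (p := p)
  rw [spine_two, prod_two, δ_two_σ_zero, δ_zero_σ_zero, δ_one_σ_zero] at h1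
  rw [← isProd_two_iff, ← isProd_two_iff]
  convert h1 using 2
  · refine funext (Fin.forall_fin_two.2 ⟨(h.incl x).symm, rfl⟩)
  · refine funext (Fin.forall_fin_two.2 ⟨?_, ?_⟩)
    · exact (congrArg (applyAut · x) (ρ.aut_edge_of_eq _ rfl _)).symm
    · refine (congrArg (applyAut · z) (?_ : ρ.aut (edge H 0 (Fin.castSucc 1) (Fin.zero_le _)
        (H.σ 0 g)) = 1)).symm
      exact (congrArg ρ.aut (congrFun (spine_two (H.σ 0 g)) 0)).trans
        ((congrArg ρ.aut (δ_two_σ_zero g)).trans ρ.aut_unit)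

variable [PartialGroup M]

/-- The simplex over $[g|1|g^{-1}]$ with component $[1|{}^gx|1]$, a degeneracy of ${}^gx$, has the
required letters and long edge. -/
lemma isProd_conj (h : IsSemidirect i τ ρ S) (g : H _⦋1⦌) (x : M _⦋1⦌) :
    IsProd E ![S 1 (unit M) g, i.app _ x, S 1 (unit M) (inv H g)]
      (i.app _ (applyAut (ρ.aut g) x)) := by
  obtain ⟨s, h2, h0, h1⟩ := mul2_inv_self g
  have hb (k : Fin 3) : spine H (H.σ 1 s) k = ![g, unit H, inv H g] k := by
    fin_cases k
    · exact ((res_res _ _ s).trans (congrArg (fun a => res a s)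
        (SimplexCategory.Hom.ext_one_left _ (SimplexCategory.δ 2) rfl rfl))).trans h2
    · exact (res_res _ _ s).trans (res_eq_unit rfl s)
    · exact ((res_res _ _ s).trans (congrArg (fun a => res a s)
        (SimplexCategory.Hom.ext_one_left _ (SimplexCategory.δ 0) rfl rfl))).trans h0
  have hp : prod H (H.σ 1 s) = unit H :=
    ((res_res _ _ s).trans (congrArg (fun a => res a s)
        (SimplexCategory.Hom.ext_one_left _ (SimplexCategory.δ 1) rfl rfl))).trans h1
  have key := h.isProd_iff (b := H.σ 1 s) (w := ![unit M, x, unit M]) (p := applyAut (ρ.aut g) x)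
  rw [hp, h.incl] at key
  have hw : (fun k : Fin 3 => S 1 (![unit M, x, unit M] k) (spine H (H.σ 1 s) k)) =
      ![S 1 (unit M) g, i.app _ x, S 1 (unit M) (inv H g)] := by
    funext k
    rw [hb]
    fin_cases k
    · rfl
    · exact h.incl x
    · rfl
  rw [hw] at key
  refine key.2 ⟨res (collapse 3 1) (applyAut (ρ.aut g) x), funext fun k => ?_, ?_⟩
  · rw [spine_apply, res_res]
    fin_cases k
    · exact (res_eq_unit rfl _).trans (Framing.applyAut_unit _).symm
    · refine (res_eq_self rfl rfl _).trans (congrArg (applyAut · x) (congrArg ρ.aut ?_))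
      exact (hb 0).symm
    · exact (res_eq_unit rfl _).trans (Framing.applyAut_unit _).symm
  · rw [prod_eq_res, res_res]
    exact res_eq_self rfl rfl _

end IsSemidirect

/-! ### Derivations and sections -/

section

variable {M E H : SSet.{u}}

lemma Section.proj_app {τ : E ⟶ H} (σ : Section τ) {n : ℕ} (b : H _⦋n⦌) :
    τ.app _ (σ.1.app _ b) = b :=
  ConcreteCategory.congr_hom (NatTrans.congr_app σ.2 (op ⦋n⦌)) b

namespace Derivation

variable {ρ : Action H M}

lemma ext {θ θ' : Derivation ρ} (h : ∀ n b, θ.map n b = θ'.map n b) : θ = θ' := by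
  cases θ
  cases θ'
  congr
  funext n b
  exact h n b

variable [PartialMonoid H]

/-- The axioms are the cases of faces and degeneracies, which generate all operators. The formula is
stable under composition because the actions of consecutive edges of `b` multiply. -/
lemma res_map (θ : Derivation ρ) {q n : ℕ} (α : ⦋q⦌ ⟶ ⦋n⦌) (b : H _⦋n⦌) :
    res α (θ.map n b) =
      applyAut (ρ.aut (edge H 0 (α.toOrderHom 0) (Fin.zero_le _) b)) (θ.map q (res α b)) := by
  let W : MorphismProperty SimplexCategory := fun q n α => ∀ b : H _⦋n.len⦌,
    res (m := q.len) (n := n.len) α (θ.map n.len b) = applyAut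
      (ρ.aut (edge H 0 (α.toOrderHom 0) (Fin.zero_le _) b))
      (θ.map q.len (res (m := q.len) (n := n.len) α b))
  have hW : W.IsMultiplicative :=
    { id_mem := fun n b => by
        have h1 : ρ.aut (edge H 0 0 (Fin.zero_le _) b) = 1 := ρ.aut_edge_of_eq _ rfl b
        have h2 : res (m := n.len) (n := n.len) (𝟙 n) b = b := res_id b
        have h3 := res_id (θ.map n.len b)
        rw [h2]
        exact h3.trans (congrArg (applyAut · (θ.map n.len b)) h1).symm
      comp_mem := fun {l m n} β α hβ hα b => by
        have h1 := congrArg (res (m := l.len) (n := m.len) β) (hα b)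
        rw [← applyAut_res, hβ, ← applyAut_mul, edge_res, ρ.aut_edge_mul (Fin.zero_le _)
          (α.toOrderHom.monotone (Fin.zero_le _))] at h1
        rw [res_res, res_res] at h1
        exact h1 }
  have htop : W = ⊤ := SimplexCategory.morphismProperty_eq_top W
    (fun {n} j b => by
      induction j using Fin.cases with
      | zero => exact θ.δ_zero n b
      | succ j =>
        refine (θ.δ_succ n j b).trans (congrArg (applyAut · _) (ρ.aut_edge_of_eq _ ?_ b)).symm
        exact rfl)
    (fun {n} j b => by
      refine (θ.σ_map n j b).trans (congrArg (applyAut · _) (ρ.aut_edge_of_eq _ ?_ b)).symm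
      exact (Fin.predAbove_right_zero (i := j)).symm)
  have : W α := htop ▸ trivial
  exact this b

end Derivation

variable {i : M ⟶ E} {τ : E ⟶ H} {ρ : Action H M} {S : ∀ n : ℕ, M _⦋n⦌ → H _⦋n⦌ → E _⦋n⦌}

variable [PartialGroup H]

namespace IsSemidirect

/-- The section `b ↦ S (θ b) b`. -/
def sectionOf (h : IsSemidirect i τ ρ S) (θ : Derivation ρ) : Section τ where
  val :=
    { app := fun n => ↾(fun b => S n.unop.len (θ.map _ b) b)
      naturality := by
        rintro ⟨⟨r⟩⟩ ⟨⟨q⟩⟩ ⟨α⟩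
        ext b
        have h1 := h.map q r α (θ.map r b) b
        rw [θ.res_map, applyAut_inv_applyAut] at h1
        exact h1.symm }
  property := by
    ext ⟨⟨r⟩⟩ b
    exact h.proj r _ b

lemma sectionOf_app (h : IsSemidirect i τ ρ S) (θ : Derivation ρ) {n : ℕ} (b : H _⦋n⦌) :
    (h.sectionOf θ).1.app _ b = S n (θ.map n b) b := rfl

/-- The component in $M$ of a section satisfies the twisted naturality of the semidirect product.
Among faces and degeneracies only $d_0$ moves the vertex 0, so these are the axioms of a derivation.
-/
lemma sectionOf_bijective (h : IsSemidirect i τ ρ S) : Function.Bijective h.sectionOf := by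
  refine ⟨fun θ θ' hθ => Derivation.ext fun n b => h.injective n _ _ b ?_, fun σ => ?_⟩
  · rw [← h.sectionOf_app, hθ, h.sectionOf_app]
  · choose f hf using fun n (b : H _⦋n⦌) => h.surjective n (σ.1.app _ b)
    simp only [σ.proj_app] at hf
    have hres {q n : ℕ} (α : ⦋q⦌ ⟶ ⦋n⦌) (b : H _⦋n⦌) :
        applyAut (ρ.aut (edge H 0 (α.toOrderHom 0) (Fin.zero_le _) b))⁻¹ (res α (f n b)) =
          f q (res α b) := by
      refine h.injective q _ _ (res α b) ?_
      rw [← h.map, hf, hf, app_res]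
    have hres0 {q n : ℕ} (α : ⦋q⦌ ⟶ ⦋n⦌) (hα : α.toOrderHom 0 = 0) (b : H _⦋n⦌) :
        res α (f n b) = f q (res α b) := by
      rw [← hres, ρ.aut_edge_of_eq _ hα.symm, inv_one, applyAut_one]
    refine ⟨⟨f, fun n b => ?_, fun n j b => hres0 _ rfl b, fun n j b => hres0 _ ?_ b⟩,
      Subtype.ext ?_⟩
    · refine Eq.trans (applyAut_applyAut_inv _ _).symm (congrArg _ (hres (SimplexCategory.δ 0) b))
    · exact Fin.predAbove_right_zero (i := j)
    · ext ⟨⟨r⟩⟩ b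
      exact hf r b

variable [PartialGroup M]

lemma sectionOf_isRegular_iff (h : IsSemidirect i τ ρ S)
    (hN : ∀ x g, S 1 x g ∈ normalizer i ↔ x ∈ normalizer (𝟙 M)) (θ : Derivation ρ) :
    θ.IsRegular ↔ (h.sectionOf θ).IsRegular i := by
  refine forall_congr' fun n => forall_congr' fun b => forall_congr' fun k => ?_
  rw [h.sectionOf_app, h.spine_S, hN]
  refine ⟨app_mem_normalizer _, fun hm => ?_⟩
  have := app_mem_normalizer (ρ.aut (edge H 0 k.castSucc (Fin.zero_le _) b)) hm
  rwa [applyAut_applyAut_inv] at this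

end IsSemidirect

end

/-! ### Homotopies as families of prisms -/

section Prism

/-- The word `(a₁, ..., a_k, η, b_{k+1}, ..., bₙ)`. -/
def prismWord {A : Type*} {n : ℕ} (η : A) (a b : Fin n → A) (k : Fin (n + 1)) : Fin (n + 1) → A :=
  k.insertNth (α := fun _ => A) η (fun j => if j.castSucc < k then a j else b j)

section

variable {A : Type*} {n : ℕ} {η : A} {a b : Fin n → A} {k : Fin (n + 1)}

lemma prismWord_self : prismWord η a b k k = η := Fin.insertNth_apply_same ..

lemma prismWord_castSucc {j : Fin n} (h : j.castSucc < k) :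
    prismWord η a b k j.castSucc = a j := by
  have := Fin.insertNth_apply_succAbove (α := fun _ => A) k η
    (fun j => if j.castSucc < k then a j else b j) j
  rwa [Fin.succAbove_of_castSucc_lt _ _ h, if_pos h] at this

lemma prismWord_succ {j : Fin n} (h : k ≤ j.castSucc) : prismWord η a b k j.succ = b j := by
  have := Fin.insertNth_apply_succAbove (α := fun _ => A) k η
    (fun j => if j.castSucc < k then a j else b j) j
  rwa [Fin.succAbove_of_le_castSucc _ _ h, if_neg (not_lt.2 h)] at this

lemma eq_prismWord {w : Fin (n + 1) → A} (hself : w k = η)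
    (hlt : ∀ j : Fin n, j.castSucc < k → w j.castSucc = a j)
    (hle : ∀ j : Fin n, k ≤ j.castSucc → w j.succ = b j) : w = prismWord η a b k := by
  refine Fin.eq_insertNth_iff.2 ⟨hself, funext fun j => ?_⟩
  change w (k.succAbove j) = _
  by_cases h : j.castSucc < k
  · rw [Fin.succAbove_of_castSucc_lt _ _ h, if_pos h, hlt j h]
  · rw [Fin.succAbove_of_le_castSucc _ _ (not_lt.1 h), if_neg h, hle j (not_lt.1 h)]

end

variable {X Y : SSet.{u}} {n : ℕ}

lemma edge_σ (y : Y _⦋n⦌) (k : Fin (n + 1)) (i j : Fin (n + 2)) (hij : i ≤ j) :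
    edge Y i j hij (Y.σ k y) = edge Y (k.predAbove i) (k.predAbove j)
      (Fin.predAbove_right_monotone _ hij) y :=
  edge_res _ _ _ _ _

lemma edge_congr {y : Y _⦋n⦌} {i j i' j' : Fin (n + 1)} {h : i ≤ j} (hi : i = i') (hj : j = j') :
    edge Y i j h y = edge Y i' j' (hi ▸ hj ▸ h) y := by
  subst hi hj
  rfl

lemma spine_σ_self [PartialMonoid Y] (y : Y _⦋n⦌) (k : Fin (n + 1)) :
    spine Y (Y.σ k y) k = unit Y := by
  rw [spine_eq_edge, edge_σ, edge_eq_unit]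
  simp

lemma spine_σ_castSucc (y : Y _⦋n⦌) {k : Fin (n + 1)} {j : Fin n} (h : j.castSucc < k) :
    spine Y (Y.σ k y) j.castSucc = spine Y y j := by
  rw [spine_eq_edge, edge_σ]
  refine edge_congr ?_ ?_
  · rw [Fin.predAbove_castSucc_of_le _ _ h.le]
  · rw [Fin.succ_castSucc, Fin.predAbove_castSucc_of_le]
    exact h

lemma spine_σ_succ (y : Y _⦋n⦌) {k : Fin (n + 1)} {j : Fin n} (h : k ≤ j.castSucc) :
    spine Y (Y.σ k y) j.succ = spine Y y j := by
  rw [spine_eq_edge, edge_σ]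
  refine edge_congr ?_ ?_
  · rw [← Fin.succ_castSucc, Fin.predAbove_succ_of_le _ _ h]
  · rw [Fin.predAbove_succ_of_le]
    exact h.trans (Fin.castSucc_le_succ j)

lemma prod_σ (y : Y _⦋n⦌) (k : Fin (n + 1)) : prod Y (Y.σ k y) = prod Y y := by
  rw [prod_eq_edge, edge_σ]
  exact edge_congr (by simp) (by simp)

lemma mkOfSucc_collapse_of_gt {n k : ℕ} (j : Fin n) (h : k < j.val) :
    SimplexCategory.mkOfSucc j ≫ collapse n k = cst 1 1 1 :=
  SimplexCategory.Hom.ext_one_left _ _ (collapse_of_lt h) (collapse_of_lt (Nat.lt_succ_of_lt h))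

/-- All prisms over `y` share their first and last vertices, so their long edge does not depend on
`k`. -/
lemma prod_prism (F : Y ⊗ (Δ[1] : SSet.{u}) ⟶ X) (y : Y _⦋n⦌) (k : Fin (n + 1)) :
    prod X (ev F (Y.σ k y) (collapse (n + 1) k)) = ev F (prod Y y) (𝟙 _) := by
  rw [prod_eq_edge, edge_ev, ← prod_eq_edge, prod_σ]
  refine congrArg (ev F _) (SimplexCategory.Hom.ext_one_left _ (𝟙 _) ?_ ?_)
  · exact collapse_of_le (n := n + 1) (k := k) (v := 0) (Nat.zero_le _)
  · exact collapse_of_lt (v := Fin.last (n + 1)) k.isLt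

variable [PartialMonoid Y] {f g : Y ⟶ X} {η : X _⦋1⦌}

lemma IsHomotopy.spine_prism {F : Y ⊗ (Δ[1] : SSet.{u}) ⟶ X} (h : IsHomotopy F f g η)
    (y : Y _⦋n⦌) (k : Fin (n + 1)) :
    spine X (ev F (Y.σ k y) (collapse (n + 1) k)) =
      prismWord η (fun j => f.app _ (spine Y y j)) (fun j => g.app _ (spine Y y j)) k := by
  refine eq_prismWord ?_ (fun j hj => ?_) (fun j hj => ?_)
  · rw [spine_ev, mkOfSucc_collapse, spine_σ_self, h.edge]
  · rw [spine_ev, mkOfSucc_collapse_of_lt _ hj, spine_σ_castSucc _ hj, h.zero]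
  · rw [spine_ev, mkOfSucc_collapse_of_gt _ (Nat.lt_succ_of_le hj), spine_σ_succ _ hj, h.one]

lemma hom_to_one_cases (α : ⦋n⦌ ⟶ ⦋1⦌) : (∀ v, α.toOrderHom v = 0) ∨ (∀ v, α.toOrderHom v = 1) ∨
    ∃ k : Fin n, α.toOrderHom k.castSucc = 0 ∧ α.toOrderHom k.succ = 1 := by
  by_cases h0 : α.toOrderHom 0 = 0
  · by_cases h : ∃ k : Fin n, α.toOrderHom k.castSucc = 0 ∧ α.toOrderHom k.succ = 1
    · exact Or.inr (Or.inr h)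
    · refine Or.inl fun v => ?_
      induction v using Fin.induction with
      | zero => exact h0
      | succ k ih =>
        by_contra hk
        exact h ⟨k, ih, Fin.eq_one_of_ne_zero _ hk⟩
  · exact Or.inr (Or.inl fun v => Fin.eq_one_of_ne_zero _ fun hv => h0
      (Fin.le_zero_iff.1 (hv ▸ α.toOrderHom.monotone (Fin.zero_le v))))

variable [PartialMonoid X]

/-- A family of prisms on the simplices of `Y` defines a homotopy. -/
lemma exists_isHomotopy_of_prism (h : ∀ (n : ℕ) (y : Y _⦋n⦌), ∃ p, ∀ k, IsProd X
      (prismWord η (fun j => f.app _ (spine Y y j)) (fun j => g.app _ (spine Y y j)) k) p) :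
    ∃ F, IsHomotopy F f g η := by
  -- The prisms on a single edge give $f(y)\cdot\eta=\eta\cdot g(y)$, the value which the homotopy
  -- must take on the diagonal.
  have hq (y : Y _⦋1⦌) : ∃ q, Mul2 X (f.app _ y) η q ∧ Mul2 X η (g.app _ y) q := by
    obtain ⟨p, hp⟩ := h 1 y
    refine ⟨p, ?_, ?_⟩
    · rw [← isProd_two_iff]
      convert hp 1
      refine eq_prismWord rfl (Fin.forall_fin_one.2 fun _ => ?_) (Fin.forall_fin_one.2 fun h => ?_)
      · rw [spine_one]
        rfl
      · exact absurd h (by decide)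
    · rw [← isProd_two_iff]
      convert hp 0
      refine eq_prismWord rfl (Fin.forall_fin_one.2 fun h => ?_) (Fin.forall_fin_one.2 fun _ => ?_)
      · exact absurd h (by decide)
      · rw [spine_one]
        rfl
  choose q hq₀ hq₁ using hq
  let c (y : Y _⦋1⦌) (α : ⦋1⦌ ⟶ ⦋1⦌) : X _⦋1⦌ := if α.toOrderHom 1 = 0 then f.app _ y else
    if α.toOrderHom 0 = 1 then g.app _ y else q y
  have hc0 (y : Y _⦋1⦌) {α : ⦋1⦌ ⟶ ⦋1⦌} (hα : α.toOrderHom 1 = 0) : c y α = f.app _ y := if_pos hα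
  have hc1 (y : Y _⦋1⦌) {α : ⦋1⦌ ⟶ ⦋1⦌} (hα : α.toOrderHom 0 = 1) : c y α = g.app _ y := by
    refine (if_neg ?_).trans (if_pos hα)
    intro h1
    have := α.toOrderHom.monotone (Fin.zero_le 1)
    rw [hα, h1] at this
    exact absurd this (by decide)
  have hcq (y : Y _⦋1⦌) {α : ⦋1⦌ ⟶ ⦋1⦌} (h0 : α.toOrderHom 0 = 0) (h1 : α.toOrderHom 1 = 1) :
      c y α = q y := by
    refine (if_neg ?_).trans (if_neg ?_)
    · rw [h1]; decide
    · rw [h0]; decide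
  suffices hF : ∃ F : Y ⊗ (Δ[1] : SSet.{u}) ⟶ X, ∀ y α, ev F y α = c y α by
    obtain ⟨F, hF⟩ := hF
    refine ⟨F, fun r y => eq_of_spine fun k => ?_, fun r y => eq_of_spine fun k => ?_, ?_⟩
    · rw [spine_ev, hF, hc0 _ rfl, app_spine]
    · rw [spine_ev, hF, hc1 _ rfl, app_spine]
    · rw [hF, hcq _ rfl rfl]
      have := hq₀ (unit Y)
      rw [app_unit] at this
      exact this.unique (unit_mul2 _)
  refine exists_tensorHom_of_edges c (fun y α => ?_) (fun r y α => ?_) (fun y α => ?_)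
  · rw [res_zero_eq_unit]
    obtain hα | hα : α.toOrderHom 0 = 0 ∨ α.toOrderHom 0 = 1 := by
      generalize α.toOrderHom 0 = a
      fin_cases a <;> simp
    · rw [hc0 _ hα, app_unit]
    · rw [hc1 _ hα, app_unit]
  · obtain hα | hα | ⟨K, hK0, hK1⟩ := hom_to_one_cases α
    · exact ⟨f.app _ y, fun k => by rw [hc0 _ (hα _), app_spine]⟩
    · exact ⟨g.app _ y, fun k => by rw [hc1 _ (hα _), app_spine]⟩
    · obtain ⟨p, hp⟩ := h r y
      obtain ⟨s, hs, -⟩ := hp K.castSucc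
      have h0 (v : Fin (r + 1)) (hv : v ≤ K.castSucc) : α.toOrderHom v = 0 :=
        Fin.le_zero_iff.1 (hK0 ▸ α.toOrderHom.monotone hv)
      have h1 (v : Fin (r + 1)) (hv : K.succ ≤ v) : α.toOrderHom v = 1 :=
        Fin.last_le_iff.1 (hK1.symm.trans_le (α.toOrderHom.monotone hv))
      -- If $\alpha$ jumps from 0 to 1 along the edge `K`, the required word arises from the prism
      -- word with $\eta$ in position `K` by merging $\eta$ with the next letter $g(y_K)$.
      refine ⟨X.δ K.succ.castSucc s, fun k => ?_⟩
      rw [δ_eq_res, spine_res]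
      obtain hk | rfl | hk := lt_trichotomy k K
      · rw [hc0 _ (h0 k.succ hk)]
        refine Eq.trans ?_ ((congrFun hs k.castSucc).trans (prismWord_castSucc hk))
        exact edge_congr (Fin.succAbove_of_castSucc_lt _ _ (by simpa using hk.le))
          (Fin.succAbove_of_castSucc_lt _ _ (by simpa using hk))
      · rw [hcq _ hK0 hK1]
        have h2 := mul2_edge s k.castSucc.castSucc k.castSucc.succ k.succ.succ
          (Fin.castSucc_le_succ _) (Fin.castSucc_le_succ k.succ)
        have h3 : edge X k.castSucc.castSucc k.castSucc.succ (Fin.castSucc_le_succ _) s = η :=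
          (congrFun hs k.castSucc).trans prismWord_self
        have h4 : edge X k.castSucc.succ k.succ.succ (Fin.castSucc_le_succ k.succ) s =
            g.app _ (spine Y y k) := (congrFun hs k.succ).trans (prismWord_succ le_rfl)
        rw [h3, h4] at h2
        refine Eq.trans ?_ (h2.unique (hq₁ _))
        exact edge_congr (Fin.succAbove_of_castSucc_lt _ _ (by simp))
          (Fin.succAbove_of_le_castSucc _ _ le_rfl)
      · rw [hc1 _ (h1 k.castSucc hk)]
        refine Eq.trans ?_ ((congrFun hs k.succ).trans (prismWord_succ hk.le))
        exact edge_congr (Fin.succAbove_of_le_castSucc _ _ hk)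
          (Fin.succAbove_of_le_castSucc _ _ (by simpa using hk.le))
  · have hα : α.toOrderHom 0 ≤ α.toOrderHom 1 := α.toOrderHom.monotone (by decide)
    have hα' : α.toOrderHom 1 ≤ α.toOrderHom 2 := α.toOrderHom.monotone (by decide)
    obtain ⟨p, hp⟩ := h 2 y
    have hw0 : IsProd X ![η, g.app _ (Y.δ 2 y), g.app _ (Y.δ 0 y)] p := by
      convert hp 0
      refine eq_prismWord rfl (fun j hj => absurd hj (Fin.not_lt_zero _)) fun j _ => ?_
      rw [spine_two]
      fin_cases j <;> rfl
    have hw1 : IsProd X ![f.app _ (Y.δ 2 y), η, g.app _ (Y.δ 0 y)] p := by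
      convert hp 1
      rw [spine_two]
      refine eq_prismWord rfl (Fin.forall_fin_two.2 ⟨fun _ => rfl, fun hj => ?_⟩)
        (Fin.forall_fin_two.2 ⟨fun hj => ?_, fun _ => rfl⟩) <;> exact absurd hj (by decide)
    -- The common product of the prisms is the value on the diagonal over the long edge; the mixed
    -- cases below are bracketings of this product.
    have hp2 : p = q (Y.δ 1 y) := by
      obtain ⟨u, hu, hup⟩ := hw0.exists_mul2_right
      rw [hu.unique ((mul2_δ y).app g)] at hup
      exact hup.unique (hq₁ _)
    obtain h2 | h2 := eq_or_ne (α.toOrderHom 2) 0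
    · have h1 : α.toOrderHom 1 = 0 := Fin.le_zero_iff.1 (h2 ▸ hα')
      rw [hc0 _ h1, hc0 _ h2, hc0 _ h2]
      exact (mul2_δ y).app f
    replace h2 := Fin.eq_one_of_ne_zero _ h2
    obtain h0 | h0 := eq_or_ne (α.toOrderHom 0) 0
    · rw [hcq _ (α := SimplexCategory.δ 1 ≫ α) h0 h2, ← hp2]
      obtain h1 | h1 := eq_or_ne (α.toOrderHom 1) 0
      · rw [hc0 _ h1, hcq _ (α := SimplexCategory.δ 0 ≫ α) h1 h2]
        obtain ⟨u, hu, hup⟩ := hw1.exists_mul2_right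
        rwa [hu.unique (hq₁ _)] at hup
      · replace h1 := Fin.eq_one_of_ne_zero _ h1
        rw [hcq _ (α := SimplexCategory.δ 2 ≫ α) h0 h1, hc1 _ h1]
        obtain ⟨u, hu, hup⟩ := hw1.exists_mul2_left
        rwa [hu.unique (hq₀ _)] at hup
    · replace h0 := Fin.eq_one_of_ne_zero _ h0
      have h1 : α.toOrderHom 1 = 1 := Fin.last_le_iff.1 (h0.symm.trans_le hα)
      rw [hc1 _ h0, hc1 _ h1, hc1 _ h0]
      exact (mul2_δ y).app g

end Prism

/-! ### Homotopy classes of sections -/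

section

variable {M E H : SSet.{u}} [PartialGroup H] {i : M ⟶ E} {τ : E ⟶ H}

/-- Homotopic sections are homotopic through sections. -/
lemma Section.exists_vertical_homotopy [PartialMonoid E] {σ σ' : Section τ}
    (h : Nonempty (SSet.Homotopy σ.1 σ'.1)) : ∃ F ξ, IsHomotopy F σ.1 σ'.1 ξ ∧
      ∀ (r : ℕ) (b : H _⦋r⦌) (α : ⦋r⦌ ⟶ ⦋1⦌), τ.app _ (ev F b α) = b := by
  obtain ⟨F, hF0, hF1⟩ := nonempty_homotopy_iff.1 h
  have hF : IsHomotopy F σ.1 σ'.1 (ev F (unit H) (𝟙 _)) := ⟨hF0, hF1, rfl⟩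
  have hZ := hF.postcomp τ
  rw [σ.2, σ'.2] at hZ
  -- The projected homotopy goes from the identity of $H$ to itself. Its reverse is inserted before
  -- `F`, which does not change the ends.
  obtain ⟨Z', hZ'⟩ := hZ.reverse
  have hG := hF.comp hZ'
  rw [Category.id_comp, Category.id_comp] at hG
  refine ⟨_, _, hG, fun r b α => ?_⟩
  have hτ := hG.postcomp τ
  -- After projection the composite homotopy has edge $z^{-1}z=1$, where $z$ is the projected edge;
  -- hence it is constant.
  have hu := (hZ.mul2_left (inv H (τ.app _ (ev F (unit H) (𝟙 _))))).unique (inv_mul2_self _)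
  rw [ev_comp] at hu
  rw [hu, σ.2, σ'.2] at hτ
  have := congrArg (fun K => ev K b α) (hτ.ext (IsHomotopy.refl (𝟙 H)))
  rw [ev_comp] at this
  exact this

namespace IsSemidirect

variable {ρ : Action H M} {S : ∀ n : ℕ, M _⦋n⦌ → H _⦋n⦌ → E _⦋n⦌}

/-- This is `isProd_iff` over the degenerate simplex $s_kb$, in which `y` sits over the inserted
unit edge. -/
lemma isProd_prismWord_iff (h : IsSemidirect i τ ρ S) (θ θ' : Derivation ρ) (y : M _⦋1⦌) {n : ℕ}
    (b : H _⦋n⦌) (k : Fin (n + 1)) (p : M _⦋1⦌) :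
    IsProd E (prismWord (i.app _ y) (fun j => (h.sectionOf θ).1.app _ (spine H b j))
        (fun j => (h.sectionOf θ').1.app _ (spine H b j)) k) (S 1 p (prod H b)) ↔
      IsProd M (k.insertNth (α := fun _ => M _⦋1⦌)
        (applyAut (ρ.aut (edge H 0 k (Fin.zero_le k) b)) y)
        (fun j : Fin n => applyAut (ρ.aut (edge H 0 j.castSucc (Fin.zero_le _) b))
          (if j.castSucc < k then θ.map 1 (spine H b j) else θ'.map 1 (spine H b j)))) p := by
  have h1 := h.isProd_iff (b := H.σ k b) (p := p)
    (w := prismWord y (fun j => θ.map 1 (spine H b j)) (fun j => θ'.map 1 (spine H b j)) k)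
  rw [prod_σ] at h1
  convert h1 using 2
  · refine (eq_prismWord ?_ (fun j hj => ?_) (fun j hj => ?_)).symm
    · rw [prismWord_self, spine_σ_self, h.incl]
    · rw [prismWord_castSucc hj, spine_σ_castSucc _ hj, sectionOf_app]
    · rw [prismWord_succ hj, spine_σ_succ _ hj, sectionOf_app]
  · have he (j : Fin (n + 1)) : edge H 0 j.castSucc (Fin.zero_le _) (H.σ k b) =
        edge H 0 (k.predAbove j.castSucc) (Fin.zero_le _) b :=
      (edge_σ b k _ _ _).trans (edge_congr Fin.predAbove_right_zero rfl)
    refine (Fin.eq_insertNth_iff.2 ⟨?_, funext fun j => ?_⟩).symm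
    · rw [prismWord_self, he]
      exact congrArg (fun g => applyAut (ρ.aut g) y) (edge_congr rfl (by simp))
    · change applyAut (ρ.aut (edge H 0 (k.succAbove j).castSucc (Fin.zero_le _) (H.σ k b)))
        (prismWord _ _ _ k (k.succAbove j)) = _
      rw [he]
      by_cases hj : j.castSucc < k
      · rw [Fin.succAbove_of_castSucc_lt _ _ hj, prismWord_castSucc hj, if_pos hj]
        exact congrArg (fun g => applyAut (ρ.aut g) _)
          (edge_congr rfl (Fin.predAbove_castSucc_of_le _ _ hj.le))
      · have hj' := not_lt.1 hj
        rw [Fin.succAbove_of_le_castSucc _ _ hj', prismWord_succ hj', if_neg hj]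
        refine congrArg (fun g => applyAut (ρ.aut g) _) (edge_congr rfl ?_)
        rw [← Fin.succ_castSucc, Fin.predAbove_succ_of_le _ _ hj']

variable [PartialGroup M]

/-- The words with a common product are the prisms of a homotopy with edge $\imath(y)$. Conversely,
verticality puts the edge of the homotopy over the unit, hence in the image of `i`, and the prisms
then have a common product. -/
lemma related_iff (h : IsSemidirect i τ ρ S) (hi : IsExt i τ) (θ θ' : Derivation ρ) :
    θ.Related θ' ↔ Nonempty (SSet.Homotopy (h.sectionOf θ).1 (h.sectionOf θ').1) := by
  have := hi.partialMonoid
  constructor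
  · rintro ⟨y, hy⟩
    obtain ⟨F, hF⟩ := exists_isHomotopy_of_prism (η := i.app _ y) (f := (h.sectionOf θ).1)
      (g := (h.sectionOf θ').1) fun n b => by
        obtain ⟨p, hp⟩ := hy n b
        exact ⟨_, fun k => (h.isProd_prismWord_iff θ θ' y b k p).2 (hp k)⟩
    exact nonempty_homotopy_iff.2 ⟨F, hF.zero, hF.one⟩
  · intro hs
    obtain ⟨F, ξ, hF, hτ⟩ := Section.exists_vertical_homotopy hs
    obtain ⟨y, hy⟩ := h.surjective 1 ξ
    rw [← hF.edge, hτ, h.incl, hF.edge] at hy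
    subst hy
    refine ⟨y, fun n b => ?_⟩
    obtain ⟨p, hp⟩ := h.surjective 1 (ev F (prod H b) (𝟙 _))
    rw [hτ] at hp
    refine ⟨p, fun k => (h.isProd_prismWord_iff θ θ' y b k p).1 ?_⟩
    exact ⟨_, hF.spine_prism b k, (prod_prism F b k).trans hp.symm⟩

end IsSemidirect

variable [PartialGroup M]

/-- A regular section `σ₀` defines an action by conjugation, derivations for this action are the
same as sections, and `H¹(H; M)` is the set of homotopy classes of sections. -/
theorem exists_conjugationAction (h : IsExt i τ) {σ₀ : Section τ} (hσ₀ : σ₀.IsRegular i) :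
    ∃ ρ : Action H M, IsConjugationAction i σ₀ ρ ∧
      (∀ ρ' : Action H M, IsConjugationAction i σ₀ ρ' → ρ' = ρ) ∧
      ∃ (Φ : Derivation ρ ≃ Section τ) (Ψ : H1 ρ ≃ SectionClasses τ),
        (∀ (θ : Derivation ρ) (g : H _⦋1⦌),
          IsProd E ![i.app (op ⦋1⦌) (θ.map 1 g), σ₀.1.app (op ⦋1⦌) g] ((Φ θ).1.app (op ⦋1⦌) g)) ∧
        (∀ θ : Derivation ρ, Ψ (Quot.mk _ θ) = Quot.mk _ (Φ θ)) ∧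
        (∀ θ : Derivation ρ, θ.IsRegular ↔ (Φ θ).IsRegular i) := by
  have := h.partialMonoid
  obtain ⟨𝓕, h𝓕, hη⟩ := hσ₀.exists_framing h
  obtain ⟨ρ, S, hS, hρ, hSe⟩ := 𝓕.exists_isSemidirect h hη
  have hconj : IsConjugationAction i σ₀ ρ := fun g => by
    refine ⟨?_, fun x => ?_⟩
    · rw [hρ, ← h𝓕]
      exact (𝓕.isHomotopy g).determines
    · rw [← h𝓕, ← h𝓕, ← hSe, ← hSe]
      exact hS.isProd_conj g x
  refine ⟨ρ, hconj, fun ρ' hρ' => Action.ext fun g => aut_ext fun x => h.injective 1 ?_,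
    Equiv.ofBijective _ hS.sectionOf_bijective,
    Quot.congr (Equiv.ofBijective _ hS.sectionOf_bijective) fun θ θ' => hS.related_iff h θ θ',
    fun θ g => ?_, fun θ => rfl, hS.sectionOf_isRegular_iff fun x g => ?_⟩
  -- The conjugation formula determines the action on edges, since products in $E$ are unique.
  · exact ((hρ' g).2 x).unique ((hconj g).2 x)
  · rw [isProd_two_iff, Equiv.ofBijective_apply, ← h𝓕, ← hSe, hS.sectionOf_app, hS.mul2_incl_iff]
    exact mul2_unit _
  · rw [hSe, 𝓕.e_mem_normalizer_iff h]

end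

end PartialGroups

theorem theorem5p8 {M E H : SSet.{u}} [PartialGroups.PartialGroup M]
    [PartialGroups.PartialGroup H] (i : M ⟶ E) (τ : E ⟶ H)
    (hτ : PartialGroups.IsExtension i τ) :
    -- (a) the obstruction class is well defined, and it vanishes iff there is a regular section
    ((∃! c : PartialGroups.H2 H M, PartialGroups.IsObstructionClass i τ c) ∧
      (∀ c : PartialGroups.H2 H M, PartialGroups.IsObstructionClass i τ c →
        ((∃ σ : PartialGroups.Section τ, σ.IsRegular i) ↔ c.Vanishes)) ∧
      (∀ φ : PartialGroups.TwistingPair H M, PartialGroups.IsTwistedProduct i τ φ →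
        ((∃ σ : PartialGroups.Section τ, σ.IsRegular i) ↔ φ.IsCoboundary))) ∧
    -- (b) a regular section defines an action by conjugation and a bijection `H¹ ≃ 𝔛(τ)`
    (∀ σ₀ : PartialGroups.Section τ, σ₀.IsRegular i →
      ∃ ρ : PartialGroups.Action H M, PartialGroups.IsConjugationAction i σ₀ ρ ∧
        (∀ ρ' : PartialGroups.Action H M,
          PartialGroups.IsConjugationAction i σ₀ ρ' → ρ' = ρ) ∧
        ∃ (Φ : PartialGroups.Derivation ρ ≃ PartialGroups.Section τ)
          (Ψ : PartialGroups.H1 ρ ≃ PartialGroups.SectionClasses τ),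
          (∀ (θ : PartialGroups.Derivation ρ) (h : H _⦋1⦌),
            PartialGroups.IsProd E ![i.app (op ⦋1⦌) (θ.map 1 h), σ₀.1.app (op ⦋1⦌) h]
              ((Φ θ).1.app (op ⦋1⦌) h)) ∧
          (∀ θ : PartialGroups.Derivation ρ, Ψ (Quot.mk _ θ) = Quot.mk _ (Φ θ)) ∧
          (∀ θ : PartialGroups.Derivation ρ, θ.IsRegular ↔ (Φ θ).IsRegular i)) := by
  exact ⟨PartialGroups.obstruction hτ.isExt, fun _ =>
    PartialGroups.exists_conjugationAction hτ.isExt⟩
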